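/- Let $\mathsf H_{\mathbb R}=\bigoplus_{i\in N}\mathsf H^{(i)}_{\mathbb R}$ ($N$ finite) be an orthogonal decomposition of a finite-dimensional real Hilbert space, let $(U_t)_{t\in\mathbb R}$ be a strongly continuous one-parameter group of orthogonal operators on $\mathsf H_{\mathbb R}$ leaving every $\mathsf H^{(i)}_{\mathbb R}$ invariant, and let $q_{ij}=q_{ji}\in(-1,1)$ for $i,j\in N$. Inner products are linear in the second variable. Let $\mathsf H_{\mathbb C}$ be the complexification of $\mathsf H_{\mathbb R}$, let $A$ be the positive invertible operator on $\mathsf H_{\mathbb C}$ with $A^{it}=U_t$, and put $\langle\xi,\zeta\rangle_U=\langle\xi,2(1+A^{-1})^{-1}\zeta\rangle$; write $\mathsf H_U$ for $\mathsf H_{\mathbb C}$ with this inner product. Let $T$ be the operator on $\mathsf H_U\otimes\mathsf H_U$ with $T(\xi\otimes\eta)=q_{ij}\,\eta\otimes\xi$ for $\xi\in\mathsf H^{(i)}_{\mathbb C}$, $\eta\in\mathsf H^{(j)}_{\mathbb C}$, let $T_k$ be $T$ acting on the legs $k,k+1$ of $\mathsf H_U^{\otimes n}$, let $\Phi$ be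 the quasi-multiplicative map on $S_n$ sending the transposition $(k,k+1)$ to $T_k$, and $P^{(n)}=\sum_{\sigma\in S_n}\Phi(\sigma)$. Let $\mathcal F_T$ be the Hilbert space completion of the algebraic Fock space $\mathcal F_{\mathrm{alg}}=\mathbb C\Omega\oplus\bigoplus_{n\ge1}\mathsf H_U^{\otimes n}$ (algebraic direct sum) for the inner product given on $\mathsf H_U^{\otimes n}$ by $\langle\xi,\eta\rangle_T=\langle\xi,P^{(n)}\eta\rangle$, tensors of different degrees being orthogonal. Let $a^*(\xi)$ be the left creation operator $\eta\mapsto\xi\otimes\eta$ on $\mathcal F_T$, and $a(\xi)$ the operator given on tensors of degree $n$ by $a(\xi)=l(\xi)(1+T_1+T_1T_2+\dots+T_1\cdots T_{n-1})$ and $a(\xi)\Omega=0$, where $l(\xi)(\xi_1\otimes\cdots\otimes\xi_n)=\langle\xi,\xi_1\rangle_U\,\xi_2\otimes\cdots\otimes\xi_n$. Let $\mathsf M_T$ be the von Neumann algebra generated by $\{a(\xi)+a^*(\xi):\xi\in\mathsf H_{\mathbb R}\}$, and $\varphi=\langle\Omega,\cdot\,\Omega\rangle$, so that $L^2(\mathsf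 M_T,\varphi)=\mathcal F_T$. Let $e_1,\dots,e_d$ be an orthonormal basis of $\mathsf H_U$ such that each $e_k$ lies in some $\mathsf H^{(j_k)}_{\mathbb C}$, let $A_k=W(e_k)\in\mathsf M_T$ be the operator with $A_k\Omega=e_k$, and let $\mathbb C[A_1,\dots,A_d]$ be the unital $*$-algebra generated by $A_1,\dots,A_d$. Then the following hold. 1. For each $k$ there is a unique linear map $\partial_k:\mathbb C[A_1,\dots,A_d]\to\mathsf M_T\,\overline\otimes\,\mathsf M_T^{\mathrm{op}}$ (the quasi-free difference quotient) with $\partial_k(xy)=(x\otimes1)\,\partial_k(y)+(1\otimes y^{\mathrm{op}})\,\partial_k(x)$ and $\partial_k(A_\ell)=\varphi(A_\ell A_k)\,1\otimes1$ for all $\ell$. There is a normalized dual system $(D_1,\dots,D_d)$ for $(A_1,\dots,A_d)$, that is, there are unbounded operators $D_k$ on $\mathcal F_T$ whose domains contain $\mathcal F_{\mathrm{alg}}$, such that $\Omega\in\operatorname{dom}D_k^*$, $D_k\Omega=0$, and $[D_k,A_\ell]=\varphi(A_\ell A_k)P_{\mathbb C\Omega}$ on $\mathcal F_{\mathrm{alg}}$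 for all $k,\ell$. 2. For every normalized dual system, $\xi_k=D_k^*\Omega$ is a conjugate variable: $\langle\xi_k,x\Omega\rangle=\langle1\otimes1,\partial_k(x)(1\otimes1)\rangle_{L^2(\mathsf M_T\overline\otimes\mathsf M_T^{\mathrm{op}})}$ for all $x\in\mathbb C[A_1,\dots,A_d]$, $1\le k\le d$. 3. The conjugate system $(\xi_1,\dots,\xi_d)$ is Lipschitz: for every $k$ the operator $\partial_k$, regarded as an unbounded operator $x\Omega\mapsto\partial_k(x)(1\otimes1)$ from $L^2(\mathsf M_T)$ to $L^2(\mathsf M_T\,\overline\otimes\,\mathsf M_T^{\mathrm{op}})$ with domain $\mathbb C[A_1,\dots,A_d]\Omega$, is closable, and for all $k,\ell$ the vector $\xi_\ell$ lies in the domain of its closure $\bar\partial_k$ and $\bar\partial_k(\xi_\ell)\in\mathsf M_T\,\overline\otimes\,\mathsf M_T^{\mathrm{op}}$, that is, $\bar\partial_k(\xi_\ell)=X(1\otimes1)$ for some $X\in\mathsf M_T\,\overline\otimes\,\mathsf M_T^{\mathrm{op}}$. -/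

import Mathlib

open scoped ComplexConjugate TensorProduct

noncomputable section

namespace MixedArakiWoods

/-! ### The complexification and the deformed inner product `⟨·, ·⟩_U` -/

/-- The complexification `H ⊕ iH` of a real space: the pair `(re, im)` is the vector `re + i im`. -/
@[ext]
structure Cplx (H : Type*) where
  re : H
  im : H

namespace Cplx

section

set_option linter.unusedSectionVars false

variable {H : Type*} [NormedAddCommGroup H] [InnerProductSpace ℝ H]

instance : Zero (Cplx H) := ⟨⟨0, 0⟩⟩
instance : Add (Cplx H) := ⟨fun x y => ⟨x.re + y.re, x.im + y.im⟩⟩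
instance : Neg (Cplx H) := ⟨fun x => ⟨-x.re, -x.im⟩⟩
instance : Sub (Cplx H) := ⟨fun x y => ⟨x.re - y.re, x.im - y.im⟩⟩
instance : SMul ℂ (Cplx H) :=
  ⟨fun c x => ⟨c.re • x.re - c.im • x.im, c.re • x.im + c.im • x.re⟩⟩

@[simp] theorem zero_re : (0 : Cplx H).re = 0 := rfl
@[simp] theorem zero_im : (0 : Cplx H).im = 0 := rfl
@[simp] theorem add_re (x y : Cplx H) : (x + y).re = x.re + y.re := rfl
@[simp] theorem add_im (x y : Cplx H) : (x + y).im = x.im + y.im := rfl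
@[simp] theorem neg_re (x : Cplx H) : (-x).re = -x.re := rfl
@[simp] theorem neg_im (x : Cplx H) : (-x).im = -x.im := rfl
@[simp] theorem sub_re (x y : Cplx H) : (x - y).re = x.re - y.re := rfl
@[simp] theorem sub_im (x y : Cplx H) : (x - y).im = x.im - y.im := rfl
@[simp] theorem smul_re (c : ℂ) (x : Cplx H) : (c • x).re = c.re • x.re - c.im • x.im := rfl
@[simp] theorem smul_im (c : ℂ) (x : Cplx H) : (c • x).im = c.re • x.im + c.im • x.re := rfl

instance (priority := 100) : AddCommGroup (Cplx H) where
  add_assoc x y z := by ext <;> simp [add_assoc]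
  zero_add x := by ext <;> simp
  add_zero x := by ext <;> simp
  add_comm x y := by ext <;> simp [add_comm]
  neg_add_cancel x := by ext <;> simp
  sub_eq_add_neg x y := by ext <;> simp [sub_eq_add_neg]
  nsmul := nsmulRec
  zsmul := zsmulRec

instance (priority := 100) : Module ℂ (Cplx H) where
  one_smul x := by ext <;> simp
  mul_smul c e x := by ext <;> simp <;> module
  smul_zero c := by ext <;> simp
  smul_add c x y := by ext <;> simp <;> module
  add_smul c e x := by ext <;> simp <;> module
  zero_smul x := by ext <;> simp

/-- `⟨a + ib, c + id⟩ = ⟨a, c⟩ + ⟨b, d⟩ + i (⟨a, d⟩ - ⟨b, c⟩)`: linear in the second variable. -/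
@[reducible]
def core : InnerProductSpace.Core ℂ (Cplx H) where
  inner x y := ⟨inner ℝ x.re y.re + inner ℝ x.im y.im, inner ℝ x.re y.im - inner ℝ x.im y.re⟩
  conj_inner_symm x y := by
    apply Complex.ext <;> simp [real_inner_comm]
  re_inner_nonneg x := by
    simpa using add_nonneg (real_inner_self_nonneg (x := x.re)) (real_inner_self_nonneg (x := x.im))
  add_left x y z := by
    apply Complex.ext <;> simp [inner_add_left] <;> ring
  smul_left x y r := by
    apply Complex.ext <;>
      simp [inner_add_left, inner_sub_left, real_inner_smul_left] <;> ring
  definite x hx := by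
    have h := congrArg Complex.re hx
    simp only [Complex.zero_re] at h
    have h1 := real_inner_self_nonneg (x := x.re)
    have h2 := real_inner_self_nonneg (x := x.im)
    ext
    · exact inner_self_eq_zero.1 (le_antisymm (by linarith) h1)
    · exact inner_self_eq_zero.1 (le_antisymm (by linarith) h2)

instance : NormedAddCommGroup (Cplx H) := (core (H := H)).toNormedAddCommGroup
instance : InnerProductSpace ℂ (Cplx H) := .ofCore _

theorem inner_eq (x y : Cplx H) : inner ℂ x y =
    ⟨inner ℝ x.re y.re + inner ℝ x.im y.im, inner ℝ x.re y.im - inner ℝ x.im y.re⟩ := rfl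

theorem norm_sq_eq (x : Cplx H) : ‖x‖ ^ 2 = ‖x.re‖ ^ 2 + ‖x.im‖ ^ 2 := by
  have := norm_sq_eq_re_inner (𝕜 := ℂ) x
  rw [this, inner_eq]
  simp

/-- The inclusion of the real space in its complexification. -/
def ofReal (x : H) : Cplx H := ⟨x, 0⟩

/-- The complex linear extension of a bounded real operator. -/
def map (B : H →L[ℝ] H) : Cplx H →L[ℂ] Cplx H :=
  LinearMap.mkContinuous
    { toFun := fun x => ⟨B x.re, B x.im⟩
      map_add' := fun x y => by ext <;> simp
      map_smul' := fun c x => by ext <;> simp }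
    ‖B‖ (fun x => by
      refine le_of_sq_le_sq ?_ (by positivity)
      have h1 := pow_le_pow_left₀ (norm_nonneg _) (B.le_opNorm x.re) 2
      have h2 := pow_le_pow_left₀ (norm_nonneg _) (B.le_opNorm x.im) 2
      rw [mul_pow, norm_sq_eq x]
      refine (norm_sq_eq (⟨B x.re, B x.im⟩ : Cplx H)).le.trans ?_
      nlinarith)
end
end Cplx

/-- A strongly continuous orthogonal representation `t ↦ U_t` of `ℝ`. -/
structure OrthogonalFlow (H : Type*) [NormedAddCommGroup H] [InnerProductSpace ℝ H] where
  toFun : ℝ → (H ≃ₗᵢ[ℝ] H)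
  map_add : ∀ s t, toFun (s + t) = toFun s * toFun t
  continuous : ∀ x : H, Continuous fun t => toFun t x

namespace OrthogonalFlow
variable {H : Type*} [NormedAddCommGroup H] [InnerProductSpace ℝ H]

/-- The infinitesimal generator `G = (d/dt) U_t |_{t = 0}`, so that `U_t = exp (t G)` if `H` is
finite dimensional. -/
def generator (U : OrthogonalFlow H) : H →L[ℝ] H :=
  deriv (fun t : ℝ => ((U.toFun t).toContinuousLinearEquiv : H →L[ℝ] H)) 0

/-- The analytic generator: the positive invertible operator `A` on the complexification such that
`A^{it} = U_t`, that is `A = exp (-i G)`. (For finite dimensional `H`.) -/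
def analyticGenerator (U : OrthogonalFlow H) : Cplx H →L[ℂ] Cplx H :=
  NormedSpace.exp (-(Complex.I • Cplx.map U.generator))

/-- The deformed inner product `⟨ξ, ζ⟩_U = ⟨ξ, 2 (1 + A⁻¹)⁻¹ ζ⟩`. -/
def twistedInner (U : OrthogonalFlow H) (ξ ζ : Cplx H) : ℂ :=
  inner ℂ ξ ((2 : ℂ) • Ring.inverse (1 + Ring.inverse U.analyticGenerator) ζ)
end OrthogonalFlow

section Hilb
variable {E : Type*} [NormedAddCommGroup E] [InnerProductSpace ℂ E] [CompleteSpace E]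

/-- The von Neumann algebra generated by a set `S` of bounded operators: the bicommutant of `S ∪ S*`
(`StarSubalgebra.centralizer` is the commutant of a set and its adjoints). -/
def vonNeumannGenerated (S : Set (E →L[ℂ] E)) : VonNeumannAlgebra E where
  toStarSubalgebra := StarSubalgebra.centralizer ℂ
    (StarSubalgebra.centralizer ℂ S : Set (E →L[ℂ] E))
  centralizer_centralizer' := by simp

/-- The dual of a Hilbert space is a Hilbert space, with `⟨⟨η, ·⟩, ⟨ζ, ·⟩⟩ = ⟨ζ, η⟩`: it is the
conjugate Hilbert space. -/
instance dualInnerProductSpace : InnerProductSpace ℂ (StrongDual ℂ E) where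
  inner f g :=
    inner ℂ ((InnerProductSpace.toDual ℂ E).symm g) ((InnerProductSpace.toDual ℂ E).symm f)
  norm_sq_eq_re_inner f := by
    rw [← norm_sq_eq_re_inner, LinearIsometryEquiv.norm_map]
  conj_inner_symm f g := inner_conj_symm _ _
  add_left f g h := by rw [map_add, inner_add_right]
  smul_left f g c := by rw [LinearIsometryEquiv.map_smulₛₗ, inner_smul_right]

/-- The Hilbert space tensor product `E ⊗ E*`. If `M` acts on `E` with cyclic unit vector `Ω` and
`φ = ⟨Ω, · Ω⟩`, then `L²(M, φ) = E`, and `L²(Mᵒᵖ, φᵒᵖ) = E*` with `bᵒᵖ f = f ∘ b` and the cyclic vector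
`⟨Ω, ·⟩`; so this is `L²(M ⊗ Mᵒᵖ, φ ⊗ φᵒᵖ)`. -/
abbrev StdTensor (E : Type*) [NormedAddCommGroup E] [InnerProductSpace ℂ E] [CompleteSpace E] :
    Type _ :=
  UniformSpace.Completion (E ⊗[ℂ] StrongDual ℂ E)

/-- The operator `a ⊗ bᵒᵖ`, acting by `x ⊗ f ↦ a x ⊗ (f ∘ b)`. -/
def tensorOp (a b : E →L[ℂ] E) : StdTensor E →L[ℂ] StdTensor E :=
  (TensorProduct.mapL a (ContinuousLinearMap.precomp ℂ b)).completion

end Hilb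

/-! ### The deformed inner product on the algebraic Fock space -/

/-- Words `w = w₀ w₁ ⋯ w_{n-1}` in the letters `0, …, d-1`; `⟨n, w⟩` indexes the simple tensor
`e_w = e_{w₀} ⊗ ⋯ ⊗ e_{w_{n-1}}`, and the word of length `0` indexes the vacuum. -/
abbrev Word (d : ℕ) : Type := Σ n : ℕ, (Fin n → Fin d)

/-- The algebraic full Fock space `⨁ₙ V^{⊗n}` over a space `V` with basis `e_0, …, e_{d-1}`:
finite linear combinations of the simple tensors `e_w`. -/
abbrev FockVec (d : ℕ) : Type := Word d →₀ ℂ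

/-- The product of `Q (w s) (w t)` over all inversions `s < t`, `σ t < σ s` of `σ`. -/
def crossWeight {d n : ℕ} (Q : Fin d → Fin d → ℝ) (σ : Equiv.Perm (Fin n))
    (w : Fin n → Fin d) : ℝ :=
  ∏ p ∈ Finset.univ.filter (fun p : Fin n × Fin n => p.1 < p.2 ∧ σ p.2 < σ p.1), Q (w p.1) (w p.2)

/-- The vector `Φ(σ) e_w`, where `Φ` is the quasi-multiplicative map with `Φ(τ_k) = T_k`, the operator
`T (e_k ⊗ e_l) = Q k l • e_l ⊗ e_k` in the legs `k, k+1`. Along a reduced word of `σ` each inverted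
pair of legs is interchanged exactly once, and contributes the factor `Q`; the leg in position `s`
ends up in position `σ s`. -/
def twistedPerm {d n : ℕ} (Q : Fin d → Fin d → ℝ) (σ : Equiv.Perm (Fin n))
    (w : Fin n → Fin d) : FockVec d :=
  Finsupp.single ⟨n, w ∘ ⇑σ⁻¹⟩ (crossWeight Q σ w : ℂ)

/-- The operator which is `P⁽ⁿ⁾ = ∑_{σ ∈ S_n} Φ(σ)` on the tensors of degree `n`, for every `n`. -/
def symmetrizer {d : ℕ} (Q : Fin d → Fin d → ℝ) : FockVec d →ₗ[ℂ] FockVec d :=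
  Finsupp.linearCombination ℂ (fun w : Word d => ∑ σ : Equiv.Perm (Fin w.1), twistedPerm Q σ w.2)

/-- The inner product of the full Fock space, for which the `e_w` are orthonormal (conjugate linear
in the first variable). -/
def freeForm {d : ℕ} (x y : FockVec d) : ℂ := x.sum fun w a => conj a * y w

/-- The deformed inner product `⟨x, y⟩_T = ⟨x, P y⟩`. -/
def deformedForm {d : ℕ} (Q : Fin d → Fin d → ℝ) (x y : FockVec d) : ℂ :=
  freeForm x (symmetrizer Q y)

theorem symmetrizer_apply {d n : ℕ} (Q : Fin d → Fin d → ℝ) (y : FockVec d) (v : Fin n → Fin d) :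
    symmetrizer Q y ⟨n, v⟩
      = ∑ σ : Equiv.Perm (Fin n), (crossWeight Q σ (v ∘ ⇑σ) : ℂ) * y ⟨n, v ∘ ⇑σ⟩ := by
  classical
  induction y using Finsupp.induction_linear with
  | zero => simp
  | add f g hf hg => simp [hf, hg, mul_add, Finset.sum_add_distrib]
  | single w a =>
    obtain ⟨m, w⟩ := w
    simp only [symmetrizer, Finsupp.linearCombination_single, Finsupp.smul_apply,
      Finsupp.finsetSum_apply, twistedPerm, smul_eq_mul, Finset.mul_sum]
    by_cases h : m = n
    · subst h
      refine Finset.sum_congr rfl fun σ _ => ?_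
      by_cases h2 : w = v ∘ ⇑σ
      · subst h2
        have : (v ∘ ⇑σ) ∘ ⇑σ⁻¹ = v := by ext i; simp
        rw [this]; simp [mul_comm]
      · have h3 : w ∘ ⇑σ⁻¹ ≠ v := by
          rintro rfl; exact h2 (by ext i; simp)
        rw [Finsupp.single_eq_of_ne (by simpa using Ne.symm h3),
          Finsupp.single_eq_of_ne (by simpa using Ne.symm h2)]
        simp
    · rw [Finset.sum_eq_zero, Finset.sum_eq_zero]
      · intro σ _
        rw [Finsupp.single_eq_of_ne]; · simp
        intro hh; exact h (congrArg Sigma.fst hh).symm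
      · intro σ _
        rw [Finsupp.single_eq_of_ne]; · simp
        intro hh; exact h (congrArg Sigma.fst hh).symm

theorem freeForm_eq {d : ℕ} (x y : FockVec d) (s : Finset ℕ)
    (hs : ∀ w ∈ x.support, w.1 ∈ s) :
    freeForm x y = ∑ n ∈ s, ∑ v : Fin n → Fin d, conj (x ⟨n, v⟩) * y ⟨n, v⟩ := by
  rw [freeForm, Finsupp.sum, ← Finset.sum_sigma (s := s) (t := fun n => Finset.univ)
    (f := fun w : Word d => conj (x w) * y w)]
  refine Finset.sum_subset (fun w hw => by simpa using hs w hw) ?_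
  intro w _ hw
  simp [Finsupp.notMem_support_iff.1 hw]

theorem crossWeight_inv {d n : ℕ} (Q : Fin d → Fin d → ℝ) (hQ : ∀ k l, Q k l = Q l k)
    (σ : Equiv.Perm (Fin n)) (v : Fin n → Fin d) :
    crossWeight Q σ⁻¹ v = crossWeight Q σ (v ∘ ⇑σ) := by
  unfold crossWeight
  refine Finset.prod_bij' (fun p _ => (σ⁻¹ p.2, σ⁻¹ p.1)) (fun p _ => (σ p.2, σ p.1))
    ?_ ?_ ?_ ?_ ?_
  · intro p hp; simp at hp ⊢; exact ⟨hp.2, hp.1⟩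
  · intro p hp; simp at hp ⊢; exact ⟨hp.2, hp.1⟩
  · intro p hp; simp
  · intro p hp; simp
  · intro p hp; simp [hQ]

theorem level_symm {d n : ℕ} (Q : Fin d → Fin d → ℝ) (hQ : ∀ k l, Q k l = Q l k)
    (f g : (Fin n → Fin d) → ℂ) :
    ∑ v : Fin n → Fin d, conj (f v) * ∑ σ : Equiv.Perm (Fin n),
        (crossWeight Q σ (v ∘ ⇑σ) : ℂ) * g (v ∘ ⇑σ)
      = ∑ v : Fin n → Fin d, ∑ σ : Equiv.Perm (Fin n),
        conj (f (v ∘ ⇑σ)) * (crossWeight Q σ (v ∘ ⇑σ) : ℂ) * g v := by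
  simp only [Finset.mul_sum]
  rw [Finset.sum_comm, Finset.sum_comm (s := Finset.univ (α := Fin n → Fin d))]
  rw [← Equiv.sum_comp (Equiv.inv (Equiv.Perm (Fin n)))]
  refine Finset.sum_congr rfl fun σ _ => ?_
  rw [← Equiv.sum_comp (Equiv.arrowCongr (Equiv.refl (Fin n)) (Equiv.refl (Fin d)) |>.trans
    (Equiv.arrowCongr σ⁻¹ (Equiv.refl (Fin d))))]
  refine Finset.sum_congr rfl fun v _ => ?_
  have h1 : ∀ u : Fin n → Fin d, (u ∘ ⇑σ) ∘ ⇑σ⁻¹ = u := fun u => by ext i; simp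
  have h2 : (Equiv.arrowCongr (Equiv.refl (Fin n)) (Equiv.refl (Fin d)) |>.trans
    (Equiv.arrowCongr σ⁻¹ (Equiv.refl (Fin d)))) v = v ∘ ⇑σ := by
    ext i; simp [Equiv.arrowCongr]; rfl
  rw [h2]
  simp only [Equiv.inv_apply, h1]
  rw [crossWeight_inv Q hQ]
  ring

theorem deformedForm_symm {d : ℕ} (Q : Fin d → Fin d → ℝ) (hQ : ∀ k l, Q k l = Q l k)
    (x y : FockVec d) : conj (deformedForm Q y x) = deformedForm Q x y := by
  classical
  unfold deformedForm
  have hx : ∀ w ∈ x.support, w.1 ∈ (x.support ∪ y.support).image Sigma.fst := fun w hw =>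
    Finset.mem_image_of_mem _ (Finset.mem_union_left _ hw)
  have hy : ∀ w ∈ y.support, w.1 ∈ (x.support ∪ y.support).image Sigma.fst := fun w hw =>
    Finset.mem_image_of_mem _ (Finset.mem_union_right _ hw)
  rw [freeForm_eq y _ _ hy, freeForm_eq x _ _ hx, map_sum]
  refine Finset.sum_congr rfl fun n _ => ?_
  simp only [symmetrizer_apply]
  rw [level_symm Q hQ (fun v => x ⟨n, v⟩) (fun v => y ⟨n, v⟩), map_sum]
  refine Finset.sum_congr rfl fun v _ => ?_
  simp only [map_mul, map_sum, Complex.conj_conj, Complex.conj_ofReal, Finset.mul_sum]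
  refine Finset.sum_congr rfl fun σ _ => ?_
  ring


theorem freeForm_add_left {d : ℕ} (x y z : FockVec d) :
    freeForm (x + y) z = freeForm x z + freeForm y z := by
  unfold freeForm
  rw [Finsupp.sum_add_index'] <;> intros <;> simp [add_mul]

theorem freeForm_smul_left {d : ℕ} (r : ℂ) (x z : FockVec d) :
    freeForm (r • x) z = conj r * freeForm x z := by
  unfold freeForm
  rw [Finsupp.sum_smul_index (by simp), Finsupp.mul_sum]
  simp [mul_assoc]

section Positivity

open scoped ComplexOrder

theorem sign_kernel_posSemidef {ι : Type*} [Fintype ι] [DecidableEq ι] (r : ℝ) (hr : |r| ≤ 1)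
    (P : ι → Prop) [DecidablePred P] :
    (Matrix.of fun i j : ι => if (P i ↔ P j) then (1 : ℂ) else (r : ℂ)).PosSemidef := by
  have h1 : 0 ≤ (1 + r) / 2 := by linarith [neg_le_of_abs_le hr]
  have h2 : 0 ≤ (1 - r) / 2 := by linarith [le_of_abs_le hr]
  have e : (Matrix.of fun i j : ι => if (P i ↔ P j) then (1 : ℂ) else (r : ℂ))
      = (((1 + r) / 2 : ℝ) : ℂ) • Matrix.vecMulVec (fun _ : ι => (1 : ℂ)) (star fun _ : ι => (1 : ℂ))
        + (((1 - r) / 2 : ℝ) : ℂ) • Matrix.vecMulVec (fun i : ι => if P i then (1 : ℂ) else -1)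
          (star fun i : ι => if P i then (1 : ℂ) else -1) := by
    ext i j
    by_cases hi : P i <;> by_cases hj : P j <;>
      simp [Matrix.vecMulVec_apply, hi, hj] <;> ring
  rw [e]
  refine Matrix.PosSemidef.add ?_ ?_
  · exact (Matrix.posSemidef_vecMulVec_self_star _).smul (by exact_mod_cast h1)
  · exact (Matrix.posSemidef_vecMulVec_self_star _).smul (by exact_mod_cast h2)

theorem prod_kernel_posSemidef {ι κ : Type*} [Fintype ι] [DecidableEq ι] (s : Finset κ)
    (A : κ → ι → ι → ℂ) (hA : ∀ k ∈ s, (Matrix.of (A k)).PosSemidef) :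
    (Matrix.of fun i j : ι => ∏ k ∈ s, A k i j).PosSemidef := by
  classical
  induction s using Finset.induction_on with
  | empty =>
    have : (Matrix.of fun i j : ι => ∏ k ∈ (∅ : Finset κ), A k i j)
        = Matrix.vecMulVec (fun _ : ι => (1 : ℂ)) (star fun _ : ι => (1 : ℂ)) := by
      ext i j; simp [Matrix.vecMulVec_apply]
    rw [this]; exact Matrix.posSemidef_vecMulVec_self_star _
  | insert a s ha ih =>
    have : (Matrix.of fun i j : ι => ∏ k ∈ insert a s, A k i j)
        = Matrix.hadamard (Matrix.of (A a)) (Matrix.of fun i j : ι => ∏ k ∈ s, A k i j) := by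
      ext i j; simp [Finset.prod_insert ha, Matrix.hadamard]
    rw [this]
    exact (hA a (Finset.mem_insert_self _ _)).hadamard
      (ih fun k hk => hA k (Finset.mem_insert_of_mem hk))

theorem crossWeight_eq_prod {d n : ℕ} (Q : Fin d → Fin d → ℝ) (hQ : ∀ k l, Q k l = Q l k)
    (c : Fin n → Fin d) (ρ τ : Equiv.Perm (Fin n)) :
    (crossWeight Q (ρ⁻¹ * τ) (c ∘ ⇑τ) : ℂ)
      = ∏ p ∈ Finset.univ.filter (fun p : Fin n × Fin n => p.1 < p.2),
        if (ρ⁻¹ p.1 < ρ⁻¹ p.2 ↔ τ⁻¹ p.1 < τ⁻¹ p.2) then (1 : ℂ) else (Q (c p.1) (c p.2) : ℂ) := by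
  have h : crossWeight Q (ρ⁻¹ * τ) (c ∘ ⇑τ)
      = ∏ p ∈ Finset.univ.filter (fun p : Fin n × Fin n => p.1 < p.2),
        if (ρ⁻¹ p.1 < ρ⁻¹ p.2 ↔ τ⁻¹ p.1 < τ⁻¹ p.2) then (1 : ℝ) else Q (c p.1) (c p.2) := by
    rw [← Finset.prod_filter_not_mul_prod_filter _
      (fun p : Fin n × Fin n => ¬ (ρ⁻¹ p.1 < ρ⁻¹ p.2 ↔ τ⁻¹ p.1 < τ⁻¹ p.2))]
    rw [Finset.prod_congr rfl (fun p hp => if_neg (Finset.mem_filter.1 hp).2),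
      Finset.prod_congr rfl (g := fun _ => (1 : ℝ)) (fun p hp => if_pos (not_not.1 (Finset.mem_filter.1 hp).2))]
    rw [Finset.prod_const_one, one_mul, crossWeight]
    refine Finset.prod_bij'
      (fun p _ => if τ p.1 < τ p.2 then (τ p.1, τ p.2) else (τ p.2, τ p.1))
      (fun p _ => if τ⁻¹ p.1 < τ⁻¹ p.2 then (τ⁻¹ p.1, τ⁻¹ p.2) else (τ⁻¹ p.2, τ⁻¹ p.1))
      ?_ ?_ ?_ ?_ ?_
    · rintro ⟨a, b⟩ hp
      obtain ⟨-, h1, h2⟩ := Finset.mem_filter.1 hp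
      have h1 : a < b := h1
      have h2 : ρ⁻¹ (τ b) < ρ⁻¹ (τ a) := h2
      have hne : τ a ≠ τ b := fun h => h1.ne (τ.injective h)
      have ht' : ∀ x, τ⁻¹ (τ x) = x := fun x => by simp
      by_cases h3 : τ a < τ b
      · simp only [if_pos h3, Finset.mem_filter, Finset.mem_univ, true_and, ht']
        exact ⟨h3, fun hh => absurd (hh.2 h1) (not_lt.2 h2.le)⟩
      · simp only [if_neg h3, Finset.mem_filter, Finset.mem_univ, true_and, ht']
        exact ⟨lt_of_le_of_ne (not_lt.1 h3) hne.symm, fun hh => absurd (hh.1 h2) (not_lt.2 h1.le)⟩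
    · rintro ⟨a, b⟩ hp
      obtain ⟨hh, h2⟩ := Finset.mem_filter.1 hp
      have h1 : a < b := (Finset.mem_filter.1 hh).2
      have h2 : ¬ (ρ⁻¹ a < ρ⁻¹ b ↔ τ⁻¹ a < τ⁻¹ b) := h2
      have hne : τ⁻¹ a ≠ τ⁻¹ b := fun h => h1.ne ((τ⁻¹).injective h)
      have hne2 : ρ⁻¹ a ≠ ρ⁻¹ b := fun h => h1.ne ((ρ⁻¹).injective h)
      have ht : ∀ x, τ (τ⁻¹ x) = x := fun x => by simp
      refine Finset.mem_filter.2 ⟨Finset.mem_univ _, ?_⟩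
      by_cases h3 : τ⁻¹ a < τ⁻¹ b
      · rw [if_pos h3]
        refine ⟨h3, ?_⟩
        change ρ⁻¹ (τ (τ⁻¹ b)) < ρ⁻¹ (τ (τ⁻¹ a))
        rw [ht, ht]
        exact lt_of_le_of_ne (not_lt.1 fun h => h2 ⟨fun _ => h3, fun _ => h⟩) hne2.symm
      · rw [if_neg h3]
        refine ⟨lt_of_le_of_ne (not_lt.1 h3) hne.symm, ?_⟩
        change ρ⁻¹ (τ (τ⁻¹ a)) < ρ⁻¹ (τ (τ⁻¹ b))
        rw [ht, ht]
        by_contra h4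
        exact h2 ⟨fun h => absurd h h4, fun h => absurd h h3⟩
    · rintro ⟨a, b⟩ hp
      simp only [Finset.mem_filter, Finset.mem_univ, true_and] at hp
      split_ifs with h1 h2 h2 <;> simp_all
      all_goals omega
    · rintro ⟨a, b⟩ hp
      simp only [Finset.mem_filter, Finset.mem_univ, true_and] at hp
      split_ifs with h1 h2 h2 <;> simp_all
      all_goals omega
    · rintro ⟨a, b⟩ hp
      split_ifs with h1
      · rfl
      · exact hQ _ _
  rw [h, Complex.ofReal_prod]
  refine Finset.prod_congr rfl fun p _ => ?_
  split_ifs <;> simp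

theorem level_nonneg {d n : ℕ} (Q : Fin d → Fin d → ℝ) (hQ : ∀ k l, Q k l = Q l k)
    (hQ1 : ∀ k l, |Q k l| ≤ 1) (f : (Fin n → Fin d) → ℂ) :
    0 ≤ ∑ v : Fin n → Fin d, conj (f v) * ∑ σ : Equiv.Perm (Fin n),
        (crossWeight Q σ (v ∘ ⇑σ) : ℂ) * f (v ∘ ⇑σ) := by
  set S := ∑ v : Fin n → Fin d, conj (f v) * ∑ σ : Equiv.Perm (Fin n),
        (crossWeight Q σ (v ∘ ⇑σ) : ℂ) * f (v ∘ ⇑σ) with hS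
  have key : (Fintype.card (Equiv.Perm (Fin n)) : ℂ) * S
      = ∑ c : Fin n → Fin d, ∑ ρ : Equiv.Perm (Fin n), conj (f (c ∘ ⇑ρ)) *
        ∑ τ : Equiv.Perm (Fin n), (crossWeight Q (ρ⁻¹ * τ) (c ∘ ⇑τ) : ℂ) * f (c ∘ ⇑τ) := by
    rw [Finset.sum_comm]
    rw [← nsmul_eq_mul, ← Finset.card_univ, ← Finset.sum_const]
    refine Finset.sum_congr rfl fun ρ _ => ?_
    rw [hS, ← Equiv.sum_comp (Equiv.arrowCongr ρ⁻¹ (Equiv.refl (Fin d)))]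
    refine Finset.sum_congr rfl fun c _ => ?_
    have h2 : (Equiv.arrowCongr ρ⁻¹ (Equiv.refl (Fin d))) c = c ∘ ⇑ρ := by
      ext i; simp [Equiv.arrowCongr]; rfl
    rw [h2]
    congr 1
    rw [← Equiv.sum_comp (Equiv.mulLeft ρ)
      (fun τ => (crossWeight Q (ρ⁻¹ * τ) (c ∘ ⇑τ) : ℂ) * f (c ∘ ⇑τ))]
    refine Finset.sum_congr rfl fun σ _ => ?_
    simp only [Equiv.coe_mulLeft, inv_mul_cancel_left, Equiv.Perm.coe_mul, Function.comp_assoc]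
  have hpos : 0 ≤ (Fintype.card (Equiv.Perm (Fin n)) : ℂ) * S := by
    rw [key]
    refine Finset.sum_nonneg fun c _ => ?_
    have hM := prod_kernel_posSemidef (ι := Equiv.Perm (Fin n))
      (Finset.univ.filter (fun p : Fin n × Fin n => p.1 < p.2))
      (fun p ρ τ => if (ρ⁻¹ p.1 < ρ⁻¹ p.2 ↔ τ⁻¹ p.1 < τ⁻¹ p.2) then (1 : ℂ)
        else (Q (c p.1) (c p.2) : ℂ))
      (fun p _ => sign_kernel_posSemidef (Q (c p.1) (c p.2)) (hQ1 _ _)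
        (fun ρ : Equiv.Perm (Fin n) => ρ⁻¹ p.1 < ρ⁻¹ p.2))
    have := hM.dotProduct_mulVec_nonneg (fun ρ => f (c ∘ ⇑ρ))
    simpa only [dotProduct, Matrix.mulVec, Matrix.of_apply, ← crossWeight_eq_prod Q hQ,
      Pi.star_apply, ← starRingEnd_apply] using this
  have hc : (Fintype.card (Equiv.Perm (Fin n)) : ℂ) ≠ 0 := by
    exact_mod_cast Fintype.card_ne_zero
  have hc' : (0 : ℂ) ≤ (((Fintype.card (Equiv.Perm (Fin n)) : ℝ)⁻¹ : ℝ) : ℂ) := by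
    rw [Complex.zero_le_real]; positivity
  have := mul_nonneg hc' hpos
  rwa [Complex.ofReal_inv, Complex.ofReal_natCast, inv_mul_cancel_left₀ hc] at this

theorem deformedForm_nonneg {d : ℕ} (Q : Fin d → Fin d → ℝ) (hQ : ∀ k l, Q k l = Q l k)
    (hQ1 : ∀ k l, |Q k l| ≤ 1) (x : FockVec d) : 0 ≤ deformedForm Q x x := by
  classical
  unfold deformedForm
  rw [freeForm_eq x _ (x.support.image Sigma.fst) fun w hw => Finset.mem_image_of_mem _ hw]
  refine Finset.sum_nonneg fun n _ => ?_
  simp only [symmetrizer_apply]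
  exact level_nonneg Q hQ hQ1 (fun v => x ⟨n, v⟩)

end Positivity

/-! ### Mixed q-Araki-Woods data -/

/-- The data of a mixed `q`-Araki-Woods algebra: an orthogonal representation `U` on the real Hilbert
space `H`, an orthogonal decomposition `H = ⨁ᵢ H⁽ⁱ⁾` into `U`-invariant subspaces, and a symmetric
matrix `(q i j)` with entries in `(-1, 1)`. -/
structure MixedData (H : Type*) [NormedAddCommGroup H] [InnerProductSpace ℝ H] (N : Type*) where
  flow : OrthogonalFlow H
  summand : N → Submodule ℝ H
  orthogonal : ∀ i j, i ≠ j → summand i ⟂ summand j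
  iSup_summand : ⨆ i, summand i = ⊤
  invariant : ∀ i t, ∀ x ∈ summand i, flow.toFun t x ∈ summand i
  q : N → N → ℝ
  q_symm : ∀ i j, q i j = q j i
  abs_q_lt_one : ∀ i j, |q i j| < 1

/-- A basis `e_0, …, e_{d-1}` of the complexification, orthonormal for `⟨·, ·⟩_U`, with each `e_k` in
the complexification of `H⁽ⁱ⁾`, `i = color k`. -/
structure AdaptedBasis {H : Type*} [NormedAddCommGroup H] [InnerProductSpace ℝ H] {N : Type*}
    (D : MixedData H N) (d : ℕ) where
  vec : Fin d → Cplx H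
  color : Fin d → N
  re_mem : ∀ k, (vec k).re ∈ D.summand (color k)
  im_mem : ∀ k, (vec k).im ∈ D.summand (color k)
  orthonormal : ∀ k l, D.flow.twistedInner (vec k) (vec l) = if k = l then 1 else 0
  span_eq_top : Submodule.span ℂ (Set.range vec) = ⊤

namespace AdaptedBasis

section
variable {H : Type*} [NormedAddCommGroup H] [InnerProductSpace ℝ H] {N : Type*}
  {D : MixedData H N} {d : ℕ}

/-- The parameter `q` of a pair of basis vectors. -/
def Q (e : AdaptedBasis D d) (k l : Fin d) : ℝ := D.q (e.color k) (e.color l)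

theorem Q_symm (e : AdaptedBasis D d) (k l : Fin d) : e.Q k l = e.Q l k := D.q_symm _ _

theorem abs_Q_le (e : AdaptedBasis D d) (k l : Fin d) : |e.Q k l| ≤ 1 := (D.abs_q_lt_one _ _).le

/-- The algebraic Fock space, spanned by the simple tensors `e_w`, with the inner product
`⟨·, ·⟩_T`. -/
def FockAlg (_e : AdaptedBasis D d) : Type := FockVec d

instance (priority := 100) (e : AdaptedBasis D d) : AddCommGroup e.FockAlg :=
  inferInstanceAs (AddCommGroup (FockVec d))

instance (priority := 100) (e : AdaptedBasis D d) : Module ℂ e.FockAlg :=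
  inferInstanceAs (Module ℂ (FockVec d))

@[reducible]
def fockCore (e : AdaptedBasis D d) : PreInnerProductSpace.Core ℂ e.FockAlg where
  inner x y := deformedForm e.Q x y
  conj_inner_symm x y := deformedForm_symm e.Q e.Q_symm x y
  re_inner_nonneg x := (Complex.nonneg_iff.1 (deformedForm_nonneg e.Q e.Q_symm e.abs_Q_le x)).1
  add_left x y _ := freeForm_add_left x y _
  smul_left x _ r := freeForm_smul_left r x _

instance (e : AdaptedBasis D d) : SeminormedAddCommGroup e.FockAlg :=
  letI := e.fockCore
  InnerProductSpace.Core.toSeminormedAddCommGroup (𝕜 := ℂ)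

instance (e : AdaptedBasis D d) : InnerProductSpace ℂ e.FockAlg := .ofCore _

/-- The `T`-deformed Fock space `ℱ_T(H_U)`: the Hilbert space completion of the algebraic Fock space
for the inner product `⟨·, ·⟩_T`. -/
abbrev Fock (e : AdaptedBasis D d) : Type := UniformSpace.Completion e.FockAlg

/-- The canonical map of the algebraic Fock space into its completion. -/
def incl (e : AdaptedBasis D d) : e.FockAlg →ₗ[ℂ] e.Fock :=
  (UniformSpace.Completion.toComplₗᵢ (𝕜 := ℂ) (E := e.FockAlg)).toLinearMap

/-- The simple tensor `e_w` in the algebraic Fock space. -/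
def word (e : AdaptedBasis D d) (w : Word d) : e.FockAlg := (Finsupp.single w 1 : FockVec d)

/-- The vacuum vector `Ω`. -/
def vacuum (e : AdaptedBasis D d) : e.Fock := e.incl (e.word ⟨0, Fin.elim0⟩)

/-- The basis vector `e_k`, as a vector of the Fock space. -/
def letter (e : AdaptedBasis D d) (k : Fin d) : e.Fock := e.incl (e.word ⟨1, fun _ => k⟩)

/-- The linear map on the algebraic Fock space with given values at the simple tensors `e_w`. -/
def ofWords (e : AdaptedBasis D d) (f : Word d → e.FockAlg) : e.FockAlg →ₗ[ℂ] e.FockAlg :=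
  Finsupp.linearCombination ℂ f

/-- The creation operator: `ξ = ∑ₖ ⟨e_k, ξ⟩_U e_k` and `a*(ξ) e_w = ξ ⊗ e_w`. -/
def createAlg (e : AdaptedBasis D d) (ξ : Cplx H) : e.FockAlg →ₗ[ℂ] e.FockAlg :=
  e.ofWords fun w => ∑ k, D.flow.twistedInner (e.vec k) ξ • e.word ⟨w.1 + 1, Fin.cons k w.2⟩

/-- The annihilation operator `a(ξ) = l(ξ) (1 + T₁ + T₁ T₂ + ⋯ + T₁ ⋯ T_{n-1})` on tensors of
degree `n`: the operator `T₁ ⋯ T_t` moves the letter `w_t` of `w₀ ⋯ w_{n-1}` to the front, with the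
factor `∏_{s < t} Q w_s w_t`, and `l(ξ)` removes the first letter `w_t`, with the factor
`⟨ξ, e_{w_t}⟩_U`. -/
def annihilateAlg (e : AdaptedBasis D d) (ξ : Cplx H) : e.FockAlg →ₗ[ℂ] e.FockAlg :=
  e.ofWords fun
    | ⟨0, _⟩ => 0
    | ⟨n + 1, w⟩ => ∑ t : Fin (n + 1),
        (D.flow.twistedInner ξ (e.vec (w t)) *
          ((∏ s ∈ Finset.univ.filter (fun s => s < t), e.Q (w s) (w t) : ℝ) : ℂ)) •
        e.word ⟨n, t.removeNth w⟩

/-- The bounded extension to the Fock space of an operator on the algebraic Fock space. (All operators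
to which this is applied below are bounded.) -/
def extend (e : AdaptedBasis D d) (f : e.FockAlg →ₗ[ℂ] e.FockAlg) : e.Fock →L[ℂ] e.Fock :=
  (e.incl ∘ₗ f).extendOfNorm e.incl

/-- The creation operator `a*(ξ)` on the Fock space. -/
def create (e : AdaptedBasis D d) (ξ : Cplx H) : e.Fock →L[ℂ] e.Fock := e.extend (e.createAlg ξ)

/-- The annihilation operator `a(ξ)` on the Fock space. -/
def annihilate (e : AdaptedBasis D d) (ξ : Cplx H) : e.Fock →L[ℂ] e.Fock :=
  e.extend (e.annihilateAlg ξ)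

/-- The mixed `q`-Araki-Woods von Neumann algebra `M_T`, generated by the operators
`s(ξ) = a(ξ) + a*(ξ)` with `ξ` in the real space. -/
def algebra (e : AdaptedBasis D d) : VonNeumannAlgebra e.Fock :=
  vonNeumannGenerated
    (Set.range fun ξ : H => e.annihilate (Cplx.ofReal ξ) + e.create (Cplx.ofReal ξ))

/-- The vacuum state `φ = ⟨Ω, · Ω⟩`. -/
def state (e : AdaptedBasis D d) (x : e.Fock →L[ℂ] e.Fock) : ℂ := inner ℂ e.vacuum (x e.vacuum)

open scoped Classical in
/-- `W(η)`: the unique operator in `M_T` with `W(η) Ω = η` (if there is one). -/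
def wick (e : AdaptedBasis D d) (η : e.Fock) : e.Fock →L[ℂ] e.Fock :=
  if h : ∃ x ∈ e.algebra, x e.vacuum = η then h.choose else 0

/-- The generators `A_k = W(e_k)`. -/
def gen (e : AdaptedBasis D d) (k : Fin d) : e.Fock →L[ℂ] e.Fock := e.wick (e.letter k)

/-- The unital `*`-algebra `ℂ[A_1, …, A_d]` generated by the `A_k`. -/
def polyAlg (e : AdaptedBasis D d) : StarSubalgebra ℂ (e.Fock →L[ℂ] e.Fock) :=
  StarAlgebra.adjoin ℂ (Set.range e.gen)

/-- The generator `A_k`, as an element of `ℂ[A_1, …, A_d]`. -/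
def polyGen (e : AdaptedBasis D d) (k : Fin d) : e.polyAlg :=
  ⟨e.gen k, StarAlgebra.subset_adjoin ℂ _ (Set.mem_range_self k)⟩

/-! ### Difference quotients, conjugate variables, dual systems -/

/-- The Hilbert space `L²(M_T ⊗ M_Tᵒᵖ)`. -/
abbrev L2Tensor (e : AdaptedBasis D d) : Type _ := StdTensor e.Fock

/-- The vector `1 ⊗ 1` of `L²(M_T ⊗ M_Tᵒᵖ)`. -/
def oneTensor (e : AdaptedBasis D d) : e.L2Tensor :=
  ((e.vacuum ⊗ₜ[ℂ] InnerProductSpace.toDual ℂ e.Fock e.vacuum :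
    e.Fock ⊗[ℂ] StrongDual ℂ e.Fock) : e.L2Tensor)

/-- The von Neumann algebra tensor product of `M_T` and `M_Tᵒᵖ`. -/
def tensorAlgebra (e : AdaptedBasis D d) : VonNeumannAlgebra e.L2Tensor :=
  vonNeumannGenerated {x | ∃ a ∈ e.algebra, ∃ b ∈ e.algebra, x = tensorOp a b}

/-- `δ` is the quasi-free difference quotient `∂_k`: a derivation from `ℂ[A_1, …, A_d]` to the von
Neumann tensor product of `M_T` and `M_Tᵒᵖ`, with `∂_k (A_l) = φ(A_l A_k) 1 ⊗ 1`. In the Leibniz rule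
`δ(xy) = x δ(y) + δ(x) y`, the bimodule structure is `x (a ⊗ bᵒᵖ) y = x a ⊗ (b y)ᵒᵖ`. -/
structure IsDiffQuotient (e : AdaptedBasis D d) (k : Fin d)
    (δ : e.polyAlg →ₗ[ℂ] (e.L2Tensor →L[ℂ] e.L2Tensor)) : Prop where
  mem : ∀ x, δ x ∈ e.tensorAlgebra
  leibniz : ∀ x y : e.polyAlg, δ (x * y)
    = tensorOp (x : e.Fock →L[ℂ] e.Fock) 1 * δ y + tensorOp 1 (y : e.Fock →L[ℂ] e.Fock) * δ x
  gen : ∀ l, δ (e.polyGen l) = e.state (e.gen l * e.gen k) • 1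

/-- A derivation on `ℂ[A_1, …, A_d]` as an unbounded operator from `L²(M_T)` to `L²(M_T ⊗ M_Tᵒᵖ)`,
with domain `ℂ[A_1, …, A_d] Ω` and values `x Ω ↦ δ(x) (1 ⊗ 1)`. -/
def unboundedOp (e : AdaptedBasis D d)
    (δ : e.polyAlg →ₗ[ℂ] (e.L2Tensor →L[ℂ] e.L2Tensor)) : e.Fock →ₗ.[ℂ] e.L2Tensor :=
  (LinearMap.range
    (LinearMap.prod
      ((ContinuousLinearMap.apply ℂ e.Fock e.vacuum).toLinearMap ∘ₗ
        e.polyAlg.toSubalgebra.toSubmodule.subtype)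
      ((ContinuousLinearMap.apply ℂ e.L2Tensor e.oneTensor).toLinearMap ∘ₗ δ))).toLinearPMap

/-- `ξ` is a conjugate variable for the derivation `δ`: `⟨ξ, x 1⟩ = ⟨1 ⊗ 1, δ(x) (1 ⊗ 1)⟩`. -/
def IsConjugateVariable (e : AdaptedBasis D d)
    (δ : e.polyAlg →ₗ[ℂ] (e.L2Tensor →L[ℂ] e.L2Tensor)) (ξ : e.Fock) : Prop :=
  ∀ x : e.polyAlg, inner ℂ ξ ((x : e.Fock →L[ℂ] e.Fock) e.vacuum)
    = inner ℂ e.oneTensor (δ x e.oneTensor)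

/-- The tuple `Δ` is a normalized dual system for `(A_1, …, A_d)`: unbounded operators whose domains
contain the algebraic Fock space and whose adjoints have `Ω` in their domains, such that
`[Δ_k, A_l] = φ(A_l A_k) P_{ℂΩ}` (on the algebraic Fock space) and `Δ_k Ω = 0`. -/
structure IsDualSystem (e : AdaptedBasis D d) (Δ : Fin d → (e.Fock →ₗ.[ℂ] e.Fock)) : Prop where
  mem_domain : ∀ k x, e.incl x ∈ (Δ k).domain
  vacuum_mem_adjoint : ∀ k, e.vacuum ∈ (Δ k).adjoint.domain
  commutator : ∀ k l x, ∃ h : e.gen l (e.incl x) ∈ (Δ k).domain,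
    Δ k ⟨e.gen l (e.incl x), h⟩ - e.gen l (Δ k ⟨e.incl x, mem_domain k x⟩)
      = e.state (e.gen l * e.gen k) • (inner ℂ e.vacuum (e.incl x) • e.vacuum)
  vacuum_eq_zero : ∀ k, Δ k ⟨e.vacuum, mem_domain k _⟩ = 0

/-- The tuple `ξ` is Lipschitz for the derivations `δ`: every `δ_k` is closable as an unbounded
operator, every `ξ_l` is in the domain of its closure, and the value of the closure at `ξ_l` is (the
vector `X (1 ⊗ 1)` of) an element `X` of the von Neumann tensor product of `M_T` and `M_Tᵒᵖ`. -/
def IsLipschitz (e : AdaptedBasis D d)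
    (δ : Fin d → (e.polyAlg →ₗ[ℂ] (e.L2Tensor →L[ℂ] e.L2Tensor))) (ξ : Fin d → e.Fock) : Prop :=
  ∀ k, (e.unboundedOp (δ k)).IsClosable ∧
    ∀ l, ∃ h : ξ l ∈ (e.unboundedOp (δ k)).closure.domain,
      ∃ X ∈ e.tensorAlgebra, X e.oneTensor = (e.unboundedOp (δ k)).closure ⟨ξ l, h⟩

end

end AdaptedBasis

end MixedArakiWoods

end

/-!
The theorem reduces to an explicit computation with words. In an adapted orthonormal basis, the simple
tensors `e_w` are indexed by words `w` in the letters `1, …, d`, and the generators are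
`A_l = a*_l + ∑ₘ c l m • a_m`, where `c l m = φ(A_l A_m)` is the covariance and the annihilation
operators satisfy `a_m a*_k = δ_{mk} + Q m k • a*_k a_m`. The decomposition of the Hilbert space enters
only through the fact that a nonzero covariance forces equal parameters `Q` of the two letters
(`AdaptedBasis.color_eq_of_cov_ne_zero`). That `a_m` is the adjoint of `a*_m` for the deformed inner
product follows by enumerating the permutations of `n + 1` letters by the position of the letter which
is moved to the front (`AdaptedBasis.wordForm_cons`).

**Cyclic and separating vacuum.** The operators `B_j`, built in the same way from right creation and
right annihilation operators, commute with all `A_l` (`TwistData.gen_genRight`), and the vacuum is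
cyclic for both families. Hence `W(e_k)` is `A_k` (`AdaptedBasis.gen_eq`), and `x ↦ x Ω` identifies the
algebra of the generators with the algebraic Fock space, as a free module over the free algebra
(`TwistData.cyclicLift`, `FockRep.injective_poly`). So the difference quotients exist and are unique
(`FockRep.exists_isDq`, `FockRep.IsDq.apply_poly`).

**Dual system.** The equations `[D_k, A_l] = c l k • P_Ω`, `D_k Ω = 0` are solved by an explicit
operator on words: a word `u j v` is contracted by pairing the letter `j` with `k`, and the letters of
`v` with letters of `u`, with all crossings counted (`TwistData.dualOp`, `TwistData.dualOp_gen`). The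
identity `⟨u ⊗ v*, ∂_k(x) (1 ⊗ 1)⟩ = ⟨u, [D_k, x] v⟩` (`FockRep.inner_dq`), at `u = v = Ω`, is the
conjugate variable relation. For `u` and `v` in the algebraic Fock space it puts `u ⊗ v*` into the
domain of the adjoint of `∂_k`, because `x v = Z x Ω` with `Z` in the commutant; so `∂_k` is closable
(`FockRep.exists_inner_dq`, `FockRep.isClosable`).

**Lipschitz property.** The vector `ξ_k = D_k^* Ω` has the inner products `⟨Ω, D_k e_w⟩` with the simple
tensors. In a contraction of a word of length `n = 2 m + 1` to the vacuum, all of the `m + 1` letters of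
`j v` cross each other, so this coefficient is of order `q ^ (m (m + 1) / 2)`, up to `n ^ O(n)`
(`TwistData.Bounds.coeff_dualOp_le`). The basis dual to the simple tensors grows only geometrically in
the `ℓ¹` norm (`TwistData.exists_dualBasis`), by inverting the operators `1 + T_1 + T_1 T_2 + ⋯` with the
braid relations, and the operator norms of the element `x` with `x Ω = e_w` and of `∂_j x` are at most of
order `n ^ O(n)` (`TwistData.Bounds.seminorm_tens_le`). So the expansion of `ξ_k` in the dual basis
converges, and so do the difference quotients of its partial sums, in operator norm
(`TwistData.Bounds.summable_dualOp`, `FockRep.exists_conjugate`). The limits are in the von Neumann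
algebra and are the values of the closure (`FockRep.exists_closure_apply`).
-/

open scoped ComplexConjugate TensorProduct

set_option linter.unusedSectionVars false

noncomputable section

namespace MixedArakiWoods

/-! ### Creation and annihilation operators on words -/

/-- The coefficients which determine the generators `A_l`: the deformation parameters `Q`, and the
covariance `c l m = φ(A_l A_m)`. A nonzero covariance forces the two letters to have the same
deformation parameters. -/
structure TwistData (ι : Type*) where
  Q : ι → ι → ℝ
  Q_symm : ∀ k l, Q k l = Q l k
  c : ι → ι → ℂ
  Q_eq : ∀ l m, c l m ≠ 0 → ∀ k, Q l k = Q m k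

/-- The algebraic full Fock space, with the simple tensors indexed by lists of letters. -/
def FreeFock (ι : Type*) := List ι →₀ ℂ

instance (ι : Type*) : AddCommGroup (FreeFock ι) := inferInstanceAs (AddCommGroup (List ι →₀ ℂ))

instance (ι : Type*) : Module ℂ (FreeFock ι) := inferInstanceAs (Module ℂ (List ι →₀ ℂ))

section Words
variable {ι : Type*} {M : Type*} [AddCommGroup M] [Module ℂ M]

/-- The simple tensor of a word. -/
def tens (w : List ι) : FreeFock ι := (Finsupp.single w 1 : List ι →₀ ℂ)

/-- The coefficient of a simple tensor. -/
def coeff (w : List ι) : FreeFock ι →ₗ[ℂ] ℂ := Finsupp.lapply (M := ℂ) (R := ℂ) w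

theorem coeff_tens_self (w : List ι) : coeff w (tens w) = 1 :=
  Finsupp.single_eq_same

theorem coeff_tens_of_ne {v w : List ι} (h : v ≠ w) : coeff v (tens w) = 0 :=
  Finsupp.single_eq_of_ne h

/-- The linear map with given values on the simple tensors. -/
def onWords (f : List ι → M) : FreeFock ι →ₗ[ℂ] M := Finsupp.linearCombination ℂ f

@[simp] theorem onWords_tens (f : List ι → M) (w : List ι) : onWords f (tens w) = f w :=
  (Finsupp.linearCombination_single ℂ 1 w).trans (one_smul ℂ _)

theorem linearMap_ext_tens {f g : FreeFock ι →ₗ[ℂ] M} (h : ∀ w, f (tens w) = g (tens w)) :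
    f = g :=
  Finsupp.lhom_ext' (M := ℂ) fun w => LinearMap.ext_ring (h w)

@[elab_as_elim]
theorem tens_induction {P : FreeFock ι → Prop} (x : FreeFock ι) (tens : ∀ w, P (tens w))
    (add : ∀ x y, P x → P y → P (x + y)) (smul : ∀ (a : ℂ) x, P x → P (a • x)) : P x := by
  refine Finsupp.induction_linear (motive := P) x ?_ add fun w a => ?_
  · have h := smul 0 _ (tens [])
    rwa [zero_smul] at h
  · have h := smul a _ (tens w)
    have e : a • MixedArakiWoods.tens w = (Finsupp.single w a : List ι →₀ ℂ) :=
      (Finsupp.smul_single _ _ _).trans (by simp)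
    rwa [e] at h

theorem span_tens : Submodule.span ℂ (Set.range (tens (ι := ι))) = ⊤ := by
  rw [eq_top_iff]
  intro x _
  induction x using tens_induction with
  | tens w => exact Submodule.subset_span ⟨w, rfl⟩
  | add x y hx hy => exact add_mem (hx trivial) (hy trivial)
  | smul a x hx => exact Submodule.smul_mem _ _ (hx trivial)

/-- The left creation operator `x ↦ e_k ⊗ x`. -/
def create (k : ι) : FreeFock ι →ₗ[ℂ] FreeFock ι := onWords fun w => tens (k :: w)

/-- The right creation operator `x ↦ x ⊗ e_k`. -/
def createRight (k : ι) : FreeFock ι →ₗ[ℂ] FreeFock ι := onWords fun w => tens (w ++ [k])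

@[simp] theorem create_tens (k : ι) (w : List ι) : create k (tens w) = tens (k :: w) := by
  simp [create]

@[simp] theorem createRight_tens (k : ι) (w : List ι) :
    createRight k (tens w) = tens (w ++ [k]) := by
  simp [createRight]

theorem createRight_create (j k : ι) (x : FreeFock ι) :
    createRight j (create k x) = create k (createRight j x) := by
  refine LinearMap.congr_fun (f := createRight j ∘ₗ create k) (g := create k ∘ₗ createRight j)
    (linearMap_ext_tens fun w => ?_) x
  simp

/-- Two linear maps agree if they agree on the vacuum, and if agreement at `x` implies agreement at
every `e_k ⊗ x`. -/
theorem eq_of_create {f g : FreeFock ι →ₗ[ℂ] M} (h0 : f (tens []) = g (tens []))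
    (h : ∀ k x, f x = g x → f (create k x) = g (create k x))
    (x : FreeFock ι) : f x = g x := by
  refine LinearMap.congr_fun (linearMap_ext_tens fun w => ?_) x
  induction w with
  | nil => exact h0
  | cons k w ih => simpa using h k _ ih

end Words

namespace TwistData

variable {ι : Type*} [DecidableEq ι] (t : TwistData ι)

/-- The value of the annihilation operator at a simple tensor: the letter `m` is removed at all its
occurrences, with the factor `Q` for each letter which it has to pass. -/
def annihilateWord (m : ι) : List ι → FreeFock ι
  | [] => 0
  | k :: w => (if m = k then tens w else 0) + (t.Q m k : ℂ) • create k (annihilateWord m w)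

/-- The left annihilation operator of the letter `m`. -/
def annihilate (m : ι) : FreeFock ι →ₗ[ℂ] FreeFock ι := onWords (t.annihilateWord m)

/-- The diagonal operator whose value at `e_w` is the factor for passing the letter `m` through the
word `w`. -/
def passing (m : ι) : FreeFock ι →ₗ[ℂ] FreeFock ι :=
  onWords fun w => (w.map fun k => (t.Q m k : ℂ)).prod • tens w

/-- The value of the right annihilation operator at a simple tensor: the letter `m` is removed at all
its occurrences, with the factor `Q` for each letter to the right of it. -/
def annihilateRightWord (m : ι) : List ι → FreeFock ι
  | [] => 0
  | k :: w => create k (annihilateRightWord m w) + (if m = k then t.passing m (tens w) else 0)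

/-- The right annihilation operator of the letter `m`. -/
def annihilateRight (m : ι) : FreeFock ι →ₗ[ℂ] FreeFock ι := onWords (t.annihilateRightWord m)

@[simp] theorem annihilate_vacuum (m : ι) : t.annihilate m (tens []) = 0 := by
  simp [annihilate, annihilateWord]

@[simp] theorem annihilateRight_vacuum (m : ι) : t.annihilateRight m (tens []) = 0 := by
  simp [annihilateRight, annihilateRightWord]

@[simp] theorem passing_vacuum (m : ι) : t.passing m (tens []) = tens [] := by
  simp [passing]

theorem passing_tens (m : ι) (w : List ι) :
    t.passing m (tens w) = (w.map fun k => (t.Q m k : ℂ)).prod • tens w := by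
  simp [passing]

theorem annihilate_create (m k : ι) (x : FreeFock ι) :
    t.annihilate m (create k x)
      = (if m = k then x else 0) + (t.Q m k : ℂ) • create k (t.annihilate m x) := by
  refine (LinearMap.congr_fun (f := t.annihilate m ∘ₗ create k)
    (g := (if m = k then LinearMap.id else 0) + (t.Q m k : ℂ) • create k ∘ₗ t.annihilate m)
    (linearMap_ext_tens fun w => ?_) x).trans ?_
  · simp only [LinearMap.comp_apply, create_tens, LinearMap.add_apply, LinearMap.smul_apply]
    simp only [annihilate, onWords_tens, annihilateWord]
    split_ifs <;> simp
  · simp only [LinearMap.comp_apply, LinearMap.add_apply, LinearMap.smul_apply]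
    split_ifs <;> simp

theorem annihilateRight_create (m k : ι) (x : FreeFock ι) :
    t.annihilateRight m (create k x)
      = create k (t.annihilateRight m x) + (if m = k then t.passing m x else 0) := by
  refine (LinearMap.congr_fun (f := t.annihilateRight m ∘ₗ create k)
    (g := create k ∘ₗ t.annihilateRight m + (if m = k then t.passing m else 0))
    (linearMap_ext_tens fun w => ?_) x).trans ?_
  · simp only [LinearMap.comp_apply, create_tens, LinearMap.add_apply]
    simp only [annihilateRight, onWords_tens, annihilateRightWord]
    split_ifs <;> simp
  · simp only [LinearMap.comp_apply, LinearMap.add_apply]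
    split_ifs <;> simp

theorem passing_create (m k : ι) (x : FreeFock ι) :
    t.passing m (create k x) = (t.Q m k : ℂ) • create k (t.passing m x) := by
  refine LinearMap.congr_fun (f := t.passing m ∘ₗ create k)
    (g := (t.Q m k : ℂ) • create k ∘ₗ t.passing m) (linearMap_ext_tens fun w => ?_) x
  simp [passing_tens, mul_smul]

theorem passing_createRight (m k : ι) (x : FreeFock ι) :
    t.passing m (createRight k x) = (t.Q m k : ℂ) • createRight k (t.passing m x) := by
  refine LinearMap.congr_fun (f := t.passing m ∘ₗ createRight k)
    (g := (t.Q m k : ℂ) • createRight k ∘ₗ t.passing m) (linearMap_ext_tens fun w => ?_) x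
  simp only [LinearMap.comp_apply, LinearMap.smul_apply, createRight_tens, passing_tens, map_smul,
    List.map_append, List.prod_append, List.map_cons, List.map_nil, List.prod_cons, List.prod_nil,
    mul_one, smul_smul]
  rw [mul_comm]

theorem annihilate_createRight (m k : ι) (x : FreeFock ι) :
    t.annihilate m (createRight k x)
      = createRight k (t.annihilate m x) + (if m = k then t.passing m x else 0) := by
  refine (eq_of_create (f := t.annihilate m ∘ₗ createRight k)
    (g := createRight k ∘ₗ t.annihilate m + (if m = k then t.passing m else 0)) ?_ ?_ x).trans ?_
  · have : tens (ι := ι) ([] ++ [k]) = create k (tens []) := by simp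
    simp only [LinearMap.comp_apply, createRight_tens, this, annihilate_create]
    split_ifs <;> simp
  · intro l w ih
    simp only [LinearMap.comp_apply, LinearMap.add_apply] at ih ⊢
    rw [createRight_create, annihilate_create, ih, annihilate_create]
    split_ifs with h1 h2 h2 <;>
      simp [createRight_create, passing_create, smul_add, add_assoc]
  · simp only [LinearMap.comp_apply, LinearMap.add_apply]
    split_ifs <;> simp

theorem annihilateRight_createRight (m k : ι) (x : FreeFock ι) :
    t.annihilateRight m (createRight k x)
      = (if m = k then x else 0) + (t.Q m k : ℂ) • createRight k (t.annihilateRight m x) := by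
  refine (eq_of_create (f := t.annihilateRight m ∘ₗ createRight k)
    (g := (if m = k then LinearMap.id else 0) + (t.Q m k : ℂ) • createRight k ∘ₗ t.annihilateRight m)
    ?_ ?_ x).trans ?_
  · have : tens (ι := ι) ([] ++ [k]) = create k (tens []) := by simp
    simp only [LinearMap.comp_apply, createRight_tens, this, annihilateRight_create]
    split_ifs <;> simp
  · intro l w ih
    simp only [LinearMap.comp_apply, LinearMap.add_apply, LinearMap.smul_apply] at ih ⊢
    rw [createRight_create, annihilateRight_create, ih, annihilateRight_create]
    split_ifs with h1 h2 h2 <;>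
      simp [createRight_create, passing_createRight, smul_add, add_assoc]
  · simp only [LinearMap.comp_apply, LinearMap.add_apply, LinearMap.smul_apply]
    split_ifs <;> simp

theorem annihilate_passing (m k : ι) (x : FreeFock ι) :
    t.annihilate m (t.passing k x) = (t.Q k m : ℂ) • t.passing k (t.annihilate m x) := by
  refine eq_of_create (f := t.annihilate m ∘ₗ t.passing k)
    (g := (t.Q k m : ℂ) • t.passing k ∘ₗ t.annihilate m) (by simp) ?_ x
  intro l w ih
  simp only [LinearMap.comp_apply, LinearMap.smul_apply] at ih ⊢
  rw [passing_create, map_smul, annihilate_create, ih, annihilate_create]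
  split_ifs with h1
  · subst h1
    simp only [map_add, map_smul, passing_create, smul_add, smul_smul]
  · simp only [zero_add, map_smul, passing_create, smul_smul]
    ring_nf

theorem annihilateRight_passing (m k : ι) (x : FreeFock ι) :
    t.annihilateRight m (t.passing k x) = (t.Q k m : ℂ) • t.passing k (t.annihilateRight m x) := by
  have comm : ∀ y, t.passing m (t.passing k y) = t.passing k (t.passing m y) := fun y => by
    refine LinearMap.congr_fun (f := t.passing m ∘ₗ t.passing k) (g := t.passing k ∘ₗ t.passing m)
      (linearMap_ext_tens fun w => ?_) y
    simp only [LinearMap.comp_apply, passing_tens, map_smul, smul_smul, mul_comm]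
  refine eq_of_create (f := t.annihilateRight m ∘ₗ t.passing k)
    (g := (t.Q k m : ℂ) • t.passing k ∘ₗ t.annihilateRight m) (by simp) ?_ x
  intro l w ih
  simp only [LinearMap.comp_apply, LinearMap.smul_apply] at ih ⊢
  rw [passing_create, map_smul, annihilateRight_create, ih, annihilateRight_create]
  split_ifs with h1
  · subst h1
    simp only [map_add, map_smul, passing_create, smul_add, smul_smul, comm]
  · simp only [add_zero, map_smul, passing_create, smul_smul]
    ring_nf

theorem annihilateRight_annihilate (m k : ι) (x : FreeFock ι) :
    t.annihilateRight m (t.annihilate k x) = t.annihilate k (t.annihilateRight m x) := by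
  refine eq_of_create (f := t.annihilateRight m ∘ₗ t.annihilate k)
    (g := t.annihilate k ∘ₗ t.annihilateRight m) (by simp) ?_ x
  intro l w ih
  simp only [LinearMap.comp_apply] at ih ⊢
  rw [annihilate_create, annihilateRight_create]
  by_cases h1 : k = l
  · subst h1
    by_cases h2 : m = k
    · subst h2
      simp [annihilateRight_create, annihilate_create, annihilate_passing, ih, smul_add, add_assoc]
    · simp [annihilateRight_create, annihilate_create, ih, h2]
  · by_cases h2 : m = l
    · subst h2
      simp [annihilateRight_create, annihilate_create, annihilate_passing, ih, smul_add, h1,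
        t.Q_symm k m]
    · simp [annihilateRight_create, annihilate_create, ih, h1, h2]

/-! ### The generators and their commutants -/

variable [Fintype ι]

/-- The annihilation part `∑ₘ c l m • a_m` of the generator `A_l`. -/
def lower (l : ι) : FreeFock ι →ₗ[ℂ] FreeFock ι := ∑ m, t.c l m • t.annihilate m

/-- The generator `A_l` on the algebraic Fock space. -/
def gen (l : ι) : FreeFock ι →ₗ[ℂ] FreeFock ι := create l + t.lower l

/-- The annihilation part `∑ₗ c l j • r_l` of the right generator `B_j`. -/
def lowerRight (j : ι) : FreeFock ι →ₗ[ℂ] FreeFock ι := ∑ l, t.c l j • t.annihilateRight l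

/-- The right generator `B_j`, which commutes with every `A_l`. -/
def genRight (j : ι) : FreeFock ι →ₗ[ℂ] FreeFock ι := createRight j + t.lowerRight j

theorem gen_apply (l : ι) (x : FreeFock ι) : t.gen l x = create l x + t.lower l x := rfl

theorem genRight_apply (j : ι) (x : FreeFock ι) :
    t.genRight j x = createRight j x + t.lowerRight j x := rfl

theorem lower_apply (l : ι) (x : FreeFock ι) :
    t.lower l x = ∑ m, t.c l m • t.annihilate m x := by simp [lower]

theorem lowerRight_apply (j : ι) (x : FreeFock ι) :
    t.lowerRight j x = ∑ l, t.c l j • t.annihilateRight l x := by simp [lowerRight]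

@[simp] theorem lower_vacuum (l : ι) : t.lower l (tens []) = 0 := by simp [lower_apply]

@[simp] theorem lowerRight_vacuum (l : ι) : t.lowerRight l (tens []) = 0 := by
  simp [lowerRight_apply]

/-- Since `c l m ≠ 0` forces equal parameters of `l` and `m`, the annihilation part of `A_l` sees only
the parameters of `l`. -/
theorem c_smul_Q (l m k : ι) : t.c l m * (t.Q m k : ℂ) = t.c l m * (t.Q l k : ℂ) := by
  by_cases h : t.c l m = 0
  · simp [h]
  · rw [t.Q_eq l m h]

theorem c_smul_passing (l m : ι) (x : FreeFock ι) :
    t.c l m • t.passing m x = t.c l m • t.passing l x := by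
  by_cases h : t.c l m = 0
  · simp [h]
  · congr 1
    have : t.passing m = t.passing l :=
      linearMap_ext_tens fun w => by simp [passing_tens, t.Q_eq l m h]
    rw [this]

theorem lower_create (l k : ι) (x : FreeFock ι) :
    t.lower l (create k x) = t.c l k • x + (t.Q l k : ℂ) • create k (t.lower l x) := by
  simp only [lower_apply, annihilate_create, smul_add, Finset.sum_add_distrib, map_sum,
    map_smul, Finset.smul_sum, smul_smul]
  congr 1
  · rw [Finset.sum_eq_single k] <;> simp +contextual
  · refine Finset.sum_congr rfl fun m _ => ?_
    rw [c_smul_Q, mul_comm]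

theorem lower_createRight (l k : ι) (x : FreeFock ι) :
    t.lower l (createRight k x) = createRight k (t.lower l x) + t.c l k • t.passing l x := by
  simp only [lower_apply, annihilate_createRight, smul_add, Finset.sum_add_distrib, map_sum,
    map_smul]
  congr 1
  rw [Finset.sum_eq_single k] <;> simp +contextual [c_smul_passing]

theorem lowerRight_create (j l : ι) (x : FreeFock ι) :
    t.lowerRight j (create l x) = create l (t.lowerRight j x) + t.c l j • t.passing l x := by
  simp only [lowerRight_apply, annihilateRight_create, smul_add, Finset.sum_add_distrib, map_sum,
    map_smul]
  congr 1
  rw [Finset.sum_eq_single l] <;> simp +contextual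

theorem lowerRight_lower (j l : ι) (x : FreeFock ι) :
    t.lowerRight j (t.lower l x) = t.lower l (t.lowerRight j x) := by
  simp only [lowerRight_apply, lower_apply, map_sum, map_smul, annihilateRight_annihilate,
    Finset.smul_sum]
  rw [Finset.sum_comm]
  exact Finset.sum_congr rfl fun _ _ => Finset.sum_congr rfl fun _ _ => smul_comm _ _ _

theorem lowerRight_gen (j l : ι) (x : FreeFock ι) :
    t.lowerRight j (t.gen l x) = t.gen l (t.lowerRight j x) + t.c l j • t.passing l x := by
  rw [gen_apply, map_add, lowerRight_create, lowerRight_lower, gen_apply]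
  abel

theorem gen_createRight (j l : ι) (x : FreeFock ι) :
    t.gen l (createRight j x) = createRight j (t.gen l x) + t.c l j • t.passing l x := by
  rw [gen_apply, gen_apply, lower_createRight, map_add, createRight_create]
  abel

/-- The left and the right generators commute: the creation and the annihilation part of `B_j` fail to
commute with `A_l` by the same multiple of `passing l`, with opposite signs. -/
theorem gen_genRight (j l : ι) (x : FreeFock ι) :
    t.gen l (t.genRight j x) = t.genRight j (t.gen l x) := by
  rw [genRight_apply, genRight_apply, map_add, gen_createRight, lowerRight_gen]
  abel

theorem lowerRight_passing (j m : ι) (x : FreeFock ι) :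
    t.lowerRight j (t.passing m x) = (t.Q m j : ℂ) • t.passing m (t.lowerRight j x) := by
  simp only [lowerRight_apply, annihilateRight_passing, map_sum, map_smul, Finset.smul_sum,
    smul_smul]
  refine Finset.sum_congr rfl fun l _ => ?_
  rw [t.Q_symm m l, t.Q_symm m j, mul_comm (t.Q j m : ℂ)]
  congr 1
  by_cases h : t.c l j = 0
  · simp [h]
  · rw [t.Q_eq l j h]

/-! ### The dual system on the algebraic Fock space -/

/-- The factor for passing the letter `j` through the word `w`. -/
def passWeight (j : ι) (w : List ι) : ℂ := (w.map fun k => (t.Q j k : ℂ)).prod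

/-- The operator `(-1)^{|v|} ∏_{a < b} Q v_a v_b • ρ_{v_0} ρ_{v_1} ⋯`, where `ρ_j` is the annihilation
part of the right generator `B_j`. -/
def contract : List ι → Module.End ℂ (FreeFock ι)
  | [] => 1
  | p :: v => -(t.passWeight p v) • (t.lowerRight p * contract v)

/-- The sum over the splittings `w = u j v` of `c j k` times the factor of `j` passing `v` times the
operator `contract v` after the right creation of `u`. -/
def dualWord (k : ι) : List ι → Module.End ℂ (FreeFock ι)
  | [] => 0
  | j :: v => (t.c j k * t.passWeight j v) • contract t v + dualWord k v * createRight j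

/-- The dual operator `D_k`, the solution of `[D_k, A_l] = c l k • P_Ω` and `D_k Ω = 0`. -/
def dualOp (k : ι) : FreeFock ι →ₗ[ℂ] FreeFock ι := onWords fun w => t.dualWord k w (tens [])

theorem c_mul_passWeight (l m : ι) (w : List ι) :
    t.c l m * t.passWeight m w = t.c l m * t.passWeight l w := by
  by_cases h : t.c l m = 0
  · simp [h]
  · simp [passWeight, t.Q_eq l m h]

/-- Contracting a letter of `w` with `A_l` removes a letter with the parameters of `l`. -/
theorem onWords_passWeight_lower {M : Type*} [AddCommGroup M] [Module ℂ M] (f : List ι → M)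
    (j l : ι) (w : List ι) :
    (t.Q j l : ℂ) • onWords (fun v => t.passWeight j v • f v) (t.lower l (tens w))
      = t.passWeight j w • onWords f (t.lower l (tens w)) := by
  induction w generalizing f with
  | nil => simp
  | cons p w ih =>
    have key : ∀ (h : List ι → M) (x : FreeFock ι),
        onWords h (create p x) = onWords (fun v => h (p :: v)) x := fun h x => by
      refine LinearMap.congr_fun (f := onWords h ∘ₗ create p) (linearMap_ext_tens fun w => ?_) x
      simp
    have hw : ∀ v, t.passWeight j (p :: v) = (t.Q j p : ℂ) * t.passWeight j v := fun v => by
      simp [passWeight]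
    have lin : ∀ (a : ℂ) (h : List ι → M) (x : FreeFock ι),
        onWords (fun v => a • h v) x = a • onWords h x := fun a h x => by
      refine LinearMap.congr_fun (g := a • onWords h) (linearMap_ext_tens fun w => ?_) x
      simp
    rw [← create_tens, lower_create]
    simp only [map_add, map_smul, key, onWords_tens, hw, mul_smul, lin, smul_add]
    rw [smul_comm (t.Q j l : ℂ) (t.Q l p : ℂ), smul_comm (t.Q j l : ℂ) (t.Q j p : ℂ), ih]
    simp only [smul_smul]
    congr 2
    · have := t.c_smul_Q l p j
      rw [t.Q_symm l j, t.Q_symm p j] at this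
      linear_combination -(t.passWeight j w) * this
    · ring

/-- Interchanging `contract v` with the factor for passing `p` costs the factor for `p` passing `v`,
whose letters have been removed. -/
theorem lowerRight_contract_passing (p : ι) (v : List ι) (x : FreeFock ι) :
    t.passWeight p v • t.passing p (t.contract v x) = t.contract v (t.passing p x) := by
  induction v with
  | nil => simp [passWeight, contract]
  | cons r v ih =>
    have hw : t.passWeight p (r :: v) = (t.Q p r : ℂ) * t.passWeight p v := by simp [passWeight]
    simp only [contract, LinearMap.smul_apply, Module.End.mul_apply, map_smul, ← ih,
      lowerRight_passing, smul_smul, hw]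
    congr 1
    ring

/-- The commutator of `contract w` with `A_l`. -/
theorem contract_gen (l : ι) (w : List ι) (x : FreeFock ι) :
    t.contract w (t.gen l x) + onWords t.contract (t.lower l (tens w)) (t.passing l x)
      = t.gen l (t.contract w x) := by
  induction w generalizing x with
  | nil => simp [contract]
  | cons p v ih =>
    have key : ∀ y : FreeFock ι, onWords t.contract (create p y)
        = (-1 : ℂ) • (t.lowerRight p * onWords (fun v => t.passWeight p v • t.contract v) y) :=
        fun y => by
      induction y using tens_induction with
      | tens w => simp only [create_tens, onWords_tens, contract, mul_smul_comm, smul_smul, neg_one_mul]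
      | add x y hx hy => rw [map_add, map_add, hx, hy, map_add, mul_add, smul_add]
      | smul a x hx =>
        rw [map_smul, map_smul, hx, map_smul, mul_smul_comm, smul_comm (-1 : ℂ)]
    rw [← create_tens p v, lower_create, map_add, map_smul, map_smul, onWords_tens, key]
    have h2 := congrArg (fun f : Module.End ℂ (FreeFock ι) => t.lowerRight p (f (t.passing l x)))
      (t.onWords_passWeight_lower t.contract p l v)
    simp only [LinearMap.smul_apply, map_smul] at h2
    simp only [contract, LinearMap.smul_apply, LinearMap.add_apply,
      Module.End.mul_apply, map_smul, smul_comm _ (-1 : ℂ), t.Q_symm l p, h2]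
    have h3 := t.lowerRight_gen p l (t.contract v x)
    rw [← ih, map_add] at h3
    rw [← sub_eq_iff_eq_add] at h3
    rw [← h3, ← t.lowerRight_contract_passing l v x]
    have h4 := t.c_mul_passWeight l p v
    rw [smul_smul (t.c l p), ← h4]
    module

/-- The commutator of `dualWord k w` with `A_l`; its value at the vacuum is the commutation relation of
the dual operator. -/
theorem dualWord_gen (k l : ι) (w : List ι) (x : FreeFock ι) :
    t.dualWord k w (t.gen l x) + onWords (t.dualWord k) (t.lower l (tens w)) (t.passing l x)
      = t.gen l (t.dualWord k w x) := by
  induction w generalizing x with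
  | nil => simp [dualWord]
  | cons j v ih =>
    have key : ∀ y : FreeFock ι, onWords (t.dualWord k) (create j y)
        = t.c j k • onWords (fun v => t.passWeight j v • t.contract v) y
          + onWords (t.dualWord k) y * createRight j := fun y => by
      induction y using tens_induction with
      | tens w => simp [dualWord, mul_smul]
      | add x y hx hy =>
        rw [map_add, map_add, hx, hy, map_add, map_add, smul_add, add_mul]
        abel
      | smul a x hx =>
        rw [map_smul, map_smul, hx, map_smul, map_smul, smul_mul_assoc, smul_add, smul_comm a]
    rw [← create_tens j v, lower_create, map_add, map_smul, map_smul, onWords_tens, key, smul_add,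
      smul_comm _ (t.c j k), t.Q_symm l j, onWords_passWeight_lower]
    simp only [dualWord, LinearMap.smul_apply, LinearMap.add_apply, Module.End.mul_apply, map_add,
      map_smul]
    rw [← t.contract_gen, ← ih, gen_createRight]
    simp only [smul_add, map_add, map_smul, passing_createRight, smul_smul, t.Q_symm l j]
    abel

/-- The commutation relation of the dual system. -/
theorem dualOp_gen (k l : ι) (x : FreeFock ι) :
    t.dualOp k (t.gen l x) = t.gen l (t.dualOp k x) + (t.c l k * coeff [] x) • tens [] := by
  refine (LinearMap.congr_fun (f := t.dualOp k ∘ₗ t.gen l)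
    (g := t.gen l ∘ₗ t.dualOp k + (t.c l k • coeff []).smulRight (tens []))
    (linearMap_ext_tens fun w => ?_) x).trans ?_
  · have key : ∀ y : FreeFock ι, t.dualOp k y = onWords (t.dualWord k) y (tens []) := fun y => by
      refine LinearMap.congr_fun
        (g := LinearMap.applyₗ (tens []) ∘ₗ onWords (t.dualWord k)) (linearMap_ext_tens fun w => ?_) y
      simp [dualOp]
    have h := t.dualWord_gen k l w (tens [])
    have hg : t.gen l (tens []) = createRight l (tens []) := by
      rw [gen_apply]; simp
    rw [passing_vacuum, hg] at h
    simp only [LinearMap.comp_apply, LinearMap.add_apply, LinearMap.smulRight_apply,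
      LinearMap.smul_apply]
    rw [gen_apply, map_add, key, key, key, onWords_tens, ← h, create_tens, onWords_tens]
    simp only [dualWord, LinearMap.add_apply, LinearMap.smul_apply, Module.End.mul_apply]
    -- The operator `contract w` applies annihilation parts only, so it kills the vacuum unless `w` is
    -- empty; this is where the projection onto the vacuum comes from.
    have hc : t.passWeight l w • t.contract w (tens []) = coeff [] (tens w) • tens [] := by
      cases w with
      | nil => simp [contract, coeff_tens_self, passWeight]
      | cons p v =>
        have hv : ∀ (v : List ι) (p : ι), t.lowerRight p (t.contract v (tens [])) = 0 := by
          intro v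
          induction v with
          | nil => simp [contract]
          | cons r v ih => simp [contract, ih]
        have h0 : coeff [] (tens (p :: v)) = 0 := coeff_tens_of_ne (by simp)
        simp [contract, hv, h0]
    rw [mul_smul, hc]
    simp only [smul_smul, smul_eq_mul]
    abel
  · simp

@[simp] theorem dualOp_vacuum (k : ι) : t.dualOp k (tens []) = 0 := by
  simp [dualOp, dualWord]

end TwistData
/-! ### The `ℓ¹` norm and the degree -/

section Norms
variable {ι : Type*} {M : Type*} [AddCommGroup M] [Module ℂ M]

/-- The simple tensors which occur in a vector. -/
def FreeFock.support (x : FreeFock ι) : Finset (List ι) := Finsupp.support (M := ℂ) x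

theorem mem_support_iff {x : FreeFock ι} {w : List ι} : w ∈ x.support ↔ coeff w x ≠ 0 :=
  Finsupp.mem_support_iff (M := ℂ)

theorem sum_coeff_smul_tens (x : FreeFock ι) : ∑ w ∈ x.support, coeff w x • tens w = x := by
  refine Eq.trans ?_ (Finsupp.sum_single (M := ℂ) x)
  refine Finset.sum_congr rfl fun w _ => ?_
  exact (Finsupp.smul_single _ _ _).trans (by simp; rfl)

/-- The `ℓ¹` norm of the coefficients with respect to the simple tensors. -/
def l1 : Seminorm ℂ (FreeFock ι) :=
  Seminorm.of (fun x => ∑ w ∈ x.support, ‖coeff w x‖)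
    (fun x y => by
      classical
      have h : ∀ z : FreeFock ι, ∀ s, z.support ⊆ s →
          ∑ w ∈ z.support, ‖coeff w z‖ = ∑ w ∈ s, ‖coeff w z‖ := fun z s hs =>
        Finset.sum_subset hs fun w _ hw => by simpa [mem_support_iff] using hw
      rw [h (x + y) (x.support ∪ y.support) (Finsupp.support_add (M := ℂ)),
        h x _ Finset.subset_union_left, h y _ Finset.subset_union_right, ← Finset.sum_add_distrib]
      exact Finset.sum_le_sum fun _ _ => by rw [map_add]; exact norm_add_le _ _)
    (fun a x => by
      have hs : (a • x).support ⊆ x.support := Finsupp.support_smul (M := ℂ)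
      rw [Finset.mul_sum, Finset.sum_subset hs fun w _ hw => by
        simpa [mem_support_iff, or_iff_not_imp_left] using hw]
      simp)

theorem l1_def (x : FreeFock ι) : l1 x = ∑ w ∈ x.support, ‖coeff w x‖ := rfl

@[simp] theorem l1_tens (w : List ι) : l1 (tens w) = 1 := by
  have h : (tens w).support = {w} := Finsupp.support_single _ one_ne_zero
  rw [l1_def, h, Finset.sum_singleton, coeff_tens_self, norm_one]

theorem norm_coeff_le_l1 (x : FreeFock ι) (w : List ι) : ‖coeff w x‖ ≤ l1 x := by
  by_cases h : w ∈ x.support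
  · exact Finset.single_le_sum (f := fun w => ‖coeff w x‖) (fun _ _ => norm_nonneg _) h
  · rw [mem_support_iff, not_not] at h
    rw [h, norm_zero]
    exact apply_nonneg _ _

theorem eq_zero_of_coeff {x : FreeFock ι} (h : ∀ w, coeff w x = 0) : x = 0 :=
  Finsupp.ext (M := ℂ) h

theorem apply_eq_sum_support (f : FreeFock ι →ₗ[ℂ] M) (x : FreeFock ι) :
    f x = ∑ w ∈ x.support, coeff w x • f (tens w) := by
  conv_lhs => rw [← sum_coeff_smul_tens x]
  simp

theorem seminorm_le_mul_l1 (p : Seminorm ℂ M) (f : FreeFock ι →ₗ[ℂ] M) {C : ℝ} {x : FreeFock ι}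
    (h : ∀ w ∈ x.support, p (f (tens w)) ≤ C) : p (f x) ≤ C * l1 x := by
  rw [apply_eq_sum_support]
  refine (Finset.le_sum_of_subadditive p (map_zero p).le (map_add_le_add p) _ _).trans ?_
  rw [l1_def, Finset.mul_sum]
  refine Finset.sum_le_sum fun w hw => ?_
  rw [map_smul_eq_mul, mul_comm]
  exact mul_le_mul_of_nonneg_right (h w hw) (norm_nonneg _)

/-- The tensors of degree `n`. -/
def degree (n : ℕ) : Submodule ℂ (FreeFock ι) := Submodule.span ℂ (tens '' {w | w.length = n})

theorem tens_mem_degree (w : List ι) : tens w ∈ degree w.length :=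
  Submodule.subset_span ⟨w, rfl, rfl⟩

theorem map_mem_of_degree {n : ℕ} {f : FreeFock ι →ₗ[ℂ] M} {p : Submodule ℂ M}
    (h : ∀ w : List ι, w.length = n → f (tens w) ∈ p) {x : FreeFock ι} (hx : x ∈ degree n) :
    f x ∈ p := by
  have : degree n ≤ p.comap f := Submodule.span_le.2 (by rintro _ ⟨w, hw, rfl⟩; exact h w hw)
  exact this hx

theorem coeff_eq_zero_of_mem_degree {n : ℕ} {x : FreeFock ι} (hx : x ∈ degree n) {w : List ι}
    (hw : w.length ≠ n) : coeff w x = 0 := by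
  refine (Submodule.mem_bot ℂ).1 (map_mem_of_degree (f := coeff w) (fun v hv => ?_) hx)
  exact coeff_tens_of_ne (by rintro rfl; exact hw hv)

theorem length_of_mem_degree {n : ℕ} {x : FreeFock ι} (hx : x ∈ degree n) {w : List ι}
    (hw : w ∈ x.support) : w.length = n := by
  by_contra h
  exact mem_support_iff.1 hw (coeff_eq_zero_of_mem_degree hx h)

instance [Finite ι] (n : ℕ) : FiniteDimensional ℂ (degree (ι := ι) n) :=
  FiniteDimensional.span_of_finite ℂ ((List.finite_length_eq ι n).image _)

theorem create_mem_degree (k : ι) {n : ℕ} {x : FreeFock ι} (hx : x ∈ degree n) :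
    create k x ∈ degree (n + 1) := by
  refine map_mem_of_degree (fun w hw => ?_) hx
  rw [create_tens, ← hw]
  exact tens_mem_degree (k :: w)

theorem createRight_mem_degree (k : ι) {n : ℕ} {x : FreeFock ι} (hx : x ∈ degree n) :
    createRight k x ∈ degree (n + 1) := by
  refine map_mem_of_degree (fun w hw => ?_) hx
  have := tens_mem_degree (w ++ [k])
  rw [createRight_tens]
  rwa [List.length_append, hw] at this

theorem l1_create_le (k : ι) (x : FreeFock ι) : l1 (create k x) ≤ l1 x := by
  simpa using seminorm_le_mul_l1 (C := 1) l1 (create k) (x := x) (by simp)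

theorem l1_createRight_le (k : ι) (x : FreeFock ι) : l1 (createRight k x) ≤ l1 x := by
  simpa using seminorm_le_mul_l1 (C := 1) l1 (createRight k) (x := x) (by simp)

/-- A strict contraction `S` of the tensors of degree `n` makes `1 - S` invertible. -/
theorem exists_sub_apply_eq [Finite ι] {n : ℕ} (S : Module.End ℂ (FreeFock ι))
    (hS : ∀ x ∈ degree n, S x ∈ degree n) {a : ℝ} (ha : a < 1) (hN : ∀ x, l1 (S x) ≤ a * l1 x)
    {y : FreeFock ι} (hy : y ∈ degree n) :
    ∃ z ∈ degree n, z - S z = y ∧ l1 z ≤ l1 y / (1 - a) := by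
  have bound : ∀ z : FreeFock ι, l1 z ≤ l1 (z - S z) / (1 - a) := fun z => by
    rw [le_div_iff₀ (by linarith)]
    have h1 : l1 z ≤ l1 (z - S z) + l1 (S z) := by
      simpa using map_add_le_add l1 (z - S z) (S z)
    linarith [hN z]
  have h1S : ∀ x ∈ degree n, (1 - S : Module.End ℂ (FreeFock ι)) x ∈ degree n := fun x hx =>
    Submodule.sub_mem _ hx (hS x hx)
  let f : degree (ι := ι) n →ₗ[ℂ] degree (ι := ι) n :=
    (1 - S : Module.End ℂ (FreeFock ι)).restrict h1S
  have hinj : Function.Injective f := by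
    refine (injective_iff_map_eq_zero f).2 ?_
    rintro ⟨z, hz⟩ h
    have h0 : z - S z = 0 := congrArg Subtype.val h
    have h2 := bound z
    rw [h0, map_zero, zero_div] at h2
    have : z = 0 := eq_zero_of_coeff fun w =>
      norm_le_zero_iff.1 ((norm_coeff_le_l1 z w).trans h2)
    exact Subtype.ext this
  obtain ⟨⟨z, hz⟩, h⟩ := LinearMap.injective_iff_surjective.1 hinj ⟨y, hy⟩
  have h : z - S z = y := congrArg Subtype.val h
  exact ⟨z, hz, h, h ▸ bound z⟩

end Norms

namespace TwistData

variable {ι : Type*} [DecidableEq ι] (t : TwistData ι)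

/-! ### The braid operators and the dual basis -/

/-- The value at a simple tensor of the operator `T` acting in the legs `i, i + 1`. -/
def braidWord : ℕ → List ι → FreeFock ι
  | 0, j :: k :: w => (t.Q j k : ℂ) • tens (k :: j :: w)
  | i + 1, j :: w => create j (braidWord i w)
  | _, _ => 0

/-- The operator `T (e_j ⊗ e_k) = Q j k • e_k ⊗ e_j`, acting in the legs `i, i + 1`; it vanishes on
the tensors of degree less than `i + 2`. -/
def braid (i : ℕ) : Module.End ℂ (FreeFock ι) := onWords (t.braidWord i)

@[simp] theorem braid_nil (i : ℕ) : t.braid i (tens []) = 0 := by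
  cases i <;> simp [braid, braidWord]

@[simp] theorem braid_zero_singleton (j : ι) : t.braid 0 (tens [j]) = 0 := by
  simp [braid, braidWord]

theorem braid_zero_cons_cons (j k : ι) (w : List ι) :
    t.braid 0 (tens (j :: k :: w)) = (t.Q j k : ℂ) • tens (k :: j :: w) := by
  simp [braid, braidWord]

theorem braid_succ_create (i : ℕ) (j : ι) (x : FreeFock ι) :
    t.braid (i + 1) (create j x) = create j (t.braid i x) := by
  refine LinearMap.congr_fun (f := t.braid (i + 1) ∘ₗ create j) (g := create j ∘ₗ t.braid i)
    (linearMap_ext_tens fun w => ?_) x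
  simp [braid, braidWord]

theorem braid_succ_cons (i : ℕ) (j : ι) (w : List ι) :
    t.braid (i + 1) (tens (j :: w)) = create j (t.braid i (tens w)) := by
  rw [← braid_succ_create, create_tens]

theorem braid_zero_create_create (j k : ι) (x : FreeFock ι) :
    t.braid 0 (create j (create k x)) = (t.Q j k : ℂ) • create k (create j x) := by
  refine LinearMap.congr_fun (f := t.braid 0 ∘ₗ create j ∘ₗ create k)
    (g := (t.Q j k : ℂ) • create k ∘ₗ create j) (linearMap_ext_tens fun w => ?_) x
  simp [braid_zero_cons_cons]

theorem braid_relation (i : ℕ) : t.braid i * t.braid (i + 1) * t.braid i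
    = t.braid (i + 1) * t.braid i * t.braid (i + 1) := by
  refine linearMap_ext_tens fun w => ?_
  induction i generalizing w with
  | zero =>
    match w with
    | [] => simp
    | [j] => simp [braid_succ_cons]
    | [j, k] => simp [braid_zero_cons_cons, braid_succ_cons]
    | j :: k :: l :: w =>
      simp only [Module.End.mul_apply, braid_zero_cons_cons, braid_succ_cons, map_smul, create_tens,
        smul_smul, zero_add]
      congr 1
      ring
  | succ i ih =>
    match w with
    | [] => simp
    | j :: w =>
      have := congrArg (create j) (ih w)
      simpa only [Module.End.mul_apply, braid_succ_cons, braid_succ_create] using this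

theorem braid_comm (i k : ℕ) : t.braid i * t.braid (i + k + 2) = t.braid (i + k + 2) * t.braid i := by
  refine linearMap_ext_tens fun w => ?_
  induction i generalizing w with
  | zero =>
    match w with
    | [] => simp
    | [j] => simp [braid_succ_cons]
    | j :: l :: w =>
      simp only [Module.End.mul_apply, braid_zero_cons_cons, braid_succ_cons, map_smul, zero_add,
        braid_zero_create_create]
  | succ i ih =>
    match w with
    | [] => simp
    | j :: w =>
      have := congrArg (create j) (ih w)
      have e : i + 1 + k + 2 = (i + k + 2) + 1 := by ring
      simpa only [e, Module.End.mul_apply, braid_succ_cons, braid_succ_create] using this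

/-- The product `T_0 T_1 ⋯ T_{k-1}`. -/
def cycle : ℕ → Module.End ℂ (FreeFock ι)
  | 0 => 1
  | k + 1 => cycle k * t.braid k

/-- The sum `1 + T_0 + T_0 T_1 + ⋯` with `k` terms. -/
def cycleSum (k : ℕ) : Module.End ℂ (FreeFock ι) := ∑ i ∈ Finset.range k, t.cycle i

theorem braid_comm_cycle (i k : ℕ) :
    t.braid (i + k + 1) * t.cycle i = t.cycle i * t.braid (i + k + 1) := by
  induction i generalizing k with
  | zero => simp [cycle]
  | succ i ih =>
    have h1 := ih (k + 1)
    have h2 := t.braid_comm i k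
    rw [show i + (k + 1) + 1 = i + k + 2 by ring] at h1
    rw [show i + 1 + k + 1 = i + k + 2 by ring, cycle, ← mul_assoc, h1, mul_assoc, ← h2, mul_assoc]

/-- Conjugation with a cycle shifts the legs of a braid operator by one. -/
theorem cycle_mul_braid (i k : ℕ) :
    t.cycle (i + k + 2) * t.braid i = t.braid (i + 1) * t.cycle (i + k + 2) := by
  induction k with
  | zero =>
    have h1 := t.braid_comm_cycle i 0
    have h2 := t.braid_relation i
    simp only [add_zero] at h1 ⊢
    rw [cycle, cycle, mul_assoc, mul_assoc, ← mul_assoc (t.braid i), h2, ← mul_assoc, ← mul_assoc,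
      ← h1]
    simp only [mul_assoc]
  | succ k ih =>
    rw [show i + (k + 1) + 2 = (i + k + 2) + 1 by ring, cycle, mul_assoc, ← t.braid_comm, ← mul_assoc,
      ih, mul_assoc]

theorem braid_mul_cycle_mul_cycle (i k : ℕ) :
    t.braid 0 * t.cycle (i + k + 1) * t.cycle i = t.cycle (i + 1) * t.cycle (i + k + 1) := by
  induction i generalizing k with
  | zero => simp [cycle]
  | succ i ih =>
    have h1 := ih (k + 1)
    rw [show i + (k + 1) + 1 = i + k + 2 by ring] at h1
    rw [show i + 1 + k + 1 = i + k + 2 by ring, show t.cycle (i + 1) = t.cycle i * t.braid i from rfl,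
      ← mul_assoc, h1, show t.cycle (i + 1 + 1) = t.cycle (i + 1) * t.braid (i + 1) from rfl, mul_assoc,
      mul_assoc, t.cycle_mul_braid]

/-- The factorization which allows to invert `cycleSum` inductively. -/
theorem cycleSum_succ_mul (k : ℕ) : t.cycleSum (k + 1) * (1 - t.cycle k)
    = (1 - t.braid 0 * t.cycle k) * t.cycleSum k := by
  have h : t.braid 0 * t.cycle k * t.cycleSum k
      = ∑ i ∈ Finset.range k, t.cycle (i + 1) * t.cycle k := by
    rw [cycleSum, Finset.mul_sum]
    refine Finset.sum_congr rfl fun i hi => ?_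
    obtain ⟨m, rfl⟩ := Nat.exists_eq_add_of_lt (Finset.mem_range.1 hi)
    exact t.braid_mul_cycle_mul_cycle i m
  rw [mul_sub, mul_one, sub_mul, one_mul, h, ← Finset.sum_mul]
  have h1 : t.cycleSum (k + 1) = t.cycleSum k + t.cycle k := Finset.sum_range_succ _ _
  have h2 : t.cycleSum (k + 1) = ∑ i ∈ Finset.range k, t.cycle (i + 1) + 1 :=
    Finset.sum_range_succ' _ _
  rw [show t.cycleSum (k + 1) * t.cycle k
    = (∑ i ∈ Finset.range k, t.cycle (i + 1)) * t.cycle k + t.cycle k by rw [h2, add_mul, one_mul],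
    h1]
  abel

theorem braid_mem_degree (i : ℕ) {n : ℕ} {x : FreeFock ι} (hx : x ∈ degree n) :
    t.braid i x ∈ degree n := by
  refine map_mem_of_degree (fun w hw => ?_) hx
  clear hx
  induction i generalizing w n with
  | zero =>
    match w with
    | [] => simp
    | [j] => simp
    | j :: k :: w =>
      rw [braid_zero_cons_cons]
      exact Submodule.smul_mem _ _ (hw ▸ tens_mem_degree (k :: j :: w))
  | succ i ih =>
    match w with
    | [] => simp
    | j :: w =>
      rw [braid_succ_cons, ← hw]
      exact create_mem_degree j (ih (n := w.length) w rfl)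

theorem cycle_mem_degree (k : ℕ) {n : ℕ} {x : FreeFock ι} (hx : x ∈ degree n) :
    t.cycle k x ∈ degree n := by
  induction k generalizing x with
  | zero => exact hx
  | succ k ih => exact ih (t.braid_mem_degree k hx)

theorem l1_braid_le {q : ℝ} (hq0 : 0 ≤ q) (hq : ∀ k l, |t.Q k l| ≤ q) (i : ℕ) (x : FreeFock ι) :
    l1 (t.braid i x) ≤ q * l1 x := by
  refine seminorm_le_mul_l1 l1 (t.braid i) ?_
  suffices h : ∀ w, l1 (t.braid i (tens w)) ≤ q from fun w _ => h w
  intro w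
  induction i generalizing w with
  | zero =>
    match w with
    | [] => simpa
    | [j] => simpa
    | j :: k :: w =>
      rw [braid_zero_cons_cons, map_smul_eq_mul, l1_tens, mul_one, Complex.norm_real]
      exact hq j k
  | succ i ih =>
    match w with
    | [] => simpa
    | j :: w =>
      rw [braid_succ_cons]
      exact (l1_create_le _ _).trans (ih w)

theorem l1_cycle_le {q : ℝ} (hq0 : 0 ≤ q) (hq : ∀ k l, |t.Q k l| ≤ q) (k : ℕ) (x : FreeFock ι) :
    l1 (t.cycle k x) ≤ q ^ k * l1 x := by
  induction k generalizing x with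
  | zero => simp [cycle]
  | succ k ih =>
    calc l1 (t.cycle (k + 1) x) = l1 (t.cycle k (t.braid k x)) := rfl
      _ ≤ q ^ k * l1 (t.braid k x) := ih _
      _ ≤ q ^ k * (q * l1 x) := by gcongr; exact t.l1_braid_le hq0 hq k x
      _ = q ^ (k + 1) * l1 x := by ring

/-- `cycleSum` is invertible on the tensors of every degree, with a bound for the inverse. -/
theorem exists_cycleSum_apply_eq [Finite ι] {q : ℝ} (hq0 : 0 ≤ q) (hq1 : q < 1)
    (hq : ∀ k l, |t.Q k l| ≤ q) (k : ℕ) {n : ℕ} {y : FreeFock ι} (hy : y ∈ degree n) :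
    ∃ u ∈ degree n, t.cycleSum (k + 1) u = y ∧
      l1 u ≤ (∏ i ∈ Finset.range k, (1 + q ^ (i + 1)) / (1 - q ^ (i + 2))) * l1 y := by
  induction k generalizing y with
  | zero => exact ⟨y, hy, by simp [cycleSum, cycle], by simp⟩
  | succ k ih =>
    have h2 : q ^ (k + 2) < 1 := pow_lt_one₀ hq0 hq1 (by omega)
    obtain ⟨z, hz, hzy, hzl⟩ := exists_sub_apply_eq (t.braid 0 * t.cycle (k + 1))
      (fun x hx => t.braid_mem_degree 0 (t.cycle_mem_degree (k + 1) hx)) h2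
      (fun x => by
        refine (t.l1_braid_le hq0 hq 0 _).trans ?_
        rw [pow_succ', mul_assoc]
        exact mul_le_mul_of_nonneg_left (t.l1_cycle_le hq0 hq _ _) hq0) hy
    obtain ⟨v, hv, hvz, hvl⟩ := ih hz
    refine ⟨v - t.cycle (k + 1) v, Submodule.sub_mem _ hv (t.cycle_mem_degree _ hv), ?_, ?_⟩
    · have h := LinearMap.congr_fun (t.cycleSum_succ_mul (k + 1)) v
      change t.cycleSum (k + 1 + 1) (v - t.cycle (k + 1) v) = t.cycleSum (k + 1) v
        - (t.braid 0 * t.cycle (k + 1)) (t.cycleSum (k + 1) v) at h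
      rw [h, hvz, hzy]
    · have h3 : l1 (v - t.cycle (k + 1) v) ≤ (1 + q ^ (k + 1)) * l1 v := by
        have := map_sub_le_add l1 v (t.cycle (k + 1) v)
        have := t.l1_cycle_le hq0 hq (k + 1) v
        linarith
      have hP : 0 ≤ ∏ i ∈ Finset.range k, (1 + q ^ (i + 1)) / (1 - q ^ (i + 2)) :=
        Finset.prod_nonneg fun i _ => div_nonneg (by positivity)
          (sub_nonneg.2 (pow_le_one₀ hq0 hq1.le))
      calc l1 (v - t.cycle (k + 1) v) ≤ (1 + q ^ (k + 1)) * l1 v := h3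
        _ ≤ (1 + q ^ (k + 1)) * ((∏ i ∈ Finset.range k, (1 + q ^ (i + 1)) / (1 - q ^ (i + 2)))
            * (l1 y / (1 - q ^ (k + 2)))) := by
          have := hvl.trans (mul_le_mul_of_nonneg_left hzl hP)
          exact mul_le_mul_of_nonneg_left this (by positivity)
        _ = _ := by rw [Finset.prod_range_succ]; ring

/-- The products which bound the inverses of `cycleSum` are bounded. -/
theorem exists_prod_le {q : ℝ} (hq0 : 0 ≤ q) (hq1 : q < 1) : ∃ C : ℝ, 1 ≤ C ∧ ∀ k,
    ∏ i ∈ Finset.range k, (1 + q ^ (i + 1)) / (1 - q ^ (i + 2)) ≤ C := by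
  refine ⟨Real.exp (2 / (1 - q) * (1 - q)⁻¹), Real.one_le_exp ?_, fun k => ?_⟩
  · have := sub_pos.2 hq1
    positivity
  have hq' := sub_pos.2 hq1
  -- Each factor is `1 + O(q ^ i)`, so that the product is bounded by the exponential of a geometric
  -- series.
  have h1 : ∀ i, (1 + q ^ (i + 1)) / (1 - q ^ (i + 2)) ≤ Real.exp (2 / (1 - q) * q ^ i) := by
    intro i
    have hp : q ^ (i + 2) ≤ q := by
      calc q ^ (i + 2) ≤ q ^ 1 := pow_le_pow_of_le_one hq0 hq1.le (by omega)
        _ = q := pow_one q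
    have hpos : 0 < 1 - q ^ (i + 2) := by linarith
    have h2 : 1 + q ^ (i + 1) ≤ Real.exp (q ^ i / (1 - q)) := by
      refine le_trans ?_ (Real.add_one_le_exp _)
      rw [add_comm]
      gcongr
      calc q ^ (i + 1) ≤ q ^ i := pow_le_pow_of_le_one hq0 hq1.le (by omega)
        _ ≤ q ^ i / (1 - q) := le_div_self (by positivity) hq' (by linarith)
    have h3 : 1 / (1 - q ^ (i + 2)) ≤ Real.exp (q ^ i / (1 - q)) := by
      have e1 : 1 / (1 - q ^ (i + 2)) = q ^ (i + 2) / (1 - q ^ (i + 2)) + 1 := by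
        rw [div_add_one hpos.ne']; ring
      rw [e1]
      refine (Real.add_one_le_exp _).trans (Real.exp_le_exp.2 ?_)
      have e2 : q ^ (i + 2) ≤ q ^ i := pow_le_pow_of_le_one hq0 hq1.le (by omega)
      gcongr
    calc (1 + q ^ (i + 1)) / (1 - q ^ (i + 2))
        = (1 + q ^ (i + 1)) * (1 / (1 - q ^ (i + 2))) := by ring
      _ ≤ Real.exp (q ^ i / (1 - q)) * Real.exp (q ^ i / (1 - q)) := by gcongr
      _ = Real.exp (2 / (1 - q) * q ^ i) := by rw [← Real.exp_add]; congr 1; ring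
  calc ∏ i ∈ Finset.range k, (1 + q ^ (i + 1)) / (1 - q ^ (i + 2))
      ≤ ∏ i ∈ Finset.range k, Real.exp (2 / (1 - q) * q ^ i) := by
        refine Finset.prod_le_prod (fun i _ => div_nonneg (by positivity) ?_) fun i _ => h1 i
        exact sub_nonneg.2 (pow_le_one₀ hq0 hq1.le)
    _ = Real.exp (2 / (1 - q) * ∑ i ∈ Finset.range k, q ^ i) := by
        rw [← Real.exp_sum, Finset.mul_sum]
    _ ≤ _ := by
        gcongr
        rw [← tsum_geometric_of_lt_one hq0 hq1]
        exact (summable_geometric_of_lt_one hq0 hq1).sum_le_tsum _ fun i _ => by positivity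

theorem cycle_succ_create (k : ℕ) (j : ι) (x : FreeFock ι) :
    t.cycle (k + 1) (create j x) = t.braid 0 (create j (t.cycle k x)) := by
  induction k generalizing x with
  | zero => rfl
  | succ k ih =>
    change t.cycle (k + 1) (t.braid (k + 1) (create j x)) = _
    rw [braid_succ_create, ih]
    rfl

theorem cycleSum_succ_create (n : ℕ) (j : ι) (x : FreeFock ι) :
    t.cycleSum (n + 1) (create j x) = create j x + t.braid 0 (create j (t.cycleSum n x)) := by
  simp only [cycleSum, Finset.sum_range_succ' _ n, LinearMap.add_apply, LinearMap.sum_apply,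
    cycle_succ_create, map_sum]
  rw [add_comm]
  rfl

variable [Fintype ι]

/-- The operator `∑ₖ a*_k a_k` is `cycleSum n` on the tensors of degree `n`. -/
theorem sum_create_annihilate {n : ℕ} {x : FreeFock ι} (hx : x ∈ degree n) :
    ∑ k, create k (t.annihilate k x) = t.cycleSum n x := by
  have h : ∀ w : List ι, ∑ k, create k (t.annihilate k (tens w)) = t.cycleSum w.length (tens w) := by
    intro w
    induction w with
    | nil => simp [cycleSum]
    | cons j w ih =>
      rw [List.length_cons, ← create_tens, cycleSum_succ_create, ← ih]
      simp only [annihilate_create, map_add, Finset.sum_add_distrib, map_sum, map_smul,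
        braid_zero_create_create]
      congr 1
      · rw [Finset.sum_eq_single j] <;> simp +contextual
      · simp only [t.Q_symm j]
  have h2 := map_mem_of_degree (f := ∑ k, create k ∘ₗ t.annihilate k - t.cycleSum n) (p := ⊥)
    (fun w hw => by
      subst hw
      simp [LinearMap.sum_apply, h]) hx
  simpa [LinearMap.sum_apply, sub_eq_zero] using h2

/-- There is a basis `u_w` with `a_j u_{kw} = δ_{jk} u_w`, which consequently is dual to the simple
tensors for the deformed inner product, and whose `ℓ¹` norms grow at most geometrically. -/
theorem exists_dualBasis {q : ℝ} (hq0 : 0 ≤ q) (hq1 : q < 1) (hq : ∀ k l, |t.Q k l| ≤ q) :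
    ∃ (C : ℝ) (u : List ι → FreeFock ι), 1 ≤ C ∧ u [] = tens [] ∧
      (∀ w, u w ∈ degree w.length) ∧ (∀ w, l1 (u w) ≤ C ^ w.length) ∧
      ∀ j k w, t.annihilate j (u (k :: w)) = if j = k then u w else 0 := by
  obtain ⟨C, hC1, hC⟩ := exists_prod_le hq0 hq1
  have step : ∀ (n : ℕ) (y : FreeFock ι), y ∈ degree (n + 1) → ∃ v ∈ degree (n + 1),
      ∑ k, create k (t.annihilate k v) = y ∧ l1 v ≤ C * l1 y := fun n y hy => by
    obtain ⟨v, hv, h1, h2⟩ := t.exists_cycleSum_apply_eq hq0 hq1 hq n hy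
    exact ⟨v, hv, (t.sum_create_annihilate hv).trans h1,
      h2.trans (mul_le_mul_of_nonneg_right (hC n) (apply_nonneg _ _))⟩
  -- The vector `u_{kw}` solves `∑ₖ a*_k a_k u_{kw} = e_k ⊗ u_w`.
  choose! f hf1 hf2 hf3 using step
  let u : List ι → FreeFock ι := fun w =>
    List.rec (tens []) (fun k w r => f w.length (create k r)) w
  have hu : ∀ k w, u (k :: w) = f w.length (create k (u w)) := fun _ _ => rfl
  have hdeg : ∀ w, u w ∈ degree w.length := fun w => by
    induction w with
    | nil => exact tens_mem_degree []
    | cons k w ih => exact hf1 _ _ (create_mem_degree k ih)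
  refine ⟨C, u, hC1, rfl, hdeg, fun w => ?_, fun j k w => ?_⟩
  · induction w with
    | nil => simp [u]
    | cons k w ih =>
      rw [hu, List.length_cons, pow_succ']
      refine (hf3 _ _ (create_mem_degree k (hdeg w))).trans ?_
      have := (l1_create_le k (u w)).trans ih
      gcongr
  · -- The map `g` selects the words which begin with `j`, and removes this letter.
    let g : FreeFock ι →ₗ[ℂ] FreeFock ι := onWords fun w =>
      match w with
      | [] => 0
      | k :: w => if j = k then tens w else 0
    have hg : ∀ k x, g (create k x) = if j = k then x else 0 := fun k x => by
      induction x using tens_induction with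
      | tens w => simp [g]
      | add x y hx hy => rw [map_add, map_add, hx, hy]; split_ifs <;> simp
      | smul a x hx => rw [map_smul, map_smul, hx]; split_ifs <;> simp
    have h := congrArg g (hf2 _ _ (create_mem_degree k (hdeg w)))
    rw [← hu, hg, map_sum] at h
    simpa [hg] using h

end TwistData
end MixedArakiWoods

namespace MixedArakiWoods
namespace TwistData

variable {ι : Type*} [DecidableEq ι] (t : TwistData ι)

/-! ### The algebraic Fock space as a cyclic module -/

theorem passing_mem_degree (m : ι) {n : ℕ} {x : FreeFock ι} (hx : x ∈ degree n) :
    t.passing m x ∈ degree n := by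
  refine map_mem_of_degree (fun w hw => ?_) hx
  rw [passing_tens]
  exact Submodule.smul_mem _ _ (hw ▸ tens_mem_degree w)

variable [Fintype ι]

theorem lower_mem_degree (l : ι) {n : ℕ} {x : FreeFock ι} (hx : x ∈ degree n) :
    t.lower l x ∈ degree (n - 1) := by
  refine map_mem_of_degree (fun w hw => ?_) hx
  clear hx
  induction w generalizing n with
  | nil => simp
  | cons k w ih =>
    rw [← hw, ← create_tens, lower_create, List.length_cons, Nat.add_sub_cancel]
    refine Submodule.add_mem _ (Submodule.smul_mem _ _ (tens_mem_degree w))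
      (Submodule.smul_mem _ _ ?_)
    cases w with
    | nil => simp
    | cons r w => exact create_mem_degree k (ih (n := w.length + 1) rfl)

theorem lowerRight_mem_degree (j : ι) {n : ℕ} {x : FreeFock ι} (hx : x ∈ degree n) :
    t.lowerRight j x ∈ degree (n - 1) := by
  refine map_mem_of_degree (fun w hw => ?_) hx
  clear hx
  induction w generalizing n with
  | nil => simp
  | cons k w ih =>
    rw [← hw, ← create_tens, lowerRight_create, List.length_cons, Nat.add_sub_cancel]
    refine Submodule.add_mem _ ?_ (Submodule.smul_mem _ _ (t.passing_mem_degree k (tens_mem_degree w)))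
    cases w with
    | nil => simp
    | cons r w => exact create_mem_degree k (ih (n := w.length + 1) rfl)

/-- The vacuum is cyclic for the generators. -/
theorem eq_top_of_gen {p : Submodule ℂ (FreeFock ι)} (h0 : tens [] ∈ p)
    (h : ∀ l, ∀ x ∈ p, t.gen l x ∈ p) : p = ⊤ := by
  rw [eq_top_iff, ← span_tens, Submodule.span_le]
  suffices H : ∀ n, ∀ w : List ι, w.length ≤ n → tens w ∈ p by
    rintro _ ⟨w, rfl⟩
    exact H _ w le_rfl
  intro n
  induction n with
  | zero =>
    intro w hw
    rwa [List.length_eq_zero_iff.1 (Nat.le_zero.1 hw)]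
  | succ n ih =>
    intro w hw
    cases w with
    | nil => exact h0
    | cons l w =>
      have hw : w.length ≤ n := by simpa using hw
      have e : tens (l :: w) = t.gen l (tens w) - t.lower l (tens w) := by simp [gen_apply]
      rw [e]
      refine p.sub_mem (h l _ (ih w hw)) ?_
      exact map_mem_of_degree (f := LinearMap.id) (fun v hv => ih v (by omega))
        (t.lower_mem_degree l (tens_mem_degree w))

/-- The vacuum is cyclic for the right generators. -/
theorem eq_top_of_genRight {p : Submodule ℂ (FreeFock ι)} (h0 : tens [] ∈ p)
    (h : ∀ l, ∀ x ∈ p, t.genRight l x ∈ p) : p = ⊤ := by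
  rw [eq_top_iff, ← span_tens, Submodule.span_le]
  suffices H : ∀ n, ∀ w : List ι, w.length ≤ n → tens w ∈ p by
    rintro _ ⟨w, rfl⟩
    exact H _ w le_rfl
  intro n
  induction n with
  | zero =>
    intro w hw
    rwa [List.length_eq_zero_iff.1 (Nat.le_zero.1 hw)]
  | succ n ih =>
    intro w hw
    rcases List.eq_nil_or_concat w with rfl | ⟨w, l, rfl⟩
    · exact h0
    · have hw : w.length ≤ n := by simpa using hw
      have e : tens (w.concat l) = t.genRight l (tens w) - t.lowerRight l (tens w) := by
        simp [genRight_apply]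
      rw [e]
      refine p.sub_mem (h l _ (ih w hw)) ?_
      exact map_mem_of_degree (f := LinearMap.id) (fun v hv => ih v (by omega))
        (t.lowerRight_mem_degree l (tens_mem_degree w))

section Universal

variable {Z : Type*} [AddCommGroup Z] [Module ℂ Z]

/-- The solution of `g Ω = z₀`, `g (A_l x) = O_l (g x)`, up to degree `n`. -/
def cyclicLiftAux (O : ι → Z →ₗ[ℂ] Z) (z₀ : Z) : ℕ → FreeFock ι →ₗ[ℂ] Z
  | 0 => onWords fun _ => z₀
  | n + 1 => onWords fun w =>
    match w with
    | [] => z₀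
    | l :: w => O l (cyclicLiftAux O z₀ n (tens w)) - cyclicLiftAux O z₀ n (t.lower l (tens w))

/-- The linear map `g` with `g Ω = z₀` and `g (A_l x) = O_l (g x)`: the algebraic Fock space is a free
module over the free algebra in the generators, with basis `Ω`. -/
def cyclicLift (O : ι → Z →ₗ[ℂ] Z) (z₀ : Z) : FreeFock ι →ₗ[ℂ] Z :=
  onWords fun w => t.cyclicLiftAux O z₀ w.length (tens w)

theorem eq_of_mem_degree {f g : FreeFock ι →ₗ[ℂ] Z} {n : ℕ}
    (h : ∀ w : List ι, w.length = n → f (tens w) = g (tens w)) {x : FreeFock ι}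
    (hx : x ∈ degree n) : f x = g x := by
  have := map_mem_of_degree (f := f - g) (p := ⊥) (fun w hw => by simp [h w hw]) hx
  simpa [sub_eq_zero] using this

theorem cyclicLiftAux_succ (O : ι → Z →ₗ[ℂ] Z) (z₀ : Z) (n : ℕ) (w : List ι) (hw : w.length ≤ n) :
    t.cyclicLiftAux O z₀ (n + 1) (tens w) = t.cyclicLiftAux O z₀ n (tens w) := by
  induction n generalizing w with
  | zero =>
    rw [List.length_eq_zero_iff.1 (Nat.le_zero.1 hw)]
    simp [cyclicLiftAux]
  | succ n ih =>
    cases w with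
    | nil => simp [cyclicLiftAux]
    | cons l w =>
      have hw : w.length ≤ n := by simpa using hw
      rw [cyclicLiftAux, onWords_tens]
      conv_rhs => rw [cyclicLiftAux, onWords_tens]
      simp only
      rw [ih w hw, eq_of_mem_degree (fun v hv => ih v (by omega))
        (t.lower_mem_degree l (tens_mem_degree w))]

theorem cyclicLiftAux_eq (O : ι → Z →ₗ[ℂ] Z) (z₀ : Z) (n : ℕ) (w : List ι) (hw : w.length ≤ n) :
    t.cyclicLiftAux O z₀ n (tens w) = t.cyclicLift O z₀ (tens w) := by
  rw [cyclicLift, onWords_tens]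
  induction n, hw using Nat.le_induction with
  | base => rfl
  | succ n hn ih => rw [t.cyclicLiftAux_succ O z₀ n w hn, ih]

@[simp] theorem cyclicLift_vacuum (O : ι → Z →ₗ[ℂ] Z) (z₀ : Z) :
    t.cyclicLift O z₀ (tens []) = z₀ := by
  simp [cyclicLift, cyclicLiftAux]

theorem cyclicLift_gen (O : ι → Z →ₗ[ℂ] Z) (z₀ : Z) (l : ι) (x : FreeFock ι) :
    t.cyclicLift O z₀ (t.gen l x) = O l (t.cyclicLift O z₀ x) := by
  refine LinearMap.congr_fun (f := t.cyclicLift O z₀ ∘ₗ t.gen l) (g := O l ∘ₗ t.cyclicLift O z₀)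
    (linearMap_ext_tens fun w => ?_) x
  simp only [LinearMap.comp_apply]
  rw [gen_apply, map_add, create_tens]
  conv_lhs => enter [1]; rw [cyclicLift, onWords_tens, List.length_cons, cyclicLiftAux, onWords_tens]
  simp only
  rw [t.cyclicLiftAux_eq O z₀ _ w le_rfl, eq_of_mem_degree
    (fun v hv => t.cyclicLiftAux_eq O z₀ _ v (by omega)) (t.lower_mem_degree l (tens_mem_degree w))]
  abel

end Universal

/-! ### Estimates -/

/-- The standing bounds: `p ^ 8` bounds the parameters `Q`, and `K` the covariances. The power `8`
makes the decay of the dual system, of order `q ^ (m (m + 1) / 2)` in degree `n = 2 m + 1`, equal to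
`p ^ (n ^ 2 - 1)`. -/
structure Bounds (p K : ℝ) : Prop where
  pos : 0 < p
  lt_one : p < 1
  Q_le : ∀ k l, |t.Q k l| ≤ p ^ 8
  one_le : 1 ≤ K
  c_le : ∀ k l, ‖t.c k l‖ ≤ K

variable {t} {p K : ℝ} (hb : t.Bounds p K)
include hb

theorem Bounds.Q_le_one (k l : ι) : |t.Q k l| ≤ 1 :=
  (hb.Q_le k l).trans (pow_le_one₀ hb.pos.le hb.lt_one.le)

theorem Bounds.norm_passWeight_le (j : ι) (w : List ι) :
    ‖t.passWeight j w‖ ≤ (p ^ 8) ^ w.length := by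
  induction w with
  | nil => simp [passWeight]
  | cons k w ih =>
    have e : t.passWeight j (k :: w) = (t.Q j k : ℂ) * t.passWeight j w := by simp [passWeight]
    rw [e, norm_mul, Complex.norm_real, List.length_cons, pow_succ']
    exact mul_le_mul (hb.Q_le j k) ih (norm_nonneg _) (pow_nonneg hb.pos.le _)

theorem Bounds.l1_passing_le (j : ι) (w : List ι) : l1 (t.passing j (tens w)) ≤ 1 := by
  rw [passing_tens, map_smul_eq_mul, l1_tens, mul_one]
  exact (hb.norm_passWeight_le j w).trans
    (pow_le_one₀ (pow_nonneg hb.pos.le _) (pow_le_one₀ hb.pos.le hb.lt_one.le))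

theorem Bounds.l1_lower_le (l : ι) (w : List ι) : l1 (t.lower l (tens w)) ≤ K * w.length := by
  induction w with
  | nil => simp
  | cons k w ih =>
    rw [← create_tens, lower_create]
    refine (map_add_le_add l1 _ _).trans ?_
    rw [map_smul_eq_mul, map_smul_eq_mul, l1_tens, mul_one, Complex.norm_real]
    have h1 := (l1_create_le k (t.lower l (tens w))).trans ih
    have h2 : ‖t.Q l k‖ * l1 (create k (t.lower l (tens w))) ≤ 1 * (K * w.length) :=
      mul_le_mul (hb.Q_le_one l k) h1 (apply_nonneg _ _) zero_le_one
    have h3 := hb.c_le l k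
    push_cast [List.length_cons]
    linarith

theorem Bounds.l1_lowerRight_le (j : ι) (w : List ι) :
    l1 (t.lowerRight j (tens w)) ≤ K * w.length := by
  induction w with
  | nil => simp
  | cons k w ih =>
    rw [← create_tens, lowerRight_create]
    refine (map_add_le_add l1 _ _).trans ?_
    rw [map_smul_eq_mul]
    have h1 := (l1_create_le k (t.lowerRight j (tens w))).trans ih
    have h2 : ‖t.c k j‖ * l1 (t.passing k (tens w)) ≤ K * 1 :=
      mul_le_mul (hb.c_le k j) (hb.l1_passing_le k w) (apply_nonneg _ _) (by linarith [hb.one_le])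
    push_cast [List.length_cons]
    linarith

theorem Bounds.l1_lowerRight_le_of_degree (j : ι) {m n : ℕ} (hmn : m ≤ n) {x : FreeFock ι}
    (hx : x ∈ degree m) : l1 (t.lowerRight j x) ≤ K * n * l1 x := by
  refine seminorm_le_mul_l1 l1 _ fun w hw => ?_
  refine (hb.l1_lowerRight_le j w).trans ?_
  have : (w.length : ℝ) ≤ n := by exact_mod_cast (length_of_mem_degree hx hw).trans_le hmn
  have := hb.one_le
  gcongr

omit hb in
theorem contract_mem_degree (v : List ι) {n : ℕ} {x : FreeFock ι} (hx : x ∈ degree n) :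
    t.contract v x ∈ degree (n - v.length) := by
  induction v with
  | nil => simpa [contract]
  | cons r v ih =>
    simp only [contract, LinearMap.smul_apply, Module.End.mul_apply]
    exact Submodule.smul_mem _ _ (t.lowerRight_mem_degree r ih)

omit hb in
theorem contract_eq_zero (v : List ι) {n : ℕ} (hn : n < v.length) {x : FreeFock ι}
    (hx : x ∈ degree n) : t.contract v x = 0 := by
  induction v with
  | nil => simp at hn
  | cons r v ih =>
    simp only [contract, LinearMap.smul_apply, Module.End.mul_apply]
    rw [List.length_cons, Nat.lt_succ_iff] at hn
    rcases hn.lt_or_eq with h | h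
    · rw [ih h, map_zero, smul_zero]
    · have h0 : t.contract v x ∈ degree 0 := by
        have := contract_mem_degree (t := t) v hx
        rwa [h, Nat.sub_self] at this
      have h1 : t.lowerRight r (t.contract v x) = 0 := by
        have := eq_of_mem_degree (f := t.lowerRight r) (g := 0)
          (fun w hw => by rw [List.length_eq_zero_iff.1 hw]; simp) h0
        simpa using this
      rw [h1, smul_zero]

omit hb in
theorem coeff_contract_eq_zero (v : List ι) {n : ℕ} (hn : v.length ≠ n) {x : FreeFock ι}
    (hx : x ∈ degree n) : coeff [] (t.contract v x) = 0 := by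
  rcases lt_or_gt_of_ne hn with h | h
  · exact coeff_eq_zero_of_mem_degree (contract_mem_degree v hx) (by simp; omega)
  · rw [contract_eq_zero v h hx, map_zero]

/-- The decay of `contract v`. The left side includes the factor by which the letter in front of `v`
passes `v`. -/
theorem Bounds.l1_contract_le (v : List ι) {m n : ℕ} (hmn : m ≤ n) {x : FreeFock ι}
    (hx : x ∈ degree m) :
    (p ^ 8) ^ v.length * l1 (t.contract v x)
      ≤ p ^ (4 * v.length * (v.length + 1)) * (K * n) ^ v.length * l1 x := by
  have hp := hb.pos
  have hK : 0 ≤ K := zero_le_one.trans hb.one_le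
  induction v with
  | nil => simp [contract]
  | cons r v ih =>
    simp only [contract, LinearMap.smul_apply, Module.End.mul_apply]
    rw [map_smul_eq_mul, norm_neg]
    have h1 := hb.l1_lowerRight_le_of_degree r ((Nat.sub_le m v.length).trans hmn)
      (contract_mem_degree (t := t) v hx)
    have h2 := hb.norm_passWeight_le r v
    calc (p ^ 8) ^ (r :: v).length * (‖t.passWeight r v‖ * l1 (t.lowerRight r (t.contract v x)))
        ≤ (p ^ 8) ^ (r :: v).length * ((p ^ 8) ^ v.length * (K * n * l1 (t.contract v x))) := by
          gcongr
      _ = (p ^ 8) ^ (v.length + 1) * (K * n) * ((p ^ 8) ^ v.length * l1 (t.contract v x)) := by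
          rw [List.length_cons]; ring
      _ ≤ (p ^ 8) ^ (v.length + 1) * (K * n) *
          (p ^ (4 * v.length * (v.length + 1)) * (K * n) ^ v.length * l1 x) := by gcongr
      _ = _ := by rw [List.length_cons]; ring

/-- The decay of the coefficient of the vacuum in `D_k`. The factor `p` on the left compensates the
difference between `p ^ n ^ 2` and `p ^ (n ^ 2 - 1)`. -/
theorem Bounds.coeff_dualWord_le (k : ι) (w : List ι) {m n : ℕ} (hn : m + w.length = n)
    {x : FreeFock ι} (hx : x ∈ degree m) :
    p * ‖coeff [] (t.dualWord k w x)‖ ≤ w.length * (K * p ^ n ^ 2 * (K * n) ^ n * l1 x) := by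
  have hp := hb.pos
  have hK : 0 ≤ K := zero_le_one.trans hb.one_le
  induction w generalizing m x with
  | nil => simp [dualWord]
  | cons j v ih =>
    simp only [dualWord, LinearMap.add_apply, LinearMap.smul_apply, Module.End.mul_apply, map_add,
      map_smul, smul_eq_mul]
    rw [List.length_cons] at hn
    have h2 := ih (by omega) (createRight_mem_degree j hx)
    have h1 : p * ‖t.c j k * t.passWeight j v * coeff [] (t.contract v x)‖
        ≤ K * p ^ n ^ 2 * (K * n) ^ n * l1 x := by
      -- Only the splitting in the middle of the word contributes, where `contract v` reaches degree `0`.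
      by_cases hv : v.length = m
      · have hnK : 1 ≤ K * n := by
          have : (1 : ℝ) ≤ n := by exact_mod_cast (by omega : 1 ≤ n)
          nlinarith [hb.one_le]
        have e : n ^ 2 = 4 * v.length * (v.length + 1) + 1 := by subst hv; subst hn; ring
        rw [norm_mul, norm_mul]
        calc p * (‖t.c j k‖ * ‖t.passWeight j v‖ * ‖coeff [] (t.contract v x)‖)
            ≤ p * (K * (p ^ 8) ^ v.length * l1 (t.contract v x)) := by
              gcongr
              · exact hb.c_le j k
              · exact hb.norm_passWeight_le j v
              · exact norm_coeff_le_l1 _ _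
          _ = p * K * ((p ^ 8) ^ v.length * l1 (t.contract v x)) := by ring
          _ ≤ p * K * (p ^ (4 * v.length * (v.length + 1)) * (K * n) ^ v.length * l1 x) := by
              gcongr p * K * ?_
              exact hb.l1_contract_le v (by omega) hx
          _ ≤ p * K * (p ^ (4 * v.length * (v.length + 1)) * (K * n) ^ n * l1 x) := by
              gcongr
              omega
          _ = K * p ^ n ^ 2 * (K * n) ^ n * l1 x := by rw [e]; ring
      · rw [coeff_contract_eq_zero v hv hx, mul_zero, norm_zero, mul_zero]
        positivity
    have h3 : (v.length : ℝ) * (K * p ^ n ^ 2 * (K * n) ^ n * l1 (createRight j x))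
        ≤ v.length * (K * p ^ n ^ 2 * (K * n) ^ n * l1 x) := by
      have := l1_createRight_le j x
      gcongr
    have h4 := mul_le_mul_of_nonneg_left (norm_add_le
      (t.c j k * t.passWeight j v * coeff [] (t.contract v x))
      (coeff [] (t.dualWord k v (createRight j x)))) hp.le
    push_cast [List.length_cons]
    linarith

/-- The decay of the conjugate variables. -/
theorem Bounds.coeff_dualOp_le (k : ι) (w : List ι) :
    p * ‖coeff [] (t.dualOp k (tens w))‖
      ≤ (p ^ w.length * (K * w.length) ^ 2) ^ w.length := by
  have hp := hb.pos
  have hK : 0 ≤ K := zero_le_one.trans hb.one_le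
  have h := hb.coeff_dualWord_le k w (zero_add _) (tens_mem_degree (ι := ι) [])
  have e : t.dualOp k (tens w) = t.dualWord k w (tens []) := by simp [dualOp]
  rw [e]
  cases w with
  | nil => simp [dualWord]
  | cons j v =>
    set n := (j :: v).length with hn
    refine h.trans ?_
    have h1 : 1 ≤ K * n := by
      have : (1 : ℝ) ≤ n := by exact_mod_cast (by simp [hn] : 1 ≤ n)
      nlinarith [hb.one_le]
    have h2 : K * n ≤ (K * n) ^ n := le_self_pow₀ h1 (by simp [hn])
    rw [l1_tens]
    calc (n : ℝ) * (K * p ^ n ^ 2 * (K * n) ^ n * 1) = K * n * (p ^ n ^ 2 * (K * n) ^ n) := by ring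
      _ ≤ (K * n) ^ n * (p ^ n ^ 2 * (K * n) ^ n) := by gcongr
      _ = _ := by ring

/-- A map which intertwines the generators with bounded operators grows at most factorially. -/
theorem Bounds.seminorm_tens_le {Z : Type*} [AddCommGroup Z] [Module ℂ Z] (s : Seminorm ℂ Z)
    (g : FreeFock ι →ₗ[ℂ] Z) (O : ι → Z →ₗ[ℂ] Z) (hO : ∀ l z, s (O l z) ≤ K * s z)
    (hg : ∀ l x, g (t.gen l x) = O l (g x)) (w : List ι) :
    s (g (tens w)) ≤ (2 * K * w.length) ^ w.length * s (g (tens [])) := by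
  have hK : 0 ≤ K := zero_le_one.trans hb.one_le
  have main : ∀ n, ∀ w : List ι, w.length = n →
      s (g (tens w)) ≤ (2 * K) ^ n * n.factorial * s (g (tens [])) := by
    intro n
    induction n using Nat.strong_induction_on with
    | _ n ih =>
    intro w hw
    cases w with
    | nil => subst hw; simp
    | cons l w =>
      rw [List.length_cons] at hw
      subst hw
      set n := w.length with hn
      have e : g (tens (l :: w)) = O l (g (tens w)) - g (t.lower l (tens w)) := by
        rw [← hg, gen_apply, map_add, create_tens, add_sub_cancel_right]
      rw [e]
      -- `e_l ⊗ e_w = A_l e_w - (annihilation part)`, and the annihilation part has at most `n` terms of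
      -- degree `n - 1`, which the factorial absorbs.
      have h1 := ih n (by omega) w rfl
      have h2 : s (g (t.lower l (tens w))) ≤ (2 * K) ^ n * n.factorial * K * s (g (tens [])) := by
        cases hn' : n with
        | zero =>
          rw [List.length_eq_zero_iff.1 (hn.symm.trans hn')]
          simp
          positivity
        | succ m =>
          have hd : t.lower l (tens w) ∈ degree m := by
            have := t.lower_mem_degree l (tens_mem_degree w)
            rwa [← hn, hn', Nat.add_sub_cancel] at this
          have h3 := seminorm_le_mul_l1 s g (x := t.lower l (tens w)) fun v hv =>
            ih m (by omega) v (length_of_mem_degree hd hv)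
          have h4 := hb.l1_lower_le l w
          rw [← hn, hn'] at h4
          calc s (g (t.lower l (tens w)))
              ≤ (2 * K) ^ m * m.factorial * s (g (tens [])) * l1 (t.lower l (tens w)) := h3
            _ ≤ (2 * K) ^ m * m.factorial * s (g (tens [])) * (K * ↑(m + 1)) := by gcongr
            _ = (2 * K) ^ m * ((m + 1).factorial) * K * s (g (tens [])) := by
                push_cast [Nat.factorial_succ]; ring
            _ ≤ (2 * K) ^ (m + 1) * ((m + 1).factorial) * K * s (g (tens [])) := by
                gcongr
                · linarith [hb.one_le]
                · omega
      have h5 : s (O l (g (tens w))) ≤ K * ((2 * K) ^ n * n.factorial * s (g (tens []))) :=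
        (hO _ _).trans (by gcongr)
      calc s (O l (g (tens w)) - g (t.lower l (tens w)))
          ≤ s (O l (g (tens w))) + s (g (t.lower l (tens w))) := map_sub_le_add s _ _
        _ ≤ (2 * K) ^ (n + 1) * n.factorial * s (g (tens [])) := by
            rw [pow_succ]; linarith
        _ ≤ (2 * K) ^ (n + 1) * (n + 1).factorial * s (g (tens [])) := by
            gcongr
            omega
  refine (main _ w rfl).trans ?_
  rw [mul_pow (2 * K)]
  have : ((w.length.factorial : ℕ) : ℝ) ≤ (w.length : ℝ) ^ w.length := by
    exact_mod_cast Nat.factorial_le_pow _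
  gcongr

end TwistData
/-! ### Operators on the tensor product `E ⊗ E*` -/

section TensorOp

variable {E : Type*} [NormedAddCommGroup E] [InnerProductSpace ℂ E] [CompleteSpace E]

/-- The vector `u ⊗ ⟨v, ·⟩` of `E ⊗ E*`. -/
def ketBra (u v : E) : StdTensor E :=
  ((u ⊗ₜ[ℂ] InnerProductSpace.toDual ℂ E v : E ⊗[ℂ] StrongDual ℂ E) : StdTensor E)

theorem tensorOp_coe (a b : E →L[ℂ] E) (x : E ⊗[ℂ] StrongDual ℂ E) :
    tensorOp a b (x : StdTensor E)
      = ((TensorProduct.mapL a (ContinuousLinearMap.precomp ℂ b) x :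
        E ⊗[ℂ] StrongDual ℂ E) : StdTensor E) :=
  UniformSpace.Completion.map_coe (ContinuousLinearMap.uniformContinuous _) x

theorem dual_eq_toDual (f : StrongDual ℂ E) :
    ∃ v, f = InnerProductSpace.toDual ℂ E v :=
  ⟨(InnerProductSpace.toDual ℂ E).symm f, by simp⟩

theorem inner_dual (f g : StrongDual ℂ E) : inner ℂ f g =
    inner ℂ ((InnerProductSpace.toDual ℂ E).symm g) ((InnerProductSpace.toDual ℂ E).symm f) := rfl

theorem inner_stdTensor_coe (x y : E ⊗[ℂ] StrongDual ℂ E) :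
    inner ℂ (x : StdTensor E) (y : StdTensor E) = inner ℂ x y :=
  UniformSpace.Completion.inner_coe (𝕜 := ℂ) (E := E ⊗[ℂ] StrongDual ℂ E) x y

theorem inner_stdTensor_add_right (x y z : StdTensor E) :
    inner ℂ x (y + z) = inner ℂ x y + inner ℂ x z :=
  inner_add_right (𝕜 := ℂ) (E := StdTensor E) x y z

theorem inner_stdTensor_zero_right (x : StdTensor E) : inner ℂ x 0 = 0 :=
  inner_zero_right (𝕜 := ℂ) (E := StdTensor E) x

theorem continuous_inner_stdTensor (x : StdTensor E) : Continuous fun y => inner ℂ x y :=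
  (innerSL ℂ (E := StdTensor E) x).continuous

theorem inner_ketBra (u v u' v' : E) :
    inner ℂ (ketBra u v) (ketBra u' v') = inner ℂ u u' * inner ℂ v' v := by
  rw [ketBra, ketBra, inner_stdTensor_coe, TensorProduct.inner_tmul, inner_dual]
  simp

/-- The span of the vectors `u ⊗ ⟨v, ·⟩` is dense. -/
theorem stdTensor_induction {P : StdTensor E → Prop} (x : StdTensor E) (closed : IsClosed {x | P x})
    (zero : P 0) (ketBra : ∀ u v, P (ketBra u v)) (add : ∀ x y, P x → P y → P (x + y)) : P x := by
  refine UniformSpace.Completion.induction_on x closed fun y => ?_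
  induction y using TensorProduct.induction_on with
  | zero => rwa [UniformSpace.Completion.coe_zero]
  | tmul u f =>
    obtain ⟨v, rfl⟩ := dual_eq_toDual f
    exact ketBra u v
  | add x y hx hy =>
    rw [UniformSpace.Completion.coe_add]
    exact add _ _ hx hy

theorem inner_tensorOp (a b : E →L[ℂ] E) (u v : E) (x : StdTensor E) :
    inner ℂ (ketBra u v) (tensorOp a b x)
      = inner ℂ (ketBra (ContinuousLinearMap.adjoint a u) (b v)) x := by
  induction x using stdTensor_induction with
  | closed =>
    exact isClosed_eq ((continuous_inner_stdTensor _).comp (tensorOp a b).continuous)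
      (continuous_inner_stdTensor _)
  | zero => rw [map_zero, inner_stdTensor_zero_right, inner_stdTensor_zero_right]
  | ketBra s r =>
    rw [inner_ketBra, ketBra, ketBra, tensorOp_coe, inner_stdTensor_coe,
      TensorProduct.mapL_tmul, TensorProduct.inner_tmul, inner_dual,
      ContinuousLinearMap.adjoint_inner_left, LinearIsometryEquiv.symm_apply_apply,
      InnerProductSpace.toDual_symm_apply]
    simp
  | add x y hx hy =>
    rw [map_add, inner_stdTensor_add_right, inner_stdTensor_add_right, hx, hy]

/-- A vector orthogonal to every `u ⊗ ⟨v, ·⟩` vanishes. -/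
theorem eq_zero_of_inner_ketBra {x : StdTensor E} (h : ∀ u v, inner ℂ (ketBra u v) x = 0) :
    x = 0 := by
  have key : ∀ y : StdTensor E, inner ℂ x y = 0 := fun y => by
    induction y using stdTensor_induction with
    | closed => exact isClosed_eq (continuous_inner_stdTensor x) continuous_const
    | zero => exact inner_stdTensor_zero_right x
    | ketBra u v =>
      have := inner_conj_symm (𝕜 := ℂ) (E := StdTensor E) x (ketBra u v)
      rw [← this, h, map_zero]
    | add y z hy hz => rw [inner_stdTensor_add_right, hy, hz, add_zero]
  exact inner_self_eq_zero (𝕜 := ℂ) (E := StdTensor E) |>.1 (key x)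

theorem norm_tensorOp_le (a b : E →L[ℂ] E) : ‖tensorOp a b‖ ≤ ‖a‖ * ‖b‖ := by
  refine ContinuousLinearMap.opNorm_le_bound _ (by positivity) fun x => ?_
  induction x using UniformSpace.Completion.induction_on with
  | hp => exact isClosed_le (by fun_prop) (by fun_prop)
  | ih x =>
    rw [tensorOp_coe, UniformSpace.Completion.norm_coe, UniformSpace.Completion.norm_coe]
    refine (ContinuousLinearMap.le_opNorm _ _).trans ?_
    gcongr
    refine (TensorProduct.norm_mapL_le _ _).trans ?_
    gcongr
    refine ContinuousLinearMap.opNorm_le_bound _ (by positivity) fun f => ?_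
    rw [mul_comm]
    exact ContinuousLinearMap.opNorm_comp_le _ _

/-- A Hilbert space `F` which is the tensor product `E ⊗ E*`, with the vectors `ketBra u v`, that is
`u ⊗ ⟨v, ·⟩`, and the operators `op a b`, that is `a ⊗ bᵒᵖ`. The arguments below only use these
properties, and not the construction of `StdTensor E` as a completion. -/
structure TensorModel (E F : Type*) [NormedAddCommGroup E] [InnerProductSpace ℂ E] [CompleteSpace E]
    [NormedAddCommGroup F] [InnerProductSpace ℂ F] where
  ketBra : E → E → F
  op : (E →L[ℂ] E) → (E →L[ℂ] E) → (F →L[ℂ] F)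
  inner_ketBra : ∀ u v u' v', inner ℂ (ketBra u v) (ketBra u' v') = inner ℂ u u' * inner ℂ v' v
  inner_op : ∀ a b u v x, inner ℂ (ketBra u v) (op a b x)
    = inner ℂ (ketBra (ContinuousLinearMap.adjoint a u) (b v)) x
  total : ∀ x, (∀ u v, inner ℂ (ketBra u v) x = 0) → x = 0
  norm_op_le : ∀ a b, ‖op a b‖ ≤ ‖a‖ * ‖b‖

variable (E) in
/-- The Hilbert space tensor product `E ⊗ E*`. -/
def stdTensorModel : TensorModel E (StdTensor E) where
  ketBra := ketBra
  op := tensorOp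
  inner_ketBra := inner_ketBra
  inner_op := inner_tensorOp
  total _ := eq_zero_of_inner_ketBra
  norm_op_le := norm_tensorOp_le

namespace TensorModel

variable {F : Type*} [NormedAddCommGroup F] [InnerProductSpace ℂ F] (T : TensorModel E F)

theorem op_ext {S S' : F →L[ℂ] F}
    (h : ∀ u v x, inner ℂ (T.ketBra u v) (S x) = inner ℂ (T.ketBra u v) (S' x)) : S = S' := by
  ext x
  exact sub_eq_zero.1 (T.total _ fun u v => by rw [inner_sub_right, h, sub_self])

theorem vec_ext {x y : F} (h : ∀ u v, inner ℂ (T.ketBra u v) x = inner ℂ (T.ketBra u v) y) :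
    x = y :=
  sub_eq_zero.1 (T.total _ fun u v => by rw [inner_sub_right, h, sub_self])

theorem op_one_one : T.op 1 1 = 1 :=
  T.op_ext fun u v x => by
    rw [T.inner_op]
    simp [← ContinuousLinearMap.star_eq_adjoint]

theorem op_mul (a b a' b' : E →L[ℂ] E) : T.op a b * T.op a' b' = T.op (a * a') (b' * b) :=
  T.op_ext fun u v x => by
    simp [T.inner_op, ← ContinuousLinearMap.star_eq_adjoint]

theorem ketBra_add_left (u u' v : E) :
    T.ketBra (u + u') v = T.ketBra u v + T.ketBra u' v :=
  T.vec_ext fun s r => by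
    simp only [inner_add_right, T.inner_ketBra]
    ring

theorem ketBra_add_right (u v v' : E) :
    T.ketBra u (v + v') = T.ketBra u v + T.ketBra u v' :=
  T.vec_ext fun s r => by
    simp only [inner_add_right, inner_add_left, T.inner_ketBra]
    ring

theorem ketBra_smul_left (a : ℂ) (u v : E) : T.ketBra (a • u) v = a • T.ketBra u v :=
  T.vec_ext fun s r => by
    simp only [inner_smul_right, T.inner_ketBra]
    ring

theorem ketBra_smul_right (a : ℂ) (u v : E) : T.ketBra u (a • v) = conj a • T.ketBra u v :=
  T.vec_ext fun s r => by
    simp only [inner_smul_right, inner_smul_left, T.inner_ketBra]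
    ring

/-- The linear map `a ↦ a ⊗ 1`. -/
def left : (E →L[ℂ] E) →ₗ[ℂ] (F →L[ℂ] F) where
  toFun a := T.op a 1
  map_add' a a' := T.op_ext fun u v x => by
    simp only [T.inner_op, map_add, add_apply, inner_add_right, ketBra_add_left, inner_add_left]
  map_smul' a b := T.op_ext fun u v x => by
    simp only [T.inner_op, LinearIsometryEquiv.map_smulₛₗ, smul_apply, ketBra_smul_left,
      inner_smul_left, inner_smul_right, RingHom.id_apply, Complex.conj_conj]

/-- The linear map `b ↦ 1 ⊗ bᵒᵖ`. -/
def right : (E →L[ℂ] E) →ₗ[ℂ] (F →L[ℂ] F) where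
  toFun b := T.op 1 b
  map_add' b b' := T.op_ext fun u v x => by
    simp only [T.inner_op, add_apply, inner_add_right, ketBra_add_right, inner_add_left]
  map_smul' a b := T.op_ext fun u v x => by
    simp only [T.inner_op, smul_apply, ketBra_smul_right, inner_smul_left, inner_smul_right,
      RingHom.id_apply, Complex.conj_conj]

theorem left_apply (a : E →L[ℂ] E) : T.left a = T.op a 1 := rfl

theorem norm_ketBra (u v : E) : ‖T.ketBra u v‖ = ‖u‖ * ‖v‖ := by
  have h : ‖T.ketBra u v‖ ^ 2 = (‖u‖ * ‖v‖) ^ 2 := by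
    have h1 := inner_self_eq_norm_sq_to_K (𝕜 := ℂ) (T.ketBra u v)
    rw [T.inner_ketBra, inner_self_eq_norm_sq_to_K, inner_self_eq_norm_sq_to_K] at h1
    rw [mul_pow]
    exact_mod_cast h1.symm
  exact (pow_left_inj₀ (norm_nonneg _) (by positivity) two_ne_zero).1 h

theorem continuous_ketBra_left (v : E) : Continuous fun u => T.ketBra u v :=
  AddMonoidHomClass.continuous_of_bound
    (AddMonoidHom.mk' (fun u => T.ketBra u v) fun u u' => T.ketBra_add_left u u' v) ‖v‖
    fun u => (T.norm_ketBra u v).le.trans_eq (mul_comm _ _)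

theorem continuous_ketBra_right (u : E) : Continuous fun v => T.ketBra u v :=
  AddMonoidHomClass.continuous_of_bound
    (AddMonoidHom.mk' (fun v => T.ketBra u v) fun v v' => T.ketBra_add_right u v v') ‖u‖
    fun v => (T.norm_ketBra u v).le

end TensorModel

/-- The von Neumann algebra generated by a set is closed in norm. -/
theorem isClosed_vonNeumannGenerated (S : Set (E →L[ℂ] E)) :
    IsClosed {x | x ∈ vonNeumannGenerated S} := by
  have : {x | x ∈ vonNeumannGenerated S} = ⋂ z ∈ (StarSubalgebra.centralizer ℂ S : Set (E →L[ℂ] E)),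
      {x | z * x = x * z} ∩ {x | star z * x = x * star z} := by
    ext x
    simp only [Set.mem_iInter, Set.mem_inter_iff, Set.mem_ofPred_eq]
    change x ∈ StarSubalgebra.centralizer ℂ _ ↔ _
    rw [StarSubalgebra.mem_centralizer_iff]
  rw [this]
  refine isClosed_biInter fun z _ => IsClosed.inter ?_ ?_
  · exact isClosed_eq (by fun_prop) (by fun_prop)
  · exact isClosed_eq (by fun_prop) (by fun_prop)

theorem subset_vonNeumannGenerated {S : Set (E →L[ℂ] E)} {x : E →L[ℂ] E} (hx : x ∈ S) :
    x ∈ vonNeumannGenerated S := by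
  change x ∈ StarSubalgebra.centralizer ℂ _
  rw [StarSubalgebra.mem_centralizer_iff]
  intro z hz
  have hz : z ∈ StarSubalgebra.centralizer ℂ S := hz
  have hz' : star z ∈ StarSubalgebra.centralizer ℂ S := star_mem hz
  rw [StarSubalgebra.mem_centralizer_iff] at hz hz'
  exact ⟨((hz x hx).1).symm, ((hz' x hx).1).symm⟩

/-- An operator which commutes with the elements of `S` and their adjoints commutes with the von
Neumann algebra generated by `S`. -/
theorem commute_of_mem_vonNeumannGenerated {S : Set (E →L[ℂ] E)} {x z : E →L[ℂ] E}
    (hx : x ∈ vonNeumannGenerated S) (hz : ∀ s ∈ S, s * z = z * s ∧ star s * z = z * star s) :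
    z * x = x * z := by
  have hx : x ∈ StarSubalgebra.centralizer ℂ _ := hx
  rw [StarSubalgebra.mem_centralizer_iff] at hx
  exact (hx z ((StarSubalgebra.mem_centralizer_iff ℂ).2 hz)).1

end TensorOp
/-! ### Bounded generators on the Hilbert space -/

namespace TwistData
variable {ι : Type*} [DecidableEq ι] (t : TwistData ι)

theorem annihilate_mem_degree (l : ι) {n : ℕ} {x : FreeFock ι} (hx : x ∈ degree n) :
    t.annihilate l x ∈ degree (n - 1) := by
  refine map_mem_of_degree (fun w hw => ?_) hx
  clear hx
  induction w generalizing n with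
  | nil => simp
  | cons k w ih =>
    rw [← hw, ← create_tens, annihilate_create, List.length_cons, Nat.add_sub_cancel]
    refine Submodule.add_mem _ ?_ (Submodule.smul_mem _ _ ?_)
    · split_ifs
      · exact tens_mem_degree w
      · exact zero_mem _
    · cases w with
      | nil => simp
      | cons r w => exact create_mem_degree k (ih (n := w.length + 1) rfl)

theorem annihilateRight_mem_degree (j : ι) {n : ℕ} {x : FreeFock ι} (hx : x ∈ degree n) :
    t.annihilateRight j x ∈ degree (n - 1) := by
  refine map_mem_of_degree (fun w hw => ?_) hx
  clear hx
  induction w generalizing n with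
  | nil => simp
  | cons k w ih =>
    rw [← hw, ← create_tens, annihilateRight_create, List.length_cons, Nat.add_sub_cancel]
    refine Submodule.add_mem _ ?_ ?_
    · cases w with
      | nil => simp
      | cons r w => exact create_mem_degree k (ih (n := w.length + 1) rfl)
    · split_ifs
      · exact t.passing_mem_degree j (tens_mem_degree w)
      · exact zero_mem _

end TwistData

/-- An operator which lowers the degree is locally nilpotent. -/
theorem eventually_pow_apply_eq_zero {ι : Type*} (f : Module.End ℂ (FreeFock ι))
    (h0 : f (tens []) = 0)
    (hf : ∀ n, ∀ x ∈ degree (ι := ι) n, f x ∈ degree (ι := ι) (n - 1)) (x : FreeFock ι) :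
    ∃ N, ∀ n ≥ N, (f ^ n) x = 0 := by
  have key : ∀ m, ∀ x ∈ degree (ι := ι) m, ∀ n, m < n → (f ^ n) x = 0 := by
    intro m
    induction m with
    | zero =>
      intro x hx n hn
      have h1 : f x = 0 := (Submodule.mem_bot ℂ).1 (map_mem_of_degree
        (fun w hw => by rw [List.length_eq_zero_iff.1 hw, h0]; exact zero_mem _) hx)
      obtain ⟨n, rfl⟩ : ∃ k, n = k + 1 := ⟨n - 1, by omega⟩
      rw [pow_succ, Module.End.mul_apply, h1, map_zero]
    | succ m ih =>
      intro x hx n hn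
      obtain ⟨n, rfl⟩ : ∃ k, n = k + 1 := ⟨n - 1, by omega⟩
      rw [pow_succ, Module.End.mul_apply]
      have h1 := hf _ x hx
      rw [Nat.add_sub_cancel] at h1
      exact ih _ h1 n (by omega)
  induction x using tens_induction with
  | tens w => exact ⟨w.length + 1, fun n hn => key _ _ (tens_mem_degree w) n hn⟩
  | add x y hx hy =>
    obtain ⟨N, hN⟩ := hx
    obtain ⟨M, hM⟩ := hy
    exact ⟨max N M, fun n hn => by
      rw [map_add, hN n (le_of_max_le_left hn), hM n (le_of_max_le_right hn), add_zero]⟩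
  | smul a x hx =>
    obtain ⟨N, hN⟩ := hx
    exact ⟨N, fun n hn => by rw [map_smul, hN n hn, smul_zero]⟩

/-- If `S'` is adjoint to `S`, locally nilpotent, and `S' S = 1 + q S S'` with `|q| < 1`, then `S` and
`S'` are bounded. -/
theorem norm_sq_le_of_qCommutation {V E : Type*} [AddCommGroup V] [Module ℂ V]
    [NormedAddCommGroup E] [InnerProductSpace ℂ E] (i : V →ₗ[ℂ] E) (S S' : Module.End ℂ V)
    (hadj : ∀ x y, inner ℂ (i (S x)) (i y) = inner ℂ (i x) (i (S' y)))
    {q r : ℝ} (hr0 : 0 ≤ r) (hr : r < 1) (hq : |q| ≤ r)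
    (hcomm : ∀ x, S' (S x) = x + (q : ℂ) • S (S' x))
    (hnil : ∀ x, ∃ N, ∀ n ≥ N, (S' ^ n) x = 0) (x : V) :
    ‖i (S x)‖ ^ 2 ≤ (1 - r)⁻¹ * ‖i x‖ ^ 2 ∧ ‖i (S' x)‖ ^ 2 ≤ (1 - r)⁻¹ * ‖i x‖ ^ 2 := by
  have hr' : 0 < 1 - r := by linarith
  set M := (1 - r)⁻¹ with hM
  have hM0 : 0 < M := inv_pos.2 hr'
  have hMr : 1 + r * M = M := by
    rw [hM]; field_simp; ring
  -- A bound for `S` at `S' x` gives one for `S'` at `x`, by Cauchy-Schwarz; and a bound for `S'` at `x`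
  -- gives one for `S` at `x`, by the commutation relation. The constant `(1 - r)⁻¹` is the fixed point
  -- of `M ↦ 1 + r M`, and the induction on the order of nilpotency never presupposes boundedness.
  have lowering : ∀ x, ‖i (S (S' x))‖ ^ 2 ≤ M * ‖i (S' x)‖ ^ 2 → ‖i (S' x)‖ ^ 2 ≤ M * ‖i x‖ ^ 2 := by
    intro x h
    have h1 : ‖i (S' x)‖ ^ 2 ≤ ‖i (S (S' x))‖ * ‖i x‖ := by
      have e : inner ℂ (i (S (S' x))) (i x) = ((‖i (S' x)‖ ^ 2 : ℝ) : ℂ) := by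
        rw [hadj, inner_self_eq_norm_sq_to_K]; simp
      have := norm_inner_le_norm (𝕜 := ℂ) (i (S (S' x))) (i x)
      rwa [e, Complex.norm_real, Real.norm_of_nonneg (by positivity)] at this
    rcases (sq_nonneg ‖i (S' x)‖).eq_or_lt with h2 | h2
    · rw [← h2]; positivity
    · refine le_of_mul_le_mul_left ?_ h2
      calc ‖i (S' x)‖ ^ 2 * ‖i (S' x)‖ ^ 2 ≤ (‖i (S (S' x))‖ * ‖i x‖) * (‖i (S (S' x))‖ * ‖i x‖) := by
            gcongr
        _ = ‖i (S (S' x))‖ ^ 2 * ‖i x‖ ^ 2 := by ring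
        _ ≤ M * ‖i (S' x)‖ ^ 2 * ‖i x‖ ^ 2 := by gcongr
        _ = _ := by ring
  have raising : ∀ n x, (S' ^ n) x = 0 → ‖i (S x)‖ ^ 2 ≤ M * ‖i x‖ ^ 2 := by
    intro n
    induction n with
    | zero =>
      intro x hx
      have hx : x = 0 := by simpa using hx
      simp [hx]
    | succ n ih =>
      intro x hx
      rw [pow_succ, Module.End.mul_apply] at hx
      have h1 := lowering x (ih _ hx)
      have h2 : ‖i (S x)‖ ^ 2 = ‖i x‖ ^ 2 + q * ‖i (S' x)‖ ^ 2 := by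
        have e : inner ℂ (i (S x)) (i (S x)) = inner ℂ (i x) (i x)
            + (q : ℂ) * conj (inner ℂ (i (S' x)) (i (S' x))) := by
          rw [hadj, hcomm, map_add, map_smul, inner_add_right, inner_smul_right, ← hadj,
            inner_conj_symm]
        simp only [inner_self_eq_norm_sq_to_K] at e
        have := congrArg Complex.re e
        simpa [← Complex.ofReal_pow] using this
      have h3 : q * ‖i (S' x)‖ ^ 2 ≤ r * (M * ‖i x‖ ^ 2) :=
        mul_le_mul ((le_abs_self q).trans hq) h1 (by positivity) hr0
      calc ‖i (S x)‖ ^ 2 ≤ ‖i x‖ ^ 2 + r * (M * ‖i x‖ ^ 2) := by rw [h2]; gcongr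
        _ = (1 + r * M) * ‖i x‖ ^ 2 := by ring
        _ = _ := by rw [hMr]
  have h : ∀ x, ‖i (S x)‖ ^ 2 ≤ M * ‖i x‖ ^ 2 := fun x =>
    let ⟨N, hN⟩ := hnil x
    raising N x (hN N le_rfl)
  exact ⟨h x, lowering x (h _)⟩

/-- A Hilbert space completion of the algebraic Fock space, in which creation and annihilation are
adjoint to each other. The condition on the covariance `c` says that `c k l = ⟨J e_k, e_l⟩` for
a conjugate linear involution `J`. -/
structure FockRep {ι : Type*} [DecidableEq ι] [Fintype ι] (t : TwistData ι) (E : Type*)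
    [NormedAddCommGroup E] [InnerProductSpace ℂ E] where
  incl : FreeFock ι →ₗ[ℂ] E
  dense : DenseRange incl
  inner_vacuum : inner ℂ (incl (tens [])) (incl (tens [])) = 1
  inner_create : ∀ k x y, inner ℂ (incl (create k x)) (incl y)
    = inner ℂ (incl x) (incl (t.annihilate k y))
  sum_conj_c_mul : ∀ k m, ∑ l, conj (t.c k l) * t.c l m = if k = m then 1 else 0

namespace FockRep

open TwistData

variable {ι : Type*} [DecidableEq ι] [Fintype ι] {t : TwistData ι} {E : Type*}
  [NormedAddCommGroup E] [InnerProductSpace ℂ E] [CompleteSpace E] (R : FockRep t E)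

/-- The vacuum vector. -/
def Ω : E := R.incl (tens [])

theorem inner_annihilate (k : ι) (x y : FreeFock ι) :
    inner ℂ (R.incl (t.annihilate k x)) (R.incl y) = inner ℂ (R.incl x) (R.incl (create k y)) := by
  rw [← inner_conj_symm, ← R.inner_create, inner_conj_symm]

theorem inner_Ω_incl (y : FreeFock ι) : inner ℂ R.Ω (R.incl y) = coeff [] y := by
  refine LinearMap.congr_fun (f := (innerSL ℂ R.Ω).toLinearMap ∘ₗ R.incl) (g := coeff [])
    (linearMap_ext_tens fun w => ?_) y
  change inner ℂ R.Ω (R.incl (tens w)) = _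
  cases w with
  | nil => rw [coeff_tens_self]; exact R.inner_vacuum
  | cons k w =>
    rw [coeff_tens_of_ne (by simp), ← create_tens, Ω, ← R.inner_annihilate]
    simp

/-- A letter can be annihilated from a tensor of degree one from either side. -/
theorem coeff_nil_annihilate (j : ι) (y : FreeFock ι) :
    coeff [] (t.annihilate j y) = coeff [] (t.annihilateRight j y) := by
  refine LinearMap.congr_fun (f := coeff [] ∘ₗ t.annihilate j)
    (g := coeff [] ∘ₗ t.annihilateRight j) (linearMap_ext_tens fun w => ?_) y
  have hc : ∀ (k : ι) (x : FreeFock ι), coeff [] (create k x) = 0 := fun k x => by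
    refine LinearMap.congr_fun (f := coeff [] ∘ₗ create k) (g := 0)
      (linearMap_ext_tens fun w => ?_) x
    simp [coeff_tens_of_ne]
  cases w with
  | nil => simp
  | cons k w =>
    simp only [LinearMap.comp_apply]
    rw [← create_tens, annihilate_create, annihilateRight_create, map_add, map_add, map_smul, hc, hc,
      smul_zero, add_zero, zero_add]
    split_ifs
    · cases w with
      | nil => simp
      | cons r w => rw [passing_tens, map_smul, coeff_tens_of_ne (by simp), smul_zero]
    · rfl

/-- Right creation and right annihilation are adjoint as well, by induction on the word of `x`, since right
creation commutes with left creation, and right annihilation with left annihilation. -/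
theorem inner_createRight (j : ι) (x y : FreeFock ι) :
    inner ℂ (R.incl (createRight j x)) (R.incl y)
      = inner ℂ (R.incl x) (R.incl (t.annihilateRight j y)) := by
  induction x using tens_induction generalizing y with
  | tens w =>
    induction w generalizing y with
    | nil =>
      have e : createRight j (tens ([] : List ι)) = create j (tens []) := by simp
      rw [e, R.inner_create]
      change inner ℂ R.Ω _ = inner ℂ R.Ω _
      rw [inner_Ω_incl, inner_Ω_incl, coeff_nil_annihilate]
    | cons k w ih =>
      rw [← create_tens, createRight_create, R.inner_create, ih, R.inner_create,
        annihilateRight_annihilate]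
  | add x z hx hz => rw [map_add, map_add, map_add, inner_add_left, inner_add_left, hx, hz]
  | smul a x hx => rw [map_smul, map_smul, map_smul, inner_smul_left, inner_smul_left, hx]

/-- An operator on the algebraic Fock space which is bounded in the norm of the Hilbert space. -/
def IsBdd (f : Module.End ℂ (FreeFock ι)) : Prop := ∃ C, ∀ x, ‖R.incl (f x)‖ ≤ C * ‖R.incl x‖

variable {R}

theorem IsBdd.add {f g : Module.End ℂ (FreeFock ι)} (hf : R.IsBdd f) (hg : R.IsBdd g) :
    R.IsBdd (f + g) := by
  obtain ⟨C, hC⟩ := hf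
  obtain ⟨C', hC'⟩ := hg
  refine ⟨C + C', fun x => ?_⟩
  rw [LinearMap.add_apply, map_add, add_mul]
  exact norm_add_le_of_le (hC x) (hC' x)

theorem IsBdd.smul {f : Module.End ℂ (FreeFock ι)} (hf : R.IsBdd f) (a : ℂ) : R.IsBdd (a • f) := by
  obtain ⟨C, hC⟩ := hf
  refine ⟨‖a‖ * C, fun x => ?_⟩
  rw [LinearMap.smul_apply, map_smul, norm_smul, mul_assoc]
  gcongr
  exact hC x

theorem IsBdd.sum {κ : Type*} {s : Finset κ} {f : κ → Module.End ℂ (FreeFock ι)}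
    (hf : ∀ k ∈ s, R.IsBdd (f k)) : R.IsBdd (∑ k ∈ s, f k) :=
  Finset.sum_induction f _ (fun _ _ => IsBdd.add) ⟨0, by simp⟩ hf

theorem IsBdd.of_sq {f : Module.End ℂ (FreeFock ι)} {C : ℝ}
    (h : ∀ x, ‖R.incl (f x)‖ ^ 2 ≤ C * ‖R.incl x‖ ^ 2) : R.IsBdd f :=
  ⟨Real.sqrt C, fun x => by
    have h1 := Real.sqrt_le_sqrt (h x)
    rwa [Real.sqrt_sq (norm_nonneg _), Real.sqrt_mul' _ (by positivity),
      Real.sqrt_sq (norm_nonneg _)] at h1⟩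

variable {p K : ℝ}

theorem pow_eight_lt_one (hb : t.Bounds p K) : p ^ 8 < 1 :=
  pow_lt_one₀ hb.pos.le hb.lt_one (by norm_num)

theorem norm_sq_create_le (hb : t.Bounds p K) (k : ι) (x : FreeFock ι) :
    ‖R.incl (create k x)‖ ^ 2 ≤ (1 - p ^ 8)⁻¹ * ‖R.incl x‖ ^ 2 ∧
      ‖R.incl (t.annihilate k x)‖ ^ 2 ≤ (1 - p ^ 8)⁻¹ * ‖R.incl x‖ ^ 2 :=
  norm_sq_le_of_qCommutation R.incl (create k) (t.annihilate k) (R.inner_create k)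
    (pow_nonneg hb.pos.le _) (pow_eight_lt_one hb) (hb.Q_le k k)
    (fun x => by rw [annihilate_create, if_pos rfl])
    (eventually_pow_apply_eq_zero _ (t.annihilate_vacuum k)
      fun _ _ => t.annihilate_mem_degree k) x

theorem norm_sq_createRight_le (hb : t.Bounds p K) (k : ι) (x : FreeFock ι) :
    ‖R.incl (createRight k x)‖ ^ 2 ≤ (1 - p ^ 8)⁻¹ * ‖R.incl x‖ ^ 2 ∧
      ‖R.incl (t.annihilateRight k x)‖ ^ 2 ≤ (1 - p ^ 8)⁻¹ * ‖R.incl x‖ ^ 2 :=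
  norm_sq_le_of_qCommutation R.incl (createRight k) (t.annihilateRight k) (R.inner_createRight k)
    (pow_nonneg hb.pos.le _) (pow_eight_lt_one hb) (hb.Q_le k k)
    (fun x => by rw [annihilateRight_createRight, if_pos rfl])
    (eventually_pow_apply_eq_zero _ (t.annihilateRight_vacuum k)
      fun _ _ => t.annihilateRight_mem_degree k) x

theorem isBdd_create (hb : t.Bounds p K) (k : ι) : R.IsBdd (create k) :=
  .of_sq fun x => (norm_sq_create_le hb k x).1

theorem isBdd_annihilate (hb : t.Bounds p K) (k : ι) : R.IsBdd (t.annihilate k) :=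
  .of_sq fun x => (norm_sq_create_le hb k x).2

theorem isBdd_gen (hb : t.Bounds p K) (l : ι) : R.IsBdd (t.gen l) :=
  (isBdd_create hb l).add (.sum fun m _ => (isBdd_annihilate hb m).smul _)

theorem isBdd_genRight (hb : t.Bounds p K) (j : ι) : R.IsBdd (t.genRight j) :=
  IsBdd.add (.of_sq fun x => (norm_sq_createRight_le hb j x).1)
    (.sum fun m _ => (IsBdd.of_sq fun x => (norm_sq_createRight_le hb m x).2).smul _)

variable (R)

/-- The extension of a bounded operator on the algebraic Fock space. -/
def ext (f : Module.End ℂ (FreeFock ι)) : E →L[ℂ] E := (R.incl ∘ₗ f).extendOfNorm R.incl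

variable {R}

theorem IsBdd.ext_incl {f : Module.End ℂ (FreeFock ι)} (hf : R.IsBdd f) (x : FreeFock ι) :
    R.ext f (R.incl x) = R.incl (f x) :=
  LinearMap.extendOfNorm_eq (f := R.incl ∘ₗ f) R.dense hf x

theorem ext_of_incl {F : Type*} [AddCommGroup F] [TopologicalSpace F] [T2Space F] [Module ℂ F]
    {S T : E →L[ℂ] F}
    (h : ∀ x, S (R.incl x) = T (R.incl x)) : S = T := by
  ext x
  exact R.dense.induction_on (p := fun x => S x = T x) x (isClosed_eq S.continuous T.continuous) h

theorem eq_zero_of_inner_incl {v : E} (h : ∀ x, inner ℂ (R.incl x) v = 0) : v = 0 := by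
  have key : ∀ y, inner ℂ y v = 0 := fun y =>
    R.dense.induction_on (p := fun y => inner ℂ y v = 0) y
      (isClosed_eq (by fun_prop) continuous_const) h
  exact inner_self_eq_zero.1 (key v)

variable (R)

/-- The generators `A_l`. -/
def A (l : ι) : E →L[ℂ] E := R.ext (t.gen l)

/-- The right generators `B_j`. -/
def B (j : ι) : E →L[ℂ] E := R.ext (t.genRight j)

variable {R}

theorem A_incl (hb : t.Bounds p K) (l : ι) (x : FreeFock ι) :
    R.A l (R.incl x) = R.incl (t.gen l x) := (isBdd_gen hb l).ext_incl x

theorem B_incl (hb : t.Bounds p K) (j : ι) (x : FreeFock ι) :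
    R.B j (R.incl x) = R.incl (t.genRight j x) := (isBdd_genRight hb j).ext_incl x

theorem A_mul_B (hb : t.Bounds p K) (l j : ι) : R.A l * R.B j = R.B j * R.A l :=
  ext_of_incl fun x => by
    simp only [mul_apply_eq_comp]
    rw [A_incl hb, B_incl hb, B_incl hb, A_incl hb, gen_genRight]

/-- The adjoint of `A_l` is `∑ₘ conj (c l m) • A_m`, on the algebraic Fock space. -/
theorem inner_gen (l : ι) (x y : FreeFock ι) :
    inner ℂ (R.incl (t.gen l x)) (R.incl y)
      = ∑ m, conj (t.c l m) * inner ℂ (R.incl x) (R.incl (t.gen m y)) := by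
  simp only [gen_apply, lower_apply, map_add, map_sum, map_smul, inner_add_left, inner_add_right,
    sum_inner, inner_sum, inner_smul_left, inner_smul_right, R.inner_create, R.inner_annihilate,
    mul_add, Finset.sum_add_distrib]
  rw [add_comm]
  congr 1
  simp only [Finset.mul_sum]
  rw [Finset.sum_comm]
  simp only [← mul_assoc, ← Finset.sum_mul, R.sum_conj_c_mul]
  simp

/-- The generators span a self-adjoint space. -/
theorem star_A (hb : t.Bounds p K) (l : ι) : star (R.A l) = ∑ m, conj (t.c l m) • R.A m :=
  ext_of_incl (R := R) fun y => sub_eq_zero.1 (eq_zero_of_inner_incl (R := R) fun x => by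
    rw [inner_sub_right, ContinuousLinearMap.star_eq_adjoint,
      ContinuousLinearMap.adjoint_inner_right, A_incl hb, inner_gen, sub_eq_zero]
    simp [inner_sum, inner_smul_right, A_incl hb])

/-- The Gram matrix of the dual basis and the simple tensors. -/
theorem inner_dualBasis {u : List ι → FreeFock ι} (hu0 : u [] = tens [])
    (hud : ∀ w, u w ∈ degree w.length)
    (hu : ∀ j k w, t.annihilate j (u (k :: w)) = if j = k then u w else 0) (w : List ι)
    (x : FreeFock ι) : inner ℂ (R.incl (u w)) (R.incl x) = coeff w x := by
  refine LinearMap.congr_fun (f := (innerSL ℂ (R.incl (u w))).toLinearMap ∘ₗ R.incl) (g := coeff w)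
    (linearMap_ext_tens fun v => ?_) x
  change inner ℂ (R.incl (u w)) (R.incl (tens v)) = _
  induction v generalizing w with
  | nil =>
    cases w with
    | nil => rw [hu0, coeff_tens_self]; exact R.inner_vacuum
    | cons k w =>
      rw [← inner_conj_symm]
      change conj (inner ℂ R.Ω _) = _
      rw [inner_Ω_incl, coeff_eq_zero_of_mem_degree (hud _) (by simp), map_zero,
        coeff_tens_of_ne (by simp)]
  | cons j v ih =>
    rw [← create_tens, ← R.inner_annihilate, create_tens]
    cases w with
    | nil => rw [hu0, annihilate_vacuum, map_zero, inner_zero_left, coeff_tens_of_ne (by simp)]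
    | cons k w =>
      rw [hu]
      by_cases h : j = k
      · subst h
        rw [if_pos rfl, ih]
        by_cases hvw : w = v
        · subst hvw; rw [coeff_tens_self, coeff_tens_self]
        · rw [coeff_tens_of_ne hvw, coeff_tens_of_ne (by simpa using hvw)]
      · rw [if_neg h, map_zero, inner_zero_left, coeff_tens_of_ne (by simp [Ne.symm h])]

/-- The simple tensors are linearly independent in the Hilbert space, since they have a dual basis. -/
theorem injective_incl (hb : t.Bounds p K) : Function.Injective R.incl := by
  obtain ⟨C, u, -, hu0, hud, -, hu⟩ :=
    t.exists_dualBasis (pow_nonneg hb.pos.le 8) (pow_eight_lt_one hb) hb.Q_le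
  refine (injective_iff_map_eq_zero R.incl).2 fun x hx => eq_zero_of_coeff fun w => ?_
  rw [← inner_dualBasis (R := R) hu0 hud hu, hx, inner_zero_right]

end FockRep
/-! ### The difference quotients -/

/-- Induction over the vectors `A_{l_1} ⋯ A_{l_n} Ω`, which span the algebraic Fock space. -/
theorem TwistData.gen_induction {ι : Type*} [DecidableEq ι] [Fintype ι] (t : TwistData ι)
    {P : FreeFock ι → Prop} (vacuum : P (tens [])) (gen : ∀ l x, P x → P (t.gen l x))
    (add : ∀ x y, P x → P y → P (x + y)) (smul : ∀ (a : ℂ) x, P x → P (a • x)) (x : FreeFock ι) :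
    P x := by
  have h := t.eq_top_of_gen (p :=
    { carrier := {x | P x}
      add_mem' := fun hx hy => add _ _ hx hy
      zero_mem' := by have := smul 0 _ vacuum; rwa [zero_smul] at this
      smul_mem' := fun a _ hx => smul a _ hx }) vacuum gen
  exact (h ▸ Submodule.mem_top : x ∈ (_ : Submodule ℂ (FreeFock ι)))

/-- Induction over the vectors `B_{j_1} ⋯ B_{j_n} Ω`, which span the algebraic Fock space. -/
theorem TwistData.genRight_induction {ι : Type*} [DecidableEq ι] [Fintype ι] (t : TwistData ι)
    {P : FreeFock ι → Prop} (vacuum : P (tens [])) (gen : ∀ l x, P x → P (t.genRight l x))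
    (add : ∀ x y, P x → P y → P (x + y)) (smul : ∀ (a : ℂ) x, P x → P (a • x)) (x : FreeFock ι) :
    P x := by
  have h := t.eq_top_of_genRight (p :=
    { carrier := {x | P x}
      add_mem' := fun hx hy => add _ _ hx hy
      zero_mem' := by have := smul 0 _ vacuum; rwa [zero_smul] at this
      smul_mem' := fun a _ hx => smul a _ hx }) vacuum gen
  exact (h ▸ Submodule.mem_top : x ∈ (_ : Submodule ℂ (FreeFock ι)))

namespace TwistData

variable {ι : Type*} [DecidableEq ι] [Fintype ι] (t : TwistData ι)

/-- The operator `x` in the algebra of the generators with `x Ω` a given vector of the algebraic Fock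
space, acting on that space. -/
def polyEnd : FreeFock ι →ₗ[ℂ] Module.End ℂ (FreeFock ι) :=
  t.cyclicLift (fun l => LinearMap.mulLeft ℂ (t.gen l)) 1

@[simp] theorem polyEnd_vacuum : t.polyEnd (tens []) = 1 := t.cyclicLift_vacuum _ _

theorem polyEnd_gen (l : ι) (x z : FreeFock ι) :
    t.polyEnd (t.gen l x) z = t.gen l (t.polyEnd x z) := by
  rw [polyEnd, cyclicLift_gen]; rfl

theorem polyEnd_apply_vacuum (x : FreeFock ι) : t.polyEnd x (tens []) = x := by
  induction x using t.gen_induction with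
  | vacuum => simp
  | gen l x hx => rw [polyEnd_gen, hx]
  | add x y hx hy => rw [map_add, LinearMap.add_apply, hx, hy]
  | smul a x hx => rw [map_smul, LinearMap.smul_apply, hx]

end TwistData

namespace FockRep

open TwistData

variable {ι : Type*} [DecidableEq ι] [Fintype ι] {t : TwistData ι} {E : Type*}
  [NormedAddCommGroup E] [InnerProductSpace ℂ E] [CompleteSpace E] (R : FockRep t E)

/-- The operator `x` in the algebra of the generators with `x Ω` a given vector of the algebraic Fock
space. -/
def poly : FreeFock ι →ₗ[ℂ] (E →L[ℂ] E) :=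
  t.cyclicLift (fun l => LinearMap.mulLeft ℂ (R.A l)) 1

@[simp] theorem poly_vacuum : R.poly (tens []) = 1 := t.cyclicLift_vacuum _ _

theorem poly_gen (l : ι) (x : FreeFock ι) : R.poly (t.gen l x) = R.A l * R.poly x :=
  t.cyclicLift_gen _ _ _ _

theorem poly_gen_vacuum (l : ι) : R.poly (t.gen l (tens [])) = R.A l := by
  rw [poly_gen, poly_vacuum, mul_one]

variable {R} {p K : ℝ}

theorem poly_incl (hb : t.Bounds p K) (x z : FreeFock ι) :
    R.poly x (R.incl z) = R.incl (t.polyEnd x z) := by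
  induction x using t.gen_induction with
  | vacuum => simp
  | gen l x hx => rw [poly_gen, mul_apply_eq_comp, hx, polyEnd_gen, A_incl hb]
  | add x y hx hy => simp [hx, hy]
  | smul a x hx => simp [hx]

theorem poly_Ω (hb : t.Bounds p K) (x : FreeFock ι) : R.poly x R.Ω = R.incl x := by
  rw [Ω, poly_incl hb, polyEnd_apply_vacuum]

theorem poly_polyEnd (x z : FreeFock ι) : R.poly (t.polyEnd x z) = R.poly x * R.poly z := by
  induction x using t.gen_induction with
  | vacuum => simp
  | gen l x hx => rw [polyEnd_gen, poly_gen, poly_gen, hx, mul_assoc]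
  | add x y hx hy => simp [hx, hy, add_mul]
  | smul a x hx => simp [hx]

theorem injective_poly (hb : t.Bounds p K) : Function.Injective R.poly := fun x y h =>
  injective_incl (R := R) hb (by rw [← poly_Ω hb, h, poly_Ω hb])

theorem exists_poly_eq_star (hb : t.Bounds p K) (x : FreeFock ι) :
    ∃ y, R.poly y = star (R.poly x) := by
  induction x using t.gen_induction with
  | vacuum => exact ⟨tens [], by simp⟩
  | gen l x hx =>
    obtain ⟨y, hy⟩ := hx
    refine ⟨t.polyEnd y (∑ m, conj (t.c l m) • t.gen m (tens [])), ?_⟩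
    rw [poly_polyEnd, hy, poly_gen, star_mul, star_A hb]
    simp [poly_gen_vacuum]
  | add x y hx hy =>
    obtain ⟨x', hx⟩ := hx
    obtain ⟨y', hy⟩ := hy
    exact ⟨x' + y', by rw [map_add, map_add, star_add, hx, hy]⟩
  | smul a x hx =>
    obtain ⟨x', hx⟩ := hx
    exact ⟨conj a • x', by rw [map_smul, map_smul, star_smul, hx]; rfl⟩

/-- The `*`-algebra generated by the `A_l` is already spanned by the monomials in the `A_l`. -/
theorem mem_adjoin_iff (hb : t.Bounds p K) {a : E →L[ℂ] E} :
    a ∈ StarAlgebra.adjoin ℂ (Set.range R.A) ↔ ∃ x, R.poly x = a := by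
  constructor
  · intro ha
    induction ha using StarAlgebra.adjoin_induction with
    | mem a ha =>
      obtain ⟨l, rfl⟩ := ha
      exact ⟨_, R.poly_gen_vacuum l⟩
    | algebraMap r => exact ⟨r • tens [], by rw [map_smul, poly_vacuum, Algebra.algebraMap_eq_smul_one]⟩
    | add a b _ _ ha hb' =>
      obtain ⟨x, rfl⟩ := ha
      obtain ⟨y, rfl⟩ := hb'
      exact ⟨x + y, map_add _ _ _⟩
    | mul a b _ _ ha hb' =>
      obtain ⟨x, rfl⟩ := ha
      obtain ⟨y, rfl⟩ := hb'
      exact ⟨_, poly_polyEnd x y⟩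
    | star a _ ha =>
      obtain ⟨x, rfl⟩ := ha
      exact exists_poly_eq_star hb x
  · rintro ⟨x, rfl⟩
    induction x using t.gen_induction with
    | vacuum => rw [poly_vacuum]; exact one_mem _
    | gen l x hx =>
      rw [poly_gen]
      exact mul_mem (StarAlgebra.subset_adjoin ℂ _ (Set.mem_range_self l)) hx
    | add x y hx hy => rw [map_add]; exact add_mem hx hy
    | smul a x hx => rw [map_smul]; exact SMulMemClass.smul_mem _ hx

variable {F : Type*} [NormedAddCommGroup F] [InnerProductSpace ℂ F] (R) (T : TensorModel E F)

/-- The recursion for the pair of `x` and `∂_k x`, as `x` is multiplied with `A_l` from the left. -/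
def dqStep (k l : ι) : Module.End ℂ ((E →L[ℂ] E) × (F →L[ℂ] F)) :=
  (LinearMap.mulLeft ℂ (R.A l) ∘ₗ LinearMap.fst ℂ _ _).prod
    (LinearMap.mulLeft ℂ (T.op (R.A l) 1) ∘ₗ LinearMap.snd ℂ _ _
      + t.c l k • (T.right ∘ₗ LinearMap.fst ℂ _ _))

/-- The pair of `x` and `∂_k x`, as a function of `x Ω`. -/
def polyDq (k : ι) : FreeFock ι →ₗ[ℂ] (E →L[ℂ] E) × (F →L[ℂ] F) :=
  t.cyclicLift (R.dqStep T k) (1, 0)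

/-- The value `∂_k x` of the difference quotient, as a function of `x Ω`. -/
def dq (k : ι) : FreeFock ι →ₗ[ℂ] (F →L[ℂ] F) :=
  LinearMap.snd ℂ _ _ ∘ₗ R.polyDq T k

theorem polyDq_gen (k l : ι) (x : FreeFock ι) :
    R.polyDq T k (t.gen l x) = R.dqStep T k l (R.polyDq T k x) := t.cyclicLift_gen _ _ _ _

theorem polyDq_fst (k : ι) (x : FreeFock ι) : (R.polyDq T k x).1 = R.poly x := by
  induction x using t.gen_induction with
  | vacuum => simp [polyDq]
  | gen l x hx => rw [polyDq_gen, poly_gen, ← hx]; rfl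
  | add x y hx hy => rw [map_add, map_add, Prod.fst_add, hx, hy]
  | smul a x hx => rw [map_smul, map_smul, Prod.smul_fst, hx]

@[simp] theorem dq_vacuum (k : ι) : R.dq T k (tens []) = 0 := by simp [dq, polyDq]

theorem dq_gen (k l : ι) (x : FreeFock ι) :
    R.dq T k (t.gen l x) = T.op (R.A l) 1 * R.dq T k x + t.c l k • T.op 1 (R.poly x) := by
  rw [← R.polyDq_fst T k, dq, LinearMap.comp_apply, polyDq_gen]; rfl

variable {R T}

theorem dq_polyEnd (k : ι) (x z : FreeFock ι) : R.dq T k (t.polyEnd x z)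
    = T.op (R.poly x) 1 * R.dq T k z + T.op 1 (R.poly z) * R.dq T k x := by
  induction x using t.gen_induction with
  | vacuum => simp [T.op_one_one]
  | gen l x hx =>
    rw [polyEnd_gen, dq_gen, hx, dq_gen, poly_gen, poly_polyEnd, mul_add, mul_add, ← mul_assoc,
      ← mul_assoc, ← mul_assoc, T.op_mul, T.op_mul, T.op_mul, mul_smul_comm, T.op_mul]
    simp [add_assoc]
  | add x y hx hy =>
    have := map_add T.left (R.poly x) (R.poly y)
    simp only [T.left_apply] at this
    rw [map_add, LinearMap.add_apply, map_add, hx, hy, map_add, map_add, this, add_mul, mul_add]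
    abel
  | smul a x hx =>
    have := map_smul T.left a (R.poly x)
    simp only [T.left_apply] at this
    rw [map_smul, LinearMap.smul_apply, map_smul, hx, map_smul, map_smul, this, smul_add,
      smul_mul_assoc, mul_smul_comm]

theorem dq_mem (k : ι) [CompleteSpace F] {N : VonNeumannAlgebra F} (hA : ∀ l, T.op (R.A l) 1 ∈ N)
    (hP : ∀ x, T.op 1 (R.poly x) ∈ N) (x : FreeFock ι) : R.dq T k x ∈ N := by
  induction x using t.gen_induction with
  | vacuum => rw [dq_vacuum]; exact zero_mem N.toStarSubalgebra
  | gen l x hx =>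
    rw [dq_gen]
    exact add_mem (S := StarSubalgebra ℂ (F →L[ℂ] F)) (s := N.toStarSubalgebra)
      (mul_mem (hA l) hx) (N.toStarSubalgebra.smul_mem (hP x) _)
  | add x y hx hy => rw [map_add]; exact add_mem (s := N.toStarSubalgebra) hx hy
  | smul a x hx => rw [map_smul]; exact N.toStarSubalgebra.smul_mem hx _

variable (R T) in
/-- The derivations `δ` on the algebra `P` of the generators which satisfy the axioms of the difference
quotient `∂_k`. -/
structure IsDq (P : StarSubalgebra ℂ (E →L[ℂ] E)) (k : ι)
    (δ : P →ₗ[ℂ] (F →L[ℂ] F)) : Prop where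
  leibniz : ∀ x y : P, δ (x * y) = T.op (x : E →L[ℂ] E) 1 * δ y + T.op 1 (y : E →L[ℂ] E) * δ x
  gen : ∀ l, ∀ h : R.A l ∈ P, δ ⟨R.A l, h⟩ = t.c l k • 1

/-- The axioms determine the difference quotient. -/
theorem IsDq.apply_poly {P : StarSubalgebra ℂ (E →L[ℂ] E)} {k : ι}
    {δ : P →ₗ[ℂ] (F →L[ℂ] F)} (h : R.IsDq T P k δ) (hP : ∀ x, R.poly x ∈ P)
    (x : FreeFock ι) : δ ⟨R.poly x, hP x⟩ = R.dq T k x := by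
  induction x using t.gen_induction with
  | vacuum =>
    have h1 := h.leibniz 1 1
    rw [mul_one] at h1
    have e : (⟨R.poly (tens []), hP _⟩ : P) = 1 := Subtype.ext R.poly_vacuum
    rw [e, dq_vacuum]
    simpa [T.op_one_one] using h1
  | gen l x hx =>
    have hl : R.A l ∈ P := R.poly_gen_vacuum l ▸ hP _
    have e : (⟨R.poly (t.gen l x), hP _⟩ : P) = ⟨R.A l, hl⟩ * ⟨R.poly x, hP x⟩ :=
      Subtype.ext (R.poly_gen l x)
    rw [e, h.leibniz, hx, h.gen, dq_gen, mul_smul_comm, mul_one]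
  | add x y hx hy =>
    have e : (⟨R.poly (x + y), hP _⟩ : P) = ⟨R.poly x, hP x⟩ + ⟨R.poly y, hP y⟩ :=
      Subtype.ext (map_add _ _ _)
    rw [e, map_add, hx, hy, map_add]
  | smul a x hx =>
    have e : (⟨R.poly (a • x), hP _⟩ : P) = a • ⟨R.poly x, hP x⟩ := Subtype.ext (map_smul _ _ _)
    rw [e, map_smul, hx, map_smul]

/-- As `x ↦ x Ω` is injective on the algebra of the generators, `∂_k` may be defined by its values on
the algebraic Fock space. -/
theorem exists_isDq (hb : t.Bounds p K) {P : StarSubalgebra ℂ (E →L[ℂ] E)}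
    (hP : P = StarAlgebra.adjoin ℂ (Set.range R.A)) (k : ι) :
    ∃ δ : P →ₗ[ℂ] (F →L[ℂ] F), R.IsDq T P k δ ∧
      ∀ x : P, ∃ y, R.poly y = (x : E →L[ℂ] E) ∧ δ x = R.dq T k y := by
  have hmem : ∀ x, R.poly x ∈ P.toSubalgebra.toSubmodule := fun x => by
    change R.poly x ∈ P
    rw [hP]
    exact (mem_adjoin_iff hb).2 ⟨x, rfl⟩
  let φ : FreeFock ι →ₗ[ℂ] P := R.poly.codRestrict P.toSubalgebra.toSubmodule hmem
  have hφ : ∀ x, (φ x : E →L[ℂ] E) = R.poly x := fun x => rfl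
  have hbij : Function.Bijective φ := by
    refine ⟨fun x y h => injective_poly (R := R) hb ?_, fun a => ?_⟩
    · rw [← hφ, h]; rfl
    · obtain ⟨x, hx⟩ := (mem_adjoin_iff hb).1 ((SetLike.ext_iff.1 hP _).1 a.2)
      exact ⟨x, Subtype.ext hx⟩
  let ψ := LinearEquiv.ofBijective φ hbij
  have hψ : ∀ x, ψ.symm (φ x) = x := fun x => ψ.symm_apply_apply x
  refine ⟨R.dq T k ∘ₗ ψ.symm.toLinearMap, ⟨fun a b => ?_, fun l h => ?_⟩, fun a => ?_⟩
  · obtain ⟨x, rfl⟩ := hbij.2 a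
    obtain ⟨y, rfl⟩ := hbij.2 b
    have e : φ x * φ y = φ (t.polyEnd x y) := Subtype.ext (poly_polyEnd x y).symm
    simp only [LinearMap.comp_apply, LinearEquiv.coe_coe]
    rw [e, hψ, hψ, hψ, dq_polyEnd, hφ, hφ]
  · have e : (⟨R.A l, h⟩ : P) = φ (t.gen l (tens [])) := Subtype.ext (R.poly_gen_vacuum l).symm
    simp only [LinearMap.comp_apply, LinearEquiv.coe_coe]
    rw [e, hψ, dq_gen, dq_vacuum, poly_vacuum, T.op_one_one, mul_zero, zero_add]
  · obtain ⟨x, rfl⟩ := hbij.2 a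
    exact ⟨x, rfl, by simp only [LinearMap.comp_apply, LinearEquiv.coe_coe]; rw [hψ]⟩

/-- The difference quotient `∂_k x` is the commutator of the dual operator `D_k` with `x`: both are
derivations in `x` with the same values at the generators. -/
theorem inner_dq (hb : t.Bounds p K) (k : ι) (u : E) (v x : FreeFock ι) :
    inner ℂ (T.ketBra u (R.incl v)) (R.dq T k x (T.ketBra R.Ω R.Ω))
      = inner ℂ u (R.incl (t.dualOp k (t.polyEnd x v) - t.polyEnd x (t.dualOp k v))) := by
  induction x using t.gen_induction generalizing u with
  | vacuum => simp [inner_zero_right]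
  | gen l x hx =>
    rw [dq_gen, add_apply, inner_add_right, mul_apply_eq_comp, smul_apply,
      inner_smul_right, T.inner_op, T.inner_op, one_apply_eq_self, hx,
      ContinuousLinearMap.adjoint_inner_left, A_incl hb, poly_incl hb, T.inner_ketBra, inner_Ω_incl,
      polyEnd_gen, polyEnd_gen, dualOp_gen,
      ← ContinuousLinearMap.star_eq_adjoint, star_one, one_apply_eq_self]
    simp only [map_sub, map_add, map_smul, inner_sub_right, inner_add_right, inner_smul_right, Ω]
    ring
  | add x y hx hy =>
    rw [map_add, add_apply, inner_add_right, hx, hy]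
    simp only [map_sub, map_add, LinearMap.add_apply, inner_sub_right, inner_add_right]
    ring
  | smul a x hx =>
    rw [map_smul, smul_apply, inner_smul_right, hx]
    simp only [map_sub, map_smul, LinearMap.smul_apply, inner_sub_right, inner_smul_right]
    ring

theorem inner_vacuum_dq (hb : t.Bounds p K) (k : ι) (x : FreeFock ι) :
    inner ℂ (T.ketBra R.Ω R.Ω) (R.dq T k x (T.ketBra R.Ω R.Ω)) = coeff [] (t.dualOp k x) := by
  have h := inner_dq (R := R) (T := T) hb k R.Ω (tens []) x
  rw [dualOp_vacuum, map_zero, sub_zero, polyEnd_apply_vacuum, inner_Ω_incl] at h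
  exact h

end FockRep
/-! ### Conjugate variables -/

open Filter Topology

/-- A sum over words, as a sum over their lengths. -/
theorem summable_length {ι : Type*} [Fintype ι] {G : ℕ → ℝ} (h0 : ∀ n, 0 ≤ G n)
    (h : Summable fun n => (Fintype.card ι : ℝ) ^ n * G n) : Summable fun w : List ι => G w.length := by
  rw [← List.equivSigmaTuple.symm.summable_iff]
  refine (summable_sigma_of_nonneg fun _ => h0 _).2 ⟨fun n => (hasSum_fintype _).summable, h.congr fun n => ?_⟩
  simp [List.equivSigmaTuple, tsum_fintype]

/-- Super-exponential decay. -/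
theorem summable_pow_of_cube (p M : ℝ) (hp : 0 < p) (hp1 : p < 1) :
    Summable fun n : ℕ => (M * ((n : ℝ) ^ 3 * p ^ n)) ^ n := by
  have h : Tendsto (fun n : ℕ => M * ((n : ℝ) ^ 3 * p ^ n)) atTop (𝓝 0) := by
    have := (tendsto_pow_const_mul_const_pow_of_abs_lt_one 3
      (by rwa [abs_of_pos hp] : |p| < 1)).const_mul M
    rwa [mul_zero] at this
  refine Summable.of_norm_bounded_eventually_nat (g := fun n : ℕ => (1 / 2 : ℝ) ^ n)
    summable_geometric_two ?_
  filter_upwards [(tendsto_zero_iff_norm_tendsto_zero.1 h).eventually_le_const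
    (by norm_num : (0 : ℝ) < 1 / 2)] with n hn
  rw [norm_pow]
  exact pow_le_pow_left₀ (norm_nonneg _) hn n

namespace TwistData

variable {ι : Type*} [DecidableEq ι] [Fintype ι] {t : TwistData ι} {p K : ℝ}

theorem Bounds.mono (hb : t.Bounds p K) {K' : ℝ} (h : K ≤ K') : t.Bounds p K' :=
  { hb with
    one_le := hb.one_le.trans h
    c_le := fun k l => (hb.c_le k l).trans h }

/-- The series for the conjugate variable converges, in any normed space in which the generators act as
bounded operators: its coefficients decay like `p ^ (n ^ 2)`, while the number of words and the norms
of the vectors of the dual basis grow exponentially and the norms of the simple tensors grow at most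
like `n ^ n`. -/
theorem Bounds.summable_dualOp (hb : t.Bounds p K) {C : ℝ} (hC : 1 ≤ C) {u : List ι → FreeFock ι}
    (hud : ∀ w, u w ∈ degree w.length) (hul : ∀ w, l1 (u w) ≤ C ^ w.length)
    {Z : Type*} [NormedAddCommGroup Z] [NormedSpace ℂ Z] [CompleteSpace Z]
    (g : FreeFock ι →ₗ[ℂ] Z) {b : ℝ} (hb0 : 0 ≤ b)
    (hg : ∀ w, ‖g (tens w)‖ ≤ (2 * K * w.length) ^ w.length * b) (k : ι) :
    Summable fun w : List ι => conj (coeff [] (t.dualOp k (tens w))) • g (u w) := by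
  have hp := hb.pos
  have hK : 0 ≤ K := zero_le_one.trans hb.one_le
  let G : ℕ → ℝ := fun n =>
    p⁻¹ * (p ^ n * (K * n) ^ 2) ^ n * ((2 * K * n) ^ n * b * C ^ n)
  have hG : Summable fun w : List ι => G w.length := by
    refine summable_length (fun n => by positivity) ?_
    refine ((summable_pow_of_cube p (Fintype.card ι * K ^ 2 * (2 * K) * C) hp hb.lt_one).mul_left
      (p⁻¹ * b)).congr fun n => ?_
    simp only [G, mul_pow]
    ring
  refine Summable.of_norm_bounded hG fun w => ?_
  rw [norm_smul, RCLike.norm_conj]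
  have h1 : ‖coeff [] (t.dualOp k (tens w))‖ ≤ p⁻¹ * (p ^ w.length * (K * w.length) ^ 2) ^ w.length := by
    rw [← div_eq_inv_mul, le_div_iff₀ hp, mul_comm]
    exact hb.coeff_dualOp_le k w
  have h2 : ‖g (u w)‖ ≤ (2 * K * w.length) ^ w.length * b * C ^ w.length := by
    have h3 := seminorm_le_mul_l1 (normSeminorm ℂ Z) g (x := u w) (C :=
      (2 * K * w.length) ^ w.length * b) fun v hv => by
        rw [← length_of_mem_degree (hud w) hv]
        exact hg v
    exact h3.trans (mul_le_mul_of_nonneg_left (hul w) (by positivity))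
  exact mul_le_mul h1 h2 (norm_nonneg _) (by positivity)

end TwistData

namespace FockRep

open TwistData

variable {ι : Type*} [DecidableEq ι] [Fintype ι] {t : TwistData ι} {E : Type*}
  [NormedAddCommGroup E] [InnerProductSpace ℂ E] [CompleteSpace E] {R : FockRep t E}
  {F : Type*} [NormedAddCommGroup F] [InnerProductSpace ℂ F] (T : TensorModel E F)
  {p K : ℝ}

theorem norm_dqStep_le (hb : t.Bounds p K) (k l : ι)
    (z : (E →L[ℂ] E) × (F →L[ℂ] F)) :
    ‖R.dqStep T k l z‖ ≤ (K + ∑ l, ‖R.A l‖) * ‖z‖ := by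
  have hA : ‖R.A l‖ ≤ ∑ l, ‖R.A l‖ :=
    Finset.single_le_sum (fun m _ => norm_nonneg (R.A m)) (Finset.mem_univ l)
  have h1 := norm_fst_le z
  have h2 := norm_snd_le z
  have hK : 0 ≤ K := zero_le_one.trans hb.one_le
  have hone : ‖(1 : E →L[ℂ] E)‖ ≤ 1 := ContinuousLinearMap.norm_id_le
  refine max_le ?_ ?_
  · change ‖R.A l * z.1‖ ≤ _
    refine (norm_mul_le _ _).trans ?_
    gcongr
    linarith
  · change ‖T.op (R.A l) 1 * z.2 + t.c l k • T.op 1 z.1‖ ≤ _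
    have h3 : ‖T.op (R.A l) 1‖ ≤ ∑ l, ‖R.A l‖ :=
      (T.norm_op_le _ _).trans ((mul_le_of_le_one_right (norm_nonneg _) hone).trans hA)
    have h4 : ‖T.op 1 z.1‖ ≤ ‖z‖ :=
      (T.norm_op_le _ _).trans ((mul_le_of_le_one_left (norm_nonneg _) hone).trans h1)
    have h5 := hb.c_le l k
    calc ‖T.op (R.A l) 1 * z.2 + t.c l k • T.op 1 z.1‖
        ≤ ‖T.op (R.A l) 1‖ * ‖z.2‖ + ‖t.c l k‖ * ‖T.op 1 z.1‖ := by
          refine (norm_add_le _ _).trans ?_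
          rw [norm_smul]
          gcongr
          exact norm_mul_le _ _
      _ ≤ (∑ l, ‖R.A l‖) * ‖z‖ + K * ‖z‖ := by gcongr
      _ = _ := by ring

/-- The conjugate variable `ξ_k`, as a limit of vectors of the algebraic Fock space along which the
difference quotients converge in norm. -/
theorem exists_conjugate [CompleteSpace F] (hb : t.Bounds p K) (k : ι) :
    ∃ (y : Finset (List ι) → FreeFock ι) (ξ : E), Tendsto (fun s => R.incl (y s)) atTop (𝓝 ξ) ∧
      (∀ x, inner ℂ ξ (R.incl x) = coeff [] (t.dualOp k x)) ∧
      ∀ j, ∃ X : F →L[ℂ] F, Tendsto (fun s => R.dq T j (y s)) atTop (𝓝 X) := by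
  obtain ⟨C, u, hC, hu0, hud, hul, hu⟩ :=
    t.exists_dualBasis (pow_nonneg hb.pos.le 8) (pow_eight_lt_one hb) hb.Q_le
  -- The partial sums of the expansion, in the dual basis, of the vector with the inner products
  -- `⟨Ω, D_k e_w⟩` with the simple tensors. The operators, not only the vectors, converge.
  let y : Finset (List ι) → FreeFock ι := fun s =>
    ∑ w ∈ s, conj (coeff [] (t.dualOp k (tens w))) • u w
  have hb' : t.Bounds p (K + ∑ l, ‖R.A l‖) :=
    hb.mono (le_add_of_nonneg_right (Finset.sum_nonneg fun _ _ => norm_nonneg _))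
  have hconv : ∀ j, ∃ z, Tendsto (fun s => R.polyDq T j (y s)) atTop (𝓝 z) := fun j => by
    have h := hb'.summable_dualOp hC hud hul (R.polyDq T j) (norm_nonneg (R.polyDq T j (tens [])))
      (fun w => hb'.seminorm_tens_le (normSeminorm ℂ _) (R.polyDq T j) (R.dqStep T j)
        (fun l z => norm_dqStep_le T hb j l z) (fun l x => R.polyDq_gen T j l x) w) k
    obtain ⟨z, hz⟩ := h
    refine ⟨z, Tendsto.congr (fun s => ?_) hz⟩
    simp only [y, map_sum, map_smul]
  obtain ⟨z, hz⟩ := hconv k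
  have hξ : Tendsto (fun s => R.incl (y s)) atTop (𝓝 (z.1 R.Ω)) := by
    have h1 : Continuous fun z : (E →L[ℂ] E) × (F →L[ℂ] F) => z.1 R.Ω := by fun_prop
    refine ((h1.tendsto z).comp hz).congr fun s => ?_
    simp only [Function.comp_apply]
    rw [polyDq_fst, poly_Ω hb]
  refine ⟨y, _, hξ, fun x => ?_, fun j => ?_⟩
  · have h1 : Tendsto (fun s => inner ℂ (R.incl (y s)) (R.incl x)) atTop
        (𝓝 (inner ℂ (z.1 R.Ω) (R.incl x))) := hξ.inner tendsto_const_nhds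
    refine tendsto_nhds_unique h1 (tendsto_const_nhds.congr' ?_)
    filter_upwards [eventually_ge_atTop x.support] with s hs
    have h2 := apply_eq_sum_support (coeff [] ∘ₗ t.dualOp k) x
    simp only [LinearMap.comp_apply] at h2
    rw [h2]
    simp only [y, map_sum, map_smul, sum_inner, inner_smul_left, Complex.conj_conj,
      inner_dualBasis (R := R) hu0 hud hu]
    refine Finset.sum_subset_zero_on_sdiff hs (fun w hw => ?_) fun w _ => by rw [smul_eq_mul, mul_comm]
    rw [Finset.mem_sdiff, mem_support_iff, not_not] at hw
    rw [hw.2, mul_zero]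
  · obtain ⟨z, hz⟩ := hconv j
    exact ⟨z.2, (continuous_snd.tendsto z).comp hz⟩

/-- A vector is determined by its inner products with the algebraic Fock space. -/
theorem eq_of_inner_incl {v w : E} (h : ∀ x, inner ℂ v (R.incl x) = inner ℂ w (R.incl x)) : v = w :=
  sub_eq_zero.1 (eq_zero_of_inner_incl (R := R) fun x => by
    rw [← inner_conj_symm, inner_sub_left, h, sub_self, map_zero])

/-! ### Closability of the difference quotients -/

variable {T}

/-- The algebraic Fock space is in the domain of the adjoint of the dual operator `D_k`. -/
theorem exists_inner_dualOp (hb : t.Bounds p K) {k : ι} {ξ : E}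
    (hξ : ∀ x, inner ℂ ξ (R.incl x) = coeff [] (t.dualOp k x)) (u : FreeFock ι) :
    ∃ η, ∀ x, inner ℂ (R.incl u) (R.incl (t.dualOp k x)) = inner ℂ η (R.incl x) := by
  induction u using t.gen_induction with
  | vacuum => exact ⟨ξ, fun x => by rw [hξ, ← R.inner_Ω_incl, Ω]⟩
  | gen l u hu =>
    obtain ⟨η, hη⟩ := hu
    refine ⟨∑ m, t.c l m • (ContinuousLinearMap.adjoint (R.A m) η
      - (conj (t.c m k) * inner ℂ R.Ω (R.incl u)) • R.Ω), fun x => ?_⟩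
    rw [inner_gen, sum_inner]
    refine Finset.sum_congr rfl fun m _ => ?_
    have h1 : t.gen m (t.dualOp k x)
        = t.dualOp k (t.gen m x) - (t.c m k * coeff [] x) • tens [] := by
      rw [dualOp_gen, add_sub_cancel_right]
    have h2 : R.incl (tens []) = R.Ω := rfl
    rw [h1, map_sub, inner_sub_right, hη, map_smul, inner_smul_right, inner_smul_left,
      inner_sub_left, ContinuousLinearMap.adjoint_inner_left, A_incl hb, inner_smul_left,
      R.inner_Ω_incl x, map_mul, Complex.conj_conj, inner_conj_symm, h2]
    ring
  | add u v hu hv =>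
    obtain ⟨η, hη⟩ := hu
    obtain ⟨θ, hθ⟩ := hv
    exact ⟨η + θ, fun x => by rw [map_add, inner_add_left, inner_add_left, hη, hθ]⟩
  | smul a u hu =>
    obtain ⟨η, hη⟩ := hu
    exact ⟨a • η, fun x => by rw [map_smul, inner_smul_left, inner_smul_left, hη]⟩

/-- The vacuum is cyclic for the commutant of the generators. -/
theorem exists_commutant (hb : t.Bounds p K) (v : FreeFock ι) :
    ∃ Z : E →L[ℂ] E, (∀ l, R.A l * Z = Z * R.A l) ∧ Z R.Ω = R.incl v := by
  induction v using t.genRight_induction with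
  | vacuum => exact ⟨1, fun l => by rw [mul_one, one_mul], rfl⟩
  | gen j v hv =>
    obtain ⟨Z, hZ, hv⟩ := hv
    refine ⟨R.B j * Z, fun l => ?_, ?_⟩
    · rw [← mul_assoc, A_mul_B hb, mul_assoc, hZ, mul_assoc]
    · rw [mul_apply_eq_comp, hv, B_incl hb]
  | add u v hu hv =>
    obtain ⟨Z, hZ, hu⟩ := hu
    obtain ⟨Y, hY, hv⟩ := hv
    exact ⟨Z + Y, fun l => by rw [mul_add, add_mul, hZ, hY], by rw [add_apply, hu, hv, map_add]⟩
  | smul a v hv =>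
    obtain ⟨Z, hZ, hv⟩ := hv
    exact ⟨a • Z, fun l => by rw [mul_smul_comm, smul_mul_assoc, hZ],
      by rw [smul_apply, hv, map_smul]⟩

theorem poly_commutant {Z : E →L[ℂ] E} (hZ : ∀ l, R.A l * Z = Z * R.A l) (x : FreeFock ι) :
    R.poly x * Z = Z * R.poly x := by
  induction x using t.gen_induction with
  | vacuum => simp
  | gen l x hx => rw [poly_gen, mul_assoc, hx, ← mul_assoc, hZ, mul_assoc]
  | add x y hx hy => rw [map_add, add_mul, mul_add, hx, hy]
  | smul a x hx => rw [map_smul, mul_smul_comm, smul_mul_assoc, hx]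

/-- The vectors `u ⊗ ⟨v, ·⟩`, with `u` and `v` in the algebraic Fock space, are in the domain of the
adjoint of the difference quotient. -/
theorem exists_inner_dq (hb : t.Bounds p K) {k : ι} {ξ : E}
    (hξ : ∀ x, inner ℂ ξ (R.incl x) = coeff [] (t.dualOp k x)) (u v : FreeFock ι) :
    ∃ θ, ∀ x, inner ℂ (T.ketBra (R.incl u) (R.incl v)) (R.dq T k x (T.ketBra R.Ω R.Ω))
      = inner ℂ θ (R.incl x) := by
  obtain ⟨η, hη⟩ := exists_inner_dualOp hb hξ u
  -- With `v = Z Ω`, where `Z` commutes with the generators, `x v = Z x Ω` is continuous in `x Ω`.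
  have hv : ∀ v, ∃ Z : E →L[ℂ] E, ∀ x, R.incl (t.polyEnd x v) = Z (R.incl x) := fun v => by
    obtain ⟨Z, hZ, hv⟩ := exists_commutant (R := R) hb v
    refine ⟨Z, fun x => ?_⟩
    rw [← poly_incl hb, ← hv, ← poly_Ω hb, ← mul_apply_eq_comp, ← mul_apply_eq_comp,
      poly_commutant hZ]
  obtain ⟨Z, hZ⟩ := hv v
  obtain ⟨Y, hY⟩ := hv (t.dualOp k v)
  refine ⟨ContinuousLinearMap.adjoint Z η - ContinuousLinearMap.adjoint Y (R.incl u), fun x => ?_⟩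
  rw [inner_dq hb, map_sub, inner_sub_right, hη, hZ, hY, inner_sub_left,
    ContinuousLinearMap.adjoint_inner_left, ContinuousLinearMap.adjoint_inner_left]

theorem eq_zero_of_inner_ketBra_incl {b : F}
    (h : ∀ u v, inner ℂ (T.ketBra (R.incl u) (R.incl v)) b = 0) : b = 0 := by
  have h1 : ∀ x v, inner ℂ (T.ketBra x (R.incl v)) b = 0 := fun x v =>
    R.dense.induction_on (p := fun x => inner ℂ (T.ketBra x (R.incl v)) b = 0) x
      (isClosed_eq ((T.continuous_ketBra_left _).inner continuous_const) continuous_const)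
      fun u => h u v
  exact T.total b fun x y =>
    R.dense.induction_on (p := fun y => inner ℂ (T.ketBra x y) b = 0) y
      (isClosed_eq ((T.continuous_ketBra_right _).inner continuous_const) continuous_const)
      fun v => h1 x v

/-- The adjoint of the difference quotient is densely defined, so it is closable. -/
theorem isClosable (hb : t.Bounds p K) {k : ι} {ξ : E}
    (hξ : ∀ x, inner ℂ ξ (R.incl x) = coeff [] (t.dualOp k x)) {L : E →ₗ.[ℂ] F}
    (hL : ∀ z ∈ L.graph, ∃ x, z = (R.incl x, R.dq T k x (T.ketBra R.Ω R.Ω))) : L.IsClosable := by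
  refine ⟨L.graph.topologicalClosure.toLinearPMap, (Submodule.toLinearPMap_graph_eq _ ?_).symm⟩
  rintro ⟨a, b⟩ hab (rfl : a = 0)
  refine eq_zero_of_inner_ketBra_incl (R := R) (T := T) fun u v => ?_
  obtain ⟨θ, hθ⟩ := exists_inner_dq (T := T) hb hξ u v
  have h : ∀ z ∈ closure (L.graph : Set (E × F)),
      inner ℂ (T.ketBra (R.incl u) (R.incl v)) z.2 = inner ℂ θ z.1 := fun z hz => by
    refine closure_minimal (t := {z | inner ℂ (T.ketBra (R.incl u) (R.incl v)) z.2 = inner ℂ θ z.1})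
      (fun z hz => ?_) (isClosed_eq (by fun_prop) (by fun_prop)) hz
    obtain ⟨x, rfl⟩ := hL z hz
    exact hθ x
  have := h (0, b) hab
  rwa [inner_zero_right] at this

/-- The graph of the difference quotient, as an unbounded operator on the algebra of the generators. -/
theorem mem_graph_iff_exists (hb : t.Bounds p K) {P : StarSubalgebra ℂ (E →L[ℂ] E)}
    (hP : ∀ x, R.poly x ∈ P) (hP' : ∀ a : P, ∃ x, a = ⟨R.poly x, hP x⟩)
    {δ : P →ₗ[ℂ] (F →L[ℂ] F)} {k : ι} (hδ : ∀ x, δ ⟨R.poly x, hP x⟩ = R.dq T k x) (z : E × F) :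
    z ∈ (LinearMap.range (LinearMap.prod
      ((ContinuousLinearMap.apply ℂ E R.Ω).toLinearMap ∘ₗ P.toSubalgebra.toSubmodule.subtype)
      ((ContinuousLinearMap.apply ℂ F (T.ketBra R.Ω R.Ω)).toLinearMap ∘ₗ δ))).toLinearPMap.graph ↔
      ∃ x, z = (R.incl x, R.dq T k x (T.ketBra R.Ω R.Ω)) := by
  set S := LinearMap.prod
      ((ContinuousLinearMap.apply ℂ E R.Ω).toLinearMap ∘ₗ P.toSubalgebra.toSubmodule.subtype)
      ((ContinuousLinearMap.apply ℂ F (T.ketBra R.Ω R.Ω)).toLinearMap ∘ₗ δ) with hS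
  have hval : ∀ x, S ⟨R.poly x, hP x⟩ = (R.incl x, R.dq T k x (T.ketBra R.Ω R.Ω)) := fun x => by
    rw [← poly_Ω hb, ← hδ]
    rfl
  have hmem : ∀ z, z ∈ LinearMap.range S ↔
      ∃ x, z = (R.incl x, R.dq T k x (T.ketBra R.Ω R.Ω)) := fun z => by
    constructor
    · rintro ⟨a, rfl⟩
      obtain ⟨x, rfl⟩ := hP' a
      exact ⟨x, hval x⟩
    · rintro ⟨x, rfl⟩
      exact ⟨_, hval x⟩
  -- The range of `S` is a graph because the vacuum is separating; otherwise `toLinearPMap` would not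
  -- have it as its graph.
  rw [← hmem, Submodule.toLinearPMap_graph_eq]
  intro z hz h0
  obtain ⟨x, rfl⟩ := (hmem z).1 hz
  have hx : x = 0 := injective_incl (R := R) hb (by rw [map_zero]; exact h0)
  subst hx
  simp

/-- The conjugate variables are in the domain of the closures of the difference quotients, with bounded
values. -/
theorem exists_closure_apply [CompleteSpace F] (hb : t.Bounds p K) {k : ι} {ξ : E}
    (hξ : ∀ x, inner ℂ ξ (R.incl x) = coeff [] (t.dualOp k x)) {j : ι} {L : E →ₗ.[ℂ] F}
    (hL : L.IsClosable)
    (hL' : ∀ x, (R.incl x, R.dq T j x (T.ketBra R.Ω R.Ω)) ∈ L.graph)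
    {N : Set (F →L[ℂ] F)} (hN : IsClosed N) (hdq : ∀ x, R.dq T j x ∈ N) :
    ∃ h : ξ ∈ L.closure.domain, ∃ X ∈ N, X (T.ketBra R.Ω R.Ω) = L.closure ⟨ξ, h⟩ := by
  obtain ⟨y, ξ', hy, hξ', hX⟩ := exists_conjugate (R := R) T hb k
  obtain rfl : ξ = ξ' := eq_of_inner_incl (R := R) fun x => by rw [hξ, hξ']
  obtain ⟨X, hX⟩ := hX j
  have h1 : (ξ, X (T.ketBra R.Ω R.Ω)) ∈ L.closure.graph := by
    rw [← hL.graph_closure_eq_closure_graph]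
    refine mem_closure_of_tendsto (hy.prodMk_nhds
      (((ContinuousLinearMap.apply ℂ F (T.ketBra R.Ω R.Ω)).continuous.tendsto X).comp hX))
      (Eventually.of_forall fun s => hL' (y s))
  obtain ⟨⟨a, h⟩, rfl, hX'⟩ := (LinearPMap.mem_graph_iff _).1 h1
  exact ⟨h, X, hN.mem_of_tendsto hX (Eventually.of_forall fun s => hdq _), hX'.symm⟩

/-! ### Dual systems -/

variable (R) in
/-- The dual operator `D_k` as an unbounded operator, with domain the algebraic Fock space. -/
def dualPMap (hb : t.Bounds p K) (k : ι) : E →ₗ.[ℂ] E where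
  domain := LinearMap.range R.incl
  toFun := R.incl ∘ₗ t.dualOp k ∘ₗ
    (LinearEquiv.ofInjective R.incl (injective_incl hb)).symm.toLinearMap

theorem dualPMap_apply (hb : t.Bounds p K) (k : ι) (x : FreeFock ι)
    (h : R.incl x ∈ (R.dualPMap hb k).domain) :
    R.dualPMap hb k ⟨R.incl x, h⟩ = R.incl (t.dualOp k x) := by
  change R.incl (t.dualOp k
    ((LinearEquiv.ofInjective R.incl (injective_incl hb)).symm ⟨R.incl x, _⟩)) = _
  congr 2
  rw [LinearEquiv.symm_apply_eq]
  rfl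

theorem vacuum_mem_adjoint_dualPMap [CompleteSpace F] (T : TensorModel E F) (hb : t.Bounds p K) (k : ι) :
    R.Ω ∈ (R.dualPMap hb k).adjoint.domain := by
  obtain ⟨-, ξ, -, hξ, -⟩ := exists_conjugate (R := R) T hb k
  refine LinearPMap.mem_adjoint_domain_of_exists _ ⟨ξ, ?_⟩
  rintro ⟨_, x, rfl⟩
  refine (hξ x).trans ?_
  rw [← inner_Ω_incl (R := R)]
  exact congrArg (inner ℂ R.Ω) (dualPMap_apply hb k x ⟨x, rfl⟩).symm

/-- The commutation relations determine a dual operator on the algebraic Fock space. -/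
theorem dual_apply_incl (hb : t.Bounds p K) {k : ι} {Δ : E →ₗ.[ℂ] E}
    (hdom : ∀ x, R.incl x ∈ Δ.domain)
    (hcomm : ∀ l x, ∃ h : R.A l (R.incl x) ∈ Δ.domain,
      Δ ⟨R.A l (R.incl x), h⟩ - R.A l (Δ ⟨R.incl x, hdom x⟩)
        = t.c l k • (inner ℂ R.Ω (R.incl x) • R.Ω))
    (h0 : Δ ⟨R.Ω, hdom _⟩ = 0) (x : FreeFock ι) :
    Δ ⟨R.incl x, hdom x⟩ = R.incl (t.dualOp k x) := by
  induction x using t.gen_induction with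
  | vacuum => rw [dualOp_vacuum, map_zero]; exact h0
  | gen l x hx =>
    obtain ⟨h, h1⟩ := hcomm l x
    have e : (⟨R.incl (t.gen l x), hdom _⟩ : Δ.domain) = ⟨R.A l (R.incl x), h⟩ :=
      Subtype.ext (A_incl hb l x).symm
    rw [hx, sub_eq_iff_eq_add] at h1
    rw [e, h1, dualOp_gen, A_incl hb, map_add, map_smul, inner_Ω_incl, smul_smul, add_comm]
    rfl
  | add x y hx hy =>
    have e : (⟨R.incl (x + y), hdom _⟩ : Δ.domain)
        = ⟨R.incl x, hdom x⟩ + ⟨R.incl y, hdom y⟩ := Subtype.ext (map_add _ _ _)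
    rw [e, Δ.map_add, hx, hy, map_add, map_add]
  | smul a x hx =>
    have e : (⟨R.incl (a • x), hdom _⟩ : Δ.domain) = a • ⟨R.incl x, hdom x⟩ :=
      Subtype.ext (map_smul _ _ _)
    rw [e, Δ.map_smul, hx, map_smul, map_smul]

/-- The inner products of the conjugate variable of a dual operator with the algebraic Fock space. -/
theorem inner_adjoint_vacuum {k : ι} {Δ : E →ₗ.[ℂ] E}
    (hdom : ∀ x, R.incl x ∈ Δ.domain)
    (hΔ : ∀ x, Δ ⟨R.incl x, hdom x⟩ = R.incl (t.dualOp k x))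
    (hΩ : R.Ω ∈ Δ.adjoint.domain) (x : FreeFock ι) :
    inner ℂ (Δ.adjoint ⟨R.Ω, hΩ⟩) (R.incl x) = coeff [] (t.dualOp k x) := by
  have hd : Dense (Δ.domain : Set E) := R.dense.mono (by rintro _ ⟨x, rfl⟩; exact hdom x)
  have h := Δ.adjoint_isFormalAdjoint hd ⟨R.Ω, hΩ⟩ ⟨R.incl x, hdom x⟩
  rw [hΔ, inner_Ω_incl] at h
  exact h

end FockRep
/-! ### The covariance of an adapted basis -/

/-- The complex conjugation `re + i im ↦ re - i im`. -/
def Cplx.conjugate {H : Type*} [NormedAddCommGroup H] (x : Cplx H) : Cplx H := ⟨x.re, -x.im⟩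

namespace Cplx

variable {H : Type*} [NormedAddCommGroup H] [InnerProductSpace ℝ H]

@[simp] theorem conjugate_conjugate (x : Cplx H) : x.conjugate.conjugate = x := by
  ext <;> simp [conjugate]

@[simp] theorem conjugate_ofReal (x : H) : (ofReal x).conjugate = ofReal x := by
  ext <;> simp [conjugate, ofReal]

theorem conjugate_add (x y : Cplx H) : (x + y).conjugate = x.conjugate + y.conjugate := by
  ext <;> simp [conjugate, add_comm]

theorem conjugate_smul (a : ℂ) (x : Cplx H) : (a • x).conjugate = conj a • x.conjugate := by
  ext <;> simp [conjugate]; abel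

theorem conjugate_sum {κ : Type*} (s : Finset κ) (f : κ → Cplx H) :
    (∑ k ∈ s, f k).conjugate = ∑ k ∈ s, (f k).conjugate :=
  map_sum (AddMonoidHom.mk' conjugate conjugate_add) f s

theorem eq_ofReal_add (x : Cplx H) : x = ofReal x.re + Complex.I • ofReal x.im := by
  ext <;> simp [ofReal]

end Cplx

namespace OrthogonalFlow

variable {H : Type*} [NormedAddCommGroup H] [InnerProductSpace ℝ H] (U : OrthogonalFlow H)

theorem twistedInner_sum_right {κ : Type*} (s : Finset κ) (x : Cplx H) (a : κ → ℂ)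
    (y : κ → Cplx H) :
    U.twistedInner x (∑ k ∈ s, a k • y k) = ∑ k ∈ s, a k * U.twistedInner x (y k) := by
  simp only [twistedInner, map_sum, map_smul, Finset.smul_sum, inner_sum]
  refine Finset.sum_congr rfl fun k _ => ?_
  rw [smul_comm, inner_smul_right]

theorem twistedInner_sum_left {κ : Type*} (s : Finset κ) (a : κ → ℂ) (x : κ → Cplx H)
    (y : Cplx H) :
    U.twistedInner (∑ k ∈ s, a k • x k) y = ∑ k ∈ s, conj (a k) * U.twistedInner (x k) y := by
  simp only [twistedInner, sum_inner, inner_smul_left]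

end OrthogonalFlow

namespace AdaptedBasis

variable {H : Type*} [NormedAddCommGroup H] [InnerProductSpace ℝ H] {N : Type*}
  {D : MixedData H N} {d : ℕ} (e : AdaptedBasis D d)

theorem sum_twistedInner_smul (x : Cplx H) :
    ∑ k, D.flow.twistedInner (e.vec k) x • e.vec k = x := by
  obtain ⟨a, rfl⟩ := (Submodule.mem_span_range_iff_exists_fun ℂ).1
    (e.span_eq_top ▸ Submodule.mem_top : x ∈ Submodule.span ℂ (Set.range e.vec))
  simp [OrthogonalFlow.twistedInner_sum_right, e.orthonormal]

theorem twistedInner_eq_sum (x y : Cplx H) : D.flow.twistedInner x y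
    = ∑ k, D.flow.twistedInner (e.vec k) y * D.flow.twistedInner x (e.vec k) := by
  conv_lhs => rw [← e.sum_twistedInner_smul y]
  exact D.flow.twistedInner_sum_right _ _ _ _

include e in
theorem twistedInner_conj_symm (x y : Cplx H) :
    conj (D.flow.twistedInner x y) = D.flow.twistedInner y x := by
  conv_rhs => rw [← e.sum_twistedInner_smul y]
  rw [e.twistedInner_eq_sum x y, D.flow.twistedInner_sum_left, map_sum]
  refine Finset.sum_congr rfl fun k _ => ?_
  rw [map_mul]
  congr 1
  conv_lhs => rw [← e.sum_twistedInner_smul x]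
  rw [D.flow.twistedInner_sum_left]
  simp [e.orthonormal]

/-- The covariance `c k l = ⟨J e_k, e_l⟩_U`, where `J` is the complex conjugation. -/
def cov (k l : Fin d) : ℂ := D.flow.twistedInner (e.vec k).conjugate (e.vec l)

theorem conj_cov (k l : Fin d) :
    conj (e.cov k l) = D.flow.twistedInner (e.vec l) (e.vec k).conjugate :=
  e.twistedInner_conj_symm _ _

theorem sum_mul_cov (x : Cplx H) (m : Fin d) :
    ∑ k, D.flow.twistedInner (e.vec k) x * e.cov k m
      = D.flow.twistedInner x.conjugate (e.vec m) := by
  conv_rhs => rw [← e.sum_twistedInner_smul x]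
  rw [Cplx.conjugate_sum]
  simp only [Cplx.conjugate_smul]
  rw [D.flow.twistedInner_sum_left]
  simp [cov]

theorem sum_conj_cov_mul (k m : Fin d) :
    ∑ l, conj (e.cov k l) * e.cov l m = if k = m then 1 else 0 := by
  simp only [e.conj_cov]
  rw [e.sum_mul_cov, Cplx.conjugate_conjugate, e.orthonormal]

/-- The conjugation leaves the complexified summands invariant, so a nonzero covariance forces the
letters to belong to the same summand. -/
theorem color_eq_of_cov_ne_zero {l m : Fin d} (h : e.cov l m ≠ 0) : e.color l = e.color m := by
  classical
  by_contra hne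
  set a : Fin d → ℂ := fun k => D.flow.twistedInner (e.vec k) (e.vec l).conjugate with ha
  have hsum : ∑ k, a k • e.vec k = (e.vec l).conjugate := e.sum_twistedInner_smul _
  -- The part `r` of the conjugate of `e_l` in the other summands vanishes: its real and imaginary
  -- parts belong to the summand of `e_l`, and are orthogonal to it.
  set S := Finset.univ.filter fun k => e.color k = e.color l with hS
  set r : Cplx H := ∑ k ∈ Finset.univ.filter (fun k => ¬ e.color k = e.color l), a k • e.vec k with hr
  have hsplit : ∑ k ∈ S, a k • e.vec k + r = (e.vec l).conjugate := by
    rw [← hsum, hS, hr, Finset.sum_filter_add_sum_filter_not]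
  have hre : ∀ (s : Finset (Fin d)), (∑ k ∈ s, a k • e.vec k).re = ∑ k ∈ s, (a k • e.vec k).re :=
    fun s => map_sum (AddMonoidHom.mk' (fun x : Cplx H => x.re) fun x y => rfl) _ s
  have him : ∀ (s : Finset (Fin d)), (∑ k ∈ s, a k • e.vec k).im = ∑ k ∈ s, (a k • e.vec k).im :=
    fun s => map_sum (AddMonoidHom.mk' (fun x : Cplx H => x.im) fun x y => rfl) _ s
  have hmem : ∀ k, (a k • e.vec k).re ∈ D.summand (e.color k) ∧
      (a k • e.vec k).im ∈ D.summand (e.color k) := fun k =>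
    ⟨Submodule.sub_mem _ (Submodule.smul_mem _ _ (e.re_mem k)) (Submodule.smul_mem _ _ (e.im_mem k)),
      Submodule.add_mem _ (Submodule.smul_mem _ _ (e.im_mem k)) (Submodule.smul_mem _ _ (e.re_mem k))⟩
  have hr' : r = (e.vec l).conjugate - ∑ k ∈ S, a k • e.vec k := by rw [← hsplit]; abel
  have hrre : r.re ∈ D.summand (e.color l) := by
    rw [hr', Cplx.sub_re, hre]
    refine Submodule.sub_mem _ (e.re_mem l) (Submodule.sum_mem _ fun k hk => ?_)
    rw [← (Finset.mem_filter.1 hk).2]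
    exact (hmem k).1
  have hrim : r.im ∈ D.summand (e.color l) := by
    rw [hr', Cplx.sub_im, him]
    refine Submodule.sub_mem _ (Submodule.neg_mem _ (e.im_mem l)) (Submodule.sum_mem _ fun k hk => ?_)
    rw [← (Finset.mem_filter.1 hk).2]
    exact (hmem k).2
  have h0 : r = 0 := by
    ext
    · refine inner_self_eq_zero (𝕜 := ℝ).1 ?_
      conv_lhs => enter [2]; rw [hr, hre]
      rw [sum_inner]
      exact Finset.sum_eq_zero fun k hk => (D.orthogonal (e.color l) (e.color k)
        (Ne.symm (Finset.mem_filter.1 hk).2)).symm.inner_eq (hmem k).1 hrre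
    · refine inner_self_eq_zero (𝕜 := ℝ).1 ?_
      conv_lhs => enter [2]; rw [hr, him]
      rw [sum_inner]
      exact Finset.sum_eq_zero fun k hk => (D.orthogonal (e.color l) (e.color k)
        (Ne.symm (Finset.mem_filter.1 hk).2)).symm.inner_eq (hmem k).2 hrim
  apply h
  have h1 : a m = 0 := by
    have : a m = D.flow.twistedInner (e.vec m) (∑ k ∈ S, a k • e.vec k) := by
      rw [h0, add_zero] at hsplit
      rw [hsplit]
    rw [this, D.flow.twistedInner_sum_right]
    refine Finset.sum_eq_zero fun k hk => ?_
    rw [e.orthonormal, if_neg, mul_zero]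
    rintro rfl
    exact hne (Finset.mem_filter.1 hk).2.symm
  change D.flow.twistedInner (e.vec m) (e.vec l).conjugate = 0 at h1
  rw [← e.conj_cov] at h1
  simpa using h1

/-- The coefficients of the generators of a mixed `q`-Araki-Woods algebra. -/
def twistData : TwistData (Fin d) where
  Q := e.Q
  Q_symm := e.Q_symm
  c := e.cov
  Q_eq l m h k := by rw [Q, Q, e.color_eq_of_cov_ne_zero h]

theorem exists_bounds : ∃ p K, e.twistData.Bounds p K := by
  obtain ⟨q, hq0, hq1, hq⟩ : ∃ q : ℝ, 0 < q ∧ q < 1 ∧ ∀ k l, |e.Q k l| ≤ q := by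
    have h : ∀ z : Fin d × Fin d, ∀ᶠ q in nhdsWithin (1 : ℝ) (Set.Iio 1), |e.Q z.1 z.2| ≤ q :=
      fun z => by
        filter_upwards [Ioo_mem_nhdsLT (D.abs_q_lt_one _ _ : |e.Q z.1 z.2| < 1)] with q hq
        exact hq.1.le
    obtain ⟨q, hq, hq01⟩ := ((Filter.eventually_all.2 h).and
      (Ioo_mem_nhdsLT (zero_lt_one' ℝ))).exists
    exact ⟨q, hq01.1, hq01.2, fun k l => hq (k, l)⟩
  refine ⟨1 - (1 - q) / 8, 1 + ∑ k, ∑ l, ‖e.cov k l‖, by linarith, by linarith, fun k l => ?_, ?_,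
    fun k l => ?_⟩
  · refine (hq k l).trans ?_
    -- By the Bernoulli inequality, `p = 1 - (1 - q) / 8` satisfies `q ≤ p ^ 8`.
    have := one_add_mul_le_pow (a := -((1 - q) / 8)) (by linarith) 8
    rw [← sub_eq_add_neg] at this
    refine le_trans ?_ this
    push_cast
    linarith
  · exact le_add_of_nonneg_right (Finset.sum_nonneg fun _ _ => Finset.sum_nonneg fun _ _ =>
      norm_nonneg _)
  · have h1 : ‖e.cov k l‖ ≤ ∑ l, ‖e.cov k l‖ :=
      Finset.single_le_sum (f := fun l => ‖e.cov k l‖) (fun _ _ => norm_nonneg _) (Finset.mem_univ l)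
    have h2 : ∑ l, ‖e.cov k l‖ ≤ ∑ k, ∑ l, ‖e.cov k l‖ :=
      Finset.single_le_sum (f := fun k => ∑ l, ‖e.cov k l‖)
        (fun _ _ => Finset.sum_nonneg fun _ _ => norm_nonneg _) (Finset.mem_univ k)
    change ‖e.cov k l‖ ≤ _
    linarith

end AdaptedBasis
/-! ### Creation and annihilation are adjoint for the deformed inner product -/

section Permutations

variable {n d : ℕ}

/-- The permutation `σ` with `σ t = 0` and `σ (t.succAbove i) = τ i + 1`. -/
def insertPerm (t : Fin (n + 1)) (τ : Equiv.Perm (Fin n)) : Equiv.Perm (Fin (n + 1)) :=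
  ((finSuccEquiv' t).trans (Equiv.optionCongr τ)).trans (finSuccEquiv' 0).symm

@[simp] theorem insertPerm_self (t : Fin (n + 1)) (τ : Equiv.Perm (Fin n)) :
    insertPerm t τ t = 0 := by
  simp [insertPerm]

@[simp] theorem insertPerm_succAbove (t : Fin (n + 1)) (τ : Equiv.Perm (Fin n)) (i : Fin n) :
    insertPerm t τ (t.succAbove i) = (τ i).succ := by
  simp [insertPerm]

theorem bijective_insertPerm :
    Function.Bijective fun z : Fin (n + 1) × Equiv.Perm (Fin n) => insertPerm z.1 z.2 := by
  refine (Fintype.bijective_iff_injective_and_card _).2 ⟨?_, ?_⟩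
  · rintro ⟨t, τ⟩ ⟨t', τ'⟩ h
    simp only at h
    have ht : t = t' := (insertPerm t' τ').injective (by rw [← h, insertPerm_self, h, insertPerm_self])
    subst ht
    refine Prod.ext rfl (Equiv.ext fun i => ?_)
    have := congrArg (fun σ : Equiv.Perm (Fin (n + 1)) => σ (t.succAbove i)) h
    simpa using this
  · simp [Fintype.card_perm, Nat.factorial_succ]

theorem crossWeight_eq_prod_ite (Q : Fin d → Fin d → ℝ) (σ : Equiv.Perm (Fin n))
    (w : Fin n → Fin d) :
    crossWeight Q σ w = ∏ a, ∏ b, if a < b ∧ σ b < σ a then Q (w a) (w b) else 1 := by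
  rw [crossWeight, Finset.prod_filter, Fintype.prod_prod_type]

/-- The inversions of `insertPerm t τ` are those of `τ`, and those of `t` with the positions before
it. -/
theorem crossWeight_insertPerm (Q : Fin d → Fin d → ℝ) (t : Fin (n + 1))
    (τ : Equiv.Perm (Fin n)) (w : Fin (n + 1) → Fin d) :
    crossWeight Q (insertPerm t τ) w
      = (∏ s ∈ Finset.univ.filter (fun s => s < t), Q (w s) (w t))
        * crossWeight Q τ (t.removeNth w) := by
  rw [crossWeight_eq_prod_ite, crossWeight_eq_prod_ite, Finset.prod_filter,
    Fin.prod_univ_succAbove _ t, Fin.prod_univ_succAbove (fun s => if s < t then Q (w s) (w t) else 1) t]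
  simp only [lt_self_iff_false, if_false, insertPerm_self, not_lt_zero, and_false,
    Finset.prod_const_one, one_mul]
  rw [← Finset.prod_mul_distrib]
  refine Finset.prod_congr rfl fun i _ => ?_
  rw [Fin.prod_univ_succAbove _ t]
  simp [Fin.removeNth]

theorem cons_comp_insertPerm (k : Fin d) (v : Fin n → Fin d) (t : Fin (n + 1))
    (τ : Equiv.Perm (Fin n)) :
    (Fin.cons k v : Fin (n + 1) → Fin d) ∘ insertPerm t τ = t.insertNth k (v ∘ τ) := by
  refine (Fin.insertNth_eq_iff.2 ⟨?_, ?_⟩).symm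
  · simp
  · funext i; simp [Fin.removeNth]

end Permutations

namespace AdaptedBasis

variable {H : Type*} [NormedAddCommGroup H] [InnerProductSpace ℝ H] {N : Type*}
  {D : MixedData H N} {d : ℕ} (e : AdaptedBasis D d)

theorem linearMap_ext_word {M : Type*} [AddCommGroup M] [Module ℂ M] {f g : e.FockAlg →ₗ[ℂ] M}
    (h : ∀ w, f (e.word w) = g (e.word w)) : f = g :=
  Finsupp.lhom_ext' (M := ℂ) fun w => LinearMap.ext_ring (h w)

theorem createAlg_word (k : Fin d) (w : Word d) :
    e.createAlg (e.vec k) (e.word w) = e.word ⟨w.1 + 1, Fin.cons k w.2⟩ := by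
  rw [createAlg, ofWords, word]
  refine (Finsupp.linearCombination_single ℂ 1 w).trans ?_
  simp [e.orthonormal]

theorem createAlg_eq_sum (ξ : Cplx H) :
    e.createAlg ξ = ∑ k, D.flow.twistedInner (e.vec k) ξ • e.createAlg (e.vec k) := by
  refine e.linearMap_ext_word fun w => ?_
  rw [LinearMap.sum_apply]
  simp only [LinearMap.smul_apply, createAlg_word]
  rw [createAlg, ofWords, word]
  exact (Finsupp.linearCombination_single ℂ 1 w).trans (one_smul _ _)

theorem annihilateAlg_word_zero (ξ : Cplx H) (w : Fin 0 → Fin d) :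
    e.annihilateAlg ξ (e.word ⟨0, w⟩) = 0 :=
  (Finsupp.linearCombination_single ℂ 1 _).trans (one_smul _ _)

theorem annihilateAlg_word_succ (ξ : Cplx H) {n : ℕ} (w : Fin (n + 1) → Fin d) :
    e.annihilateAlg ξ (e.word ⟨n + 1, w⟩) = ∑ t : Fin (n + 1),
        (D.flow.twistedInner ξ (e.vec (w t)) *
          ((∏ s ∈ Finset.univ.filter (fun s => s < t), e.Q (w s) (w t) : ℝ) : ℂ)) •
        e.word ⟨n, t.removeNth w⟩ :=
  (Finsupp.linearCombination_single ℂ 1 _).trans (one_smul _ _)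

theorem annihilateAlg_eq_sum (ξ : Cplx H) :
    e.annihilateAlg ξ = ∑ k, D.flow.twistedInner ξ (e.vec k) • e.annihilateAlg (e.vec k) := by
  refine e.linearMap_ext_word fun w => ?_
  rw [LinearMap.sum_apply]
  simp only [LinearMap.smul_apply]
  obtain ⟨_ | n, w⟩ := w
  · simp [annihilateAlg_word_zero]
  · simp only [annihilateAlg_word_succ, Finset.smul_sum, smul_smul]
    rw [Finset.sum_comm]
    refine Finset.sum_congr rfl fun t _ => ?_
    rw [← Finset.sum_smul]
    simp [e.orthonormal]

theorem annihilateAlg_cons (m k : Fin d) {n : ℕ} (w : Fin n → Fin d) :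
    e.annihilateAlg (e.vec m) (e.word ⟨n + 1, Fin.cons k w⟩)
      = (if m = k then e.word ⟨n, w⟩ else 0)
        + (e.Q m k : ℂ) • e.createAlg (e.vec k) (e.annihilateAlg (e.vec m) (e.word ⟨n, w⟩)) := by
  rw [annihilateAlg_word_succ, Fin.sum_univ_succ]
  congr 1
  · simp [e.orthonormal]
  · cases n with
    | zero => simp [annihilateAlg_word_zero]
    | succ n =>
      rw [annihilateAlg_word_succ]
      simp only [map_sum, map_smul, Finset.smul_sum, createAlg_word, smul_smul]
      refine Finset.sum_congr rfl fun t _ => ?_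
      congr 1
      · simp only [Fin.cons_succ, e.orthonormal]
        by_cases h : m = w t
        · subst h
          rw [Finset.prod_filter, Fin.prod_univ_succ, Finset.prod_filter]
          simp [e.Q_symm]
        · simp [h]
      · congr 2
        funext i
        induction i using Fin.cases <;> simp [Fin.removeNth]

theorem word_induction {P : e.FockAlg → Prop} (y : e.FockAlg) (word : ∀ w, P (e.word w))
    (add : ∀ x y, P x → P y → P (x + y)) (smul : ∀ (a : ℂ) x, P x → P (a • x)) : P y := by
  refine Finsupp.induction_linear (motive := P) y ?_ add fun w a => ?_
  · have h := smul 0 _ (word ⟨0, Fin.elim0⟩)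
    rwa [zero_smul] at h
  · have h := smul a _ (word w)
    have h' : a • e.word w = (Finsupp.single w a : FockVec d) :=
      (Finsupp.smul_single a w (1 : ℂ)).trans (by rw [smul_eq_mul, mul_one])
    exact h' ▸ h

/-- The coefficient of a simple tensor. -/
def wordCoeff (w : Word d) : e.FockAlg →ₗ[ℂ] ℂ := Finsupp.lapply (M := ℂ) (R := ℂ) w

theorem wordCoeff_word (v w : Word d) : e.wordCoeff v (e.word w) = if w = v then 1 else 0 := by
  classical
  exact Finsupp.single_apply

/-- The deformed inner product with a simple tensor. -/
def wordForm (w : Word d) : e.FockAlg →ₗ[ℂ] ℂ :=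
  Finsupp.lapply (M := ℂ) (R := ℂ) w ∘ₗ symmetrizer e.Q

theorem wordForm_apply {n : ℕ} (v : Fin n → Fin d) (y : e.FockAlg) : e.wordForm ⟨n, v⟩ y
    = ∑ σ : Equiv.Perm (Fin n), (crossWeight e.Q σ (v ∘ ⇑σ) : ℂ) * e.wordCoeff ⟨n, v ∘ ⇑σ⟩ y :=
  symmetrizer_apply e.Q y v

theorem deformedForm_word (w : Word d) (y : e.FockAlg) :
    deformedForm e.Q (e.word w) y = e.wordForm w y := by
  refine (Finsupp.sum_single_index (h := fun v a => conj a * e.wordForm v y) (by simp)).trans ?_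
  rw [map_one, one_mul]

/-- The coefficient at `u` of the annihilation of the letter `k` collects the coefficients at the words
which arise from `u` by inserting `k`. -/
theorem wordCoeff_annihilateAlg (k : Fin d) (y : e.FockAlg) {n : ℕ} (u : Fin n → Fin d) :
    e.wordCoeff ⟨n, u⟩ (e.annihilateAlg (e.vec k) y)
      = ∑ t : Fin (n + 1), ((∏ s ∈ Finset.univ.filter (fun s => s < t),
          e.Q ((t.insertNth k u : Fin (n + 1) → Fin d) s) k : ℝ) : ℂ)
          * e.wordCoeff ⟨n + 1, t.insertNth k u⟩ y := by
  induction y using e.word_induction with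
  | word w =>
    obtain ⟨_ | m, w⟩ := w
    · rw [annihilateAlg_word_zero, map_zero]
      simp [wordCoeff_word]
    · rw [annihilateAlg_word_succ, map_sum]
      simp only [map_smul, wordCoeff_word, e.orthonormal]
      by_cases hm : m = n
      · subst hm
        refine Finset.sum_congr rfl fun t _ => ?_
        by_cases h : w = t.insertNth k u
        · subst h
          simp
        · have h' : ¬ (k = w t ∧ t.removeNth w = u) := by
            rintro ⟨rfl, rfl⟩
            exact h (by simp)
          by_cases hk : k = w t
          · have : t.removeNth w ≠ u := fun h1 => h' ⟨hk, h1⟩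
            simp [this, h]
          · simp [hk, h]
      · rw [Finset.sum_eq_zero fun t _ => ?_, Finset.sum_eq_zero fun t _ => ?_]
        · rw [if_neg, mul_zero]
          intro h
          exact hm (by simpa using congrArg Sigma.fst h)
        · rw [if_neg fun h => hm (congrArg Sigma.fst h), smul_zero]
  | add x y hx hy => simp only [map_add, hx, hy, mul_add, Finset.sum_add_distrib]
  | smul a x hx =>
    simp only [map_smul, hx, Finset.smul_sum]
    refine Finset.sum_congr rfl fun t _ => ?_
    rw [smul_eq_mul, smul_eq_mul]
    ring

/-- The creation operator of a letter is adjoint to the annihilation operator, coefficientwise: the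
permutations of `n + 1` letters are enumerated by the position of the letter which is moved to the
front. -/
theorem wordForm_cons (k : Fin d) (y : e.FockAlg) {n : ℕ} (v : Fin n → Fin d) :
    e.wordForm ⟨n + 1, Fin.cons k v⟩ y = e.wordForm ⟨n, v⟩ (e.annihilateAlg (e.vec k) y) := by
  rw [wordForm_apply, wordForm_apply]
  simp only [wordCoeff_annihilateAlg, Finset.mul_sum]
  rw [Finset.sum_comm, ← Fintype.sum_prod_type', ← bijective_insertPerm.sum_comp]
  refine Finset.sum_congr rfl fun z _ => ?_
  rw [cons_comp_insertPerm, crossWeight_insertPerm]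
  simp only [Fin.insertNth_apply_same, Fin.removeNth_insertNth]
  push_cast
  ring

theorem inner_createAlg (k : Fin d) (x y : e.FockAlg) :
    deformedForm e.Q (e.createAlg (e.vec k) x) y
      = deformedForm e.Q x (e.annihilateAlg (e.vec k) y) := by
  induction x using e.word_induction with
  | word w => rw [createAlg_word, deformedForm_word, deformedForm_word, wordForm_cons]
  | add x x' hx hx' =>
    rw [map_add]
    refine (freeForm_add_left _ _ _).trans (Eq.trans ?_ (freeForm_add_left _ _ _).symm)
    exact congrArg₂ _ hx hx'
  | smul a x hx =>
    rw [map_smul]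
    refine (freeForm_smul_left _ _ _).trans (Eq.trans ?_ (freeForm_smul_left _ _ _).symm)
    exact congrArg _ hx

/-- The simple tensors indexed by lists of letters, as vectors of the algebraic Fock space. -/
def ofLists : FreeFock (Fin d) →ₗ[ℂ] e.FockAlg :=
  onWords fun w => e.word (List.equivSigmaTuple w)

theorem equivSigmaTuple_nil : List.equivSigmaTuple ([] : List (Fin d)) = ⟨0, Fin.elim0⟩ :=
  Sigma.ext rfl (heq_of_eq (funext fun i : Fin 0 => i.elim0))

theorem equivSigmaTuple_cons (k : Fin d) (w : List (Fin d)) : List.equivSigmaTuple (k :: w)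
    = ⟨(List.equivSigmaTuple w).1 + 1, Fin.cons k (List.equivSigmaTuple w).2⟩ := by
  refine Sigma.ext rfl (heq_of_eq ?_)
  funext i
  induction i using Fin.cases <;> rfl

theorem surjective_ofLists : Function.Surjective e.ofLists := by
  intro y
  induction y using e.word_induction with
  | word w => exact ⟨tens (List.equivSigmaTuple.symm w), by
    rw [ofLists, onWords_tens, Equiv.apply_symm_apply]⟩
  | add x y hx hy =>
    obtain ⟨x, rfl⟩ := hx
    obtain ⟨y, rfl⟩ := hy
    exact ⟨x + y, map_add _ _ _⟩
  | smul a x hx =>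
    obtain ⟨x, rfl⟩ := hx
    exact ⟨a • x, map_smul _ _ _⟩

theorem createAlg_ofLists (k : Fin d) (x : FreeFock (Fin d)) :
    e.createAlg (e.vec k) (e.ofLists x) = e.ofLists (MixedArakiWoods.create k x) := by
  induction x using tens_induction with
  | tens w => rw [create_tens, ofLists, onWords_tens, onWords_tens, equivSigmaTuple_cons, createAlg_word]
  | add x y hx hy => simp only [map_add, hx, hy]
  | smul a x hx => simp only [map_smul, hx]

theorem annihilateAlg_ofLists (k : Fin d) (x : FreeFock (Fin d)) :
    e.annihilateAlg (e.vec k) (e.ofLists x) = e.ofLists (e.twistData.annihilate k x) := by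
  induction x using tens_induction with
  | tens w =>
    induction w with
    | nil =>
      rw [TwistData.annihilate_vacuum, map_zero, ofLists, onWords_tens]
      exact e.annihilateAlg_word_zero _ _
    | cons j w ih =>
      have h1 : e.ofLists (tens (j :: w)) = e.word ⟨_, Fin.cons j (List.equivSigmaTuple w).2⟩ := by
        rw [ofLists, onWords_tens, equivSigmaTuple_cons]
      have h2 : e.ofLists (tens w) = e.word ⟨_, (List.equivSigmaTuple w).2⟩ := by
        rw [ofLists, onWords_tens]
      rw [h1, annihilateAlg_cons, ← h2, ih, createAlg_ofLists, ← create_tens,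
        TwistData.annihilate_create, map_add, map_smul]
      congr 1
      split_ifs <;> simp
  | add x y hx hy => simp only [map_add, hx, hy]
  | smul a x hx => simp only [map_smul, hx]

/-- The `T`-deformed Fock space as a completion of the algebraic Fock space over lists. -/
def fockRep : FockRep e.twistData e.Fock where
  incl := e.incl ∘ₗ e.ofLists
  dense := (UniformSpace.Completion.denseRange_coe (α := e.FockAlg)).comp
    e.surjective_ofLists.denseRange (UniformSpace.Completion.continuous_coe e.FockAlg)
  inner_vacuum := by
    refine (UniformSpace.Completion.inner_coe (𝕜 := ℂ) _ _).trans ?_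
    change deformedForm e.Q _ _ = 1
    rw [ofLists, onWords_tens, deformedForm_word, equivSigmaTuple_nil, wordForm_apply]
    simp [crossWeight, wordCoeff_word, Subsingleton.elim (Fin.elim0 ∘ _) (Fin.elim0 : Fin 0 → Fin d)]
  inner_create k x y := by
    refine (UniformSpace.Completion.inner_coe (𝕜 := ℂ) _ _).trans
      (Eq.trans ?_ (UniformSpace.Completion.inner_coe (𝕜 := ℂ) _ _).symm)
    rw [← annihilateAlg_ofLists, ← createAlg_ofLists]
    exact e.inner_createAlg k _ _
  sum_conj_c_mul := e.sum_conj_cov_mul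

end AdaptedBasis
/-! ### The generators of the mixed q-Araki-Woods algebra -/

namespace AdaptedBasis

open FockRep

variable {H : Type*} [NormedAddCommGroup H] [InnerProductSpace ℝ H] {N : Type*}
  {D : MixedData H N} {d : ℕ} (e : AdaptedBasis D d) {p K : ℝ}

theorem fockRep_incl (x : FreeFock (Fin d)) : e.fockRep.incl x = e.incl (e.ofLists x) := rfl

theorem fockRep_Ω : e.fockRep.Ω = e.vacuum := by
  rw [Ω, fockRep_incl, ofLists, onWords_tens, equivSigmaTuple_nil]
  rfl

theorem letter_eq (k : Fin d) : e.letter k = e.fockRep.incl (tens [k]) := by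
  rw [fockRep_incl, ofLists, onWords_tens, equivSigmaTuple_cons, equivSigmaTuple_nil, letter]
  congr 3
  funext i
  induction i using Fin.cases with
  | zero => rfl
  | succ i => exact i.elim0

theorem extend_incl {f : e.FockAlg →ₗ[ℂ] e.FockAlg} {g : Module.End ℂ (FreeFock (Fin d))}
    (hg : e.fockRep.IsBdd g) (hf : ∀ x, f (e.ofLists x) = e.ofLists (g x))
    (x : FreeFock (Fin d)) : e.extend f (e.fockRep.incl x) = e.fockRep.incl (g x) := by
  obtain ⟨C, hC⟩ := hg
  rw [fockRep_incl, fockRep_incl, ← hf]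
  refine LinearMap.extendOfNorm_eq (f := e.incl ∘ₗ f) (e := e.incl)
    (UniformSpace.Completion.denseRange_coe (α := e.FockAlg)) ⟨C, fun y => ?_⟩ _
  obtain ⟨x, rfl⟩ := e.surjective_ofLists y
  rw [LinearMap.comp_apply, hf]
  exact hC x

/-- The operators `a(ξ) + a*(ξ)` are linear combinations of the `A_k`. -/
theorem annihilate_add_create (hb : e.twistData.Bounds p K) (ξ : H) :
    e.annihilate (Cplx.ofReal ξ) + e.create (Cplx.ofReal ξ)
      = ∑ k, D.flow.twistedInner (e.vec k) (Cplx.ofReal ξ) • e.fockRep.A k := by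
  refine ext_of_incl (R := e.fockRep) fun x => ?_
  have h1 := e.extend_incl (f := e.annihilateAlg (Cplx.ofReal ξ))
    (IsBdd.sum (R := e.fockRep) (s := Finset.univ) fun m _ => (isBdd_annihilate hb m).smul
      (D.flow.twistedInner (Cplx.ofReal ξ) (e.vec m)))
    (fun x => by
      rw [annihilateAlg_eq_sum]
      simp only [LinearMap.sum_apply, LinearMap.smul_apply, annihilateAlg_ofLists, map_sum, map_smul])
    x
  have h2 := e.extend_incl (f := e.createAlg (Cplx.ofReal ξ))
    (IsBdd.sum (R := e.fockRep) (s := Finset.univ) fun m _ => (isBdd_create hb m).smul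
      (D.flow.twistedInner (e.vec m) (Cplx.ofReal ξ)))
    (fun x => by
      rw [createAlg_eq_sum]
      simp only [LinearMap.sum_apply, LinearMap.smul_apply, createAlg_ofLists, map_sum, map_smul])
    x
  have h3 : ∀ m, D.flow.twistedInner (Cplx.ofReal ξ) (e.vec m)
      = ∑ k, D.flow.twistedInner (e.vec k) (Cplx.ofReal ξ) * e.cov k m := fun m => by
    rw [e.sum_mul_cov, Cplx.conjugate_ofReal]
  have h4 : (∑ k, D.flow.twistedInner (e.vec k) (Cplx.ofReal ξ) • e.fockRep.A k) (e.fockRep.incl x)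
      = e.fockRep.incl
        (∑ k, D.flow.twistedInner (e.vec k) (Cplx.ofReal ξ) • e.twistData.gen k x) := by
    simp [A_incl hb]
  rw [add_apply, annihilate, create, h1, h2, ← map_add, h4]
  congr 1
  simp only [LinearMap.sum_apply, LinearMap.smul_apply, TwistData.gen_apply, smul_add,
    Finset.sum_add_distrib, TwistData.lower_apply, h3, Finset.sum_smul, Finset.smul_sum, smul_smul]
  rw [add_comm, Finset.sum_comm]
  rfl

theorem A_mem_algebra (hb : e.twistData.Bounds p K) (k : Fin d) : e.fockRep.A k ∈ e.algebra := by
  -- Since `a + a*` is real linear in `ξ`, the operator `A_k` is its value at the real part of `e_k`,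
  -- plus `i` times its value at the imaginary part.
  have h : ∀ ξ : H, e.annihilate (Cplx.ofReal ξ) + e.create (Cplx.ofReal ξ) ∈ e.algebra :=
    fun ξ => subset_vonNeumannGenerated ⟨ξ, rfl⟩
  have e1 : e.fockRep.A k = (e.annihilate (Cplx.ofReal (e.vec k).re)
      + e.create (Cplx.ofReal (e.vec k).re))
      + Complex.I • (e.annihilate (Cplx.ofReal (e.vec k).im)
      + e.create (Cplx.ofReal (e.vec k).im)) := by
    rw [e.annihilate_add_create hb, e.annihilate_add_create hb, Finset.smul_sum,
      ← Finset.sum_add_distrib]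
    have h2 : ∀ l, D.flow.twistedInner (e.vec l) (Cplx.ofReal (e.vec k).re)
        + Complex.I * D.flow.twistedInner (e.vec l) (Cplx.ofReal (e.vec k).im)
        = if l = k then 1 else 0 := fun l => by
      rw [← e.orthonormal, Cplx.eq_ofReal_add (e.vec k)]
      have := D.flow.twistedInner_sum_right Finset.univ (e.vec l) ![1, Complex.I]
        ![Cplx.ofReal (e.vec k).re, Cplx.ofReal (e.vec k).im]
      simpa [Cplx.ofReal] using this.symm
    simp only [smul_smul, ← add_smul, h2]
    simp
  rw [e1]
  exact add_mem (s := e.algebra.toStarSubalgebra) (h _) (e.algebra.toStarSubalgebra.smul_mem (h _) _)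

/-- An operator which commutes with the `A_k` is in the commutant of `M_T`. -/
theorem commute_algebra (hb : e.twistData.Bounds p K) {Z x : e.Fock →L[ℂ] e.Fock}
    (hZ : ∀ l, e.fockRep.A l * Z = Z * e.fockRep.A l) (hx : x ∈ e.algebra) : Z * x = x * Z := by
  refine commute_of_mem_vonNeumannGenerated hx ?_
  rintro _ ⟨ξ, rfl⟩
  simp only [e.annihilate_add_create hb, star_sum, star_smul, star_A hb, Finset.sum_mul,
    Finset.mul_sum, smul_mul_assoc, mul_smul_comm, Finset.smul_sum, hZ, and_self]

/-- The generator `W(e_k)` is `A_k`: the vacuum is separating for `M_T`, since it is cyclic for the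
commutant. -/
theorem gen_eq (hb : e.twistData.Bounds p K) : e.gen = e.fockRep.A := by
  funext k
  have hA : e.fockRep.A k e.vacuum = e.letter k := by
    rw [← fockRep_Ω, Ω, A_incl hb, letter_eq, TwistData.gen_apply]
    simp
  have hex : ∃ x ∈ e.algebra, x e.vacuum = e.letter k := ⟨_, e.A_mem_algebra hb k, hA⟩
  -- `gen k` is chosen among the elements of `M_T` with value `e_k` at the vacuum, which exist.
  have hgen : e.gen k = hex.choose := dif_pos hex
  obtain ⟨h1, h2⟩ := hex.choose_spec
  rw [← hgen] at h1 h2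
  refine ext_of_incl (R := e.fockRep) fun v => ?_
  obtain ⟨Z, hZ, hv⟩ := exists_commutant (R := e.fockRep) hb v
  rw [← hv, ← mul_apply_eq_comp, ← mul_apply_eq_comp, ← e.commute_algebra hb hZ h1, hZ,
    mul_apply_eq_comp, mul_apply_eq_comp, fockRep_Ω, h2, hA]

theorem state_gen_mul_gen (hb : e.twistData.Bounds p K) (l k : Fin d) :
    e.state (e.gen l * e.gen k) = e.cov l k := by
  rw [state, e.gen_eq hb, mul_apply_eq_comp, ← fockRep_Ω]
  conv_lhs => enter [3]; rw [Ω, A_incl hb, A_incl hb]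
  rw [inner_Ω_incl]
  have h : e.twistData.gen k (tens []) = MixedArakiWoods.create k (tens []) := by
    rw [TwistData.gen_apply, TwistData.lower_vacuum, add_zero]
  rw [h, TwistData.gen_apply, TwistData.lower_create, TwistData.lower_vacuum]
  simp [coeff_tens_self, coeff_tens_of_ne]
  rfl

theorem polyAlg_eq (hb : e.twistData.Bounds p K) :
    e.polyAlg = StarAlgebra.adjoin ℂ (Set.range e.fockRep.A) := by
  rw [polyAlg, e.gen_eq hb]

theorem poly_mem_polyAlg (hb : e.twistData.Bounds p K) (x : FreeFock (Fin d)) :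
    e.fockRep.poly x ∈ e.polyAlg := by
  rw [e.polyAlg_eq hb]
  exact (mem_adjoin_iff hb).2 ⟨x, rfl⟩

theorem exists_poly_eq (hb : e.twistData.Bounds p K) (a : e.polyAlg) :
    ∃ x, a = ⟨e.fockRep.poly x, e.poly_mem_polyAlg hb x⟩ := by
  obtain ⟨x, hx⟩ := (mem_adjoin_iff hb).1 ((SetLike.ext_iff.1 (e.polyAlg_eq hb) _).1 a.2)
  exact ⟨x, Subtype.ext hx.symm⟩

theorem poly_mem_algebra (hb : e.twistData.Bounds p K) (x : FreeFock (Fin d)) :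
    e.fockRep.poly x ∈ e.algebra := by
  have h : e.polyAlg ≤ e.algebra.toStarSubalgebra := by
    rw [e.polyAlg_eq hb]
    refine StarAlgebra.adjoin_le ?_
    rintro _ ⟨k, rfl⟩
    exact e.A_mem_algebra hb k
  exact h (e.poly_mem_polyAlg hb x)

/-! ### The Lipschitz conjugate system -/

theorem oneTensor_eq : e.oneTensor
    = (stdTensorModel e.Fock).ketBra e.fockRep.Ω e.fockRep.Ω := by
  rw [fockRep_Ω]; rfl

theorem dq_mem_tensorAlgebra (hb : e.twistData.Bounds p K) (k : Fin d) (x : FreeFock (Fin d)) :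
    e.fockRep.dq (stdTensorModel e.Fock) k x ∈ e.tensorAlgebra := by
  have h1 : (1 : e.Fock →L[ℂ] e.Fock) ∈ e.algebra := one_mem e.algebra.toStarSubalgebra
  have h2 : ∀ a ∈ e.algebra, ∀ b ∈ e.algebra, tensorOp a b ∈ e.tensorAlgebra :=
    fun a ha b hb => subset_vonNeumannGenerated ⟨a, ha, b, hb, rfl⟩
  exact dq_mem k (fun l => h2 _ (e.A_mem_algebra hb l) _ h1)
    (fun x => h2 _ h1 _ (e.poly_mem_algebra hb x)) x

theorem IsDiffQuotient.isDq (hb : e.twistData.Bounds p K) {k : Fin d}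
    {δ : e.polyAlg →ₗ[ℂ] (e.L2Tensor →L[ℂ] e.L2Tensor)} (h : e.IsDiffQuotient k δ) :
    e.fockRep.IsDq (stdTensorModel e.Fock) e.polyAlg k δ where
  leibniz := h.leibniz
  gen l hl := by
    have h1 := h.gen l
    rw [e.state_gen_mul_gen hb] at h1
    refine Eq.trans ?_ h1
    congr 1
    exact Subtype.ext (congrFun (e.gen_eq hb) l).symm

theorem IsDiffQuotient.apply_poly (hb : e.twistData.Bounds p K) {k : Fin d}
    {δ : e.polyAlg →ₗ[ℂ] (e.L2Tensor →L[ℂ] e.L2Tensor)} (h : e.IsDiffQuotient k δ)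
    (x : FreeFock (Fin d)) : δ ⟨e.fockRep.poly x, e.poly_mem_polyAlg hb x⟩
      = e.fockRep.dq (stdTensorModel e.Fock) k x :=
  (h.isDq e hb).apply_poly (e.poly_mem_polyAlg hb) x

theorem exists_isDiffQuotient (hb : e.twistData.Bounds p K) (k : Fin d) :
    ∃ δ, e.IsDiffQuotient k δ := by
  obtain ⟨δ, h, hδ⟩ := exists_isDq (T := stdTensorModel e.Fock) hb (e.polyAlg_eq hb) k
  refine ⟨δ, fun x => ?_, h.leibniz, fun l => ?_⟩
  · obtain ⟨y, -, hy⟩ := hδ x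
    rw [hy]
    exact e.dq_mem_tensorAlgebra hb k y
  · have hl : e.fockRep.A l ∈ e.polyAlg := e.gen_eq hb ▸ (e.polyGen l).2
    have h1 : e.polyGen l = ⟨e.fockRep.A l, hl⟩ := Subtype.ext (congrFun (e.gen_eq hb) l)
    rw [h1, e.state_gen_mul_gen hb]
    exact h.gen l hl

theorem mem_graph_unboundedOp (hb : e.twistData.Bounds p K) {k : Fin d}
    {δ : e.polyAlg →ₗ[ℂ] (e.L2Tensor →L[ℂ] e.L2Tensor)} (h : e.IsDiffQuotient k δ)
    (z : e.Fock × e.L2Tensor) : z ∈ (e.unboundedOp δ).graph ↔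
      ∃ x, z = (e.fockRep.incl x, e.fockRep.dq (stdTensorModel e.Fock) k x
        ((stdTensorModel e.Fock).ketBra e.fockRep.Ω e.fockRep.Ω)) := by
  rw [unboundedOp, e.oneTensor_eq, ← fockRep_Ω]
  exact mem_graph_iff_exists (T := stdTensorModel e.Fock) hb (e.poly_mem_polyAlg hb)
    (e.exists_poly_eq hb) (h.apply_poly e hb) z

theorem IsDualSystem.apply_incl (hb : e.twistData.Bounds p K)
    {Δ : Fin d → (e.Fock →ₗ.[ℂ] e.Fock)} (hΔ : e.IsDualSystem Δ) (k : Fin d)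
    (x : FreeFock (Fin d)) : Δ k ⟨e.fockRep.incl x, hΔ.mem_domain k _⟩
      = e.fockRep.incl (e.twistData.dualOp k x) := by
  refine dual_apply_incl hb (fun x => hΔ.mem_domain k (e.ofLists x)) (fun l x => ?_) ?_ x
  · have h := hΔ.commutator k l (e.ofLists x)
    rw [e.state_gen_mul_gen hb, e.gen_eq hb, ← fockRep_Ω] at h
    exact h
  · have h := hΔ.vacuum_eq_zero k
    refine Eq.trans ?_ h
    congr 1
    exact Subtype.ext e.fockRep_Ω

/-- The conjugate variable of a dual system. -/
theorem IsDualSystem.inner_adjoint (hb : e.twistData.Bounds p K)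
    {Δ : Fin d → (e.Fock →ₗ.[ℂ] e.Fock)} (hΔ : e.IsDualSystem Δ) (k : Fin d)
    (x : FreeFock (Fin d)) :
    inner ℂ ((Δ k).adjoint ⟨e.vacuum, hΔ.vacuum_mem_adjoint k⟩) (e.fockRep.incl x)
      = coeff [] (e.twistData.dualOp k x) := by
  have hΩ : e.fockRep.Ω ∈ (Δ k).adjoint.domain := e.fockRep_Ω ▸ hΔ.vacuum_mem_adjoint k
  have h := inner_adjoint_vacuum (R := e.fockRep) (fun x => hΔ.mem_domain k (e.ofLists x))
    (hΔ.apply_incl e hb k) hΩ x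
  have h1 : (⟨e.vacuum, hΔ.vacuum_mem_adjoint k⟩ : (Δ k).adjoint.domain)
      = ⟨e.fockRep.Ω, hΩ⟩ := Subtype.ext e.fockRep_Ω.symm
  rw [h1]
  exact h

theorem exists_isDualSystem (hb : e.twistData.Bounds p K) : ∃ Δ, e.IsDualSystem Δ := by
  have hdom : ∀ k x, e.incl x ∈ (e.fockRep.dualPMap hb k).domain := fun k x => by
    obtain ⟨x, rfl⟩ := e.surjective_ofLists x
    exact ⟨x, rfl⟩
  refine ⟨e.fockRep.dualPMap hb, hdom, fun k => ?_, fun k l x => ?_, fun k => ?_⟩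
  · rw [← fockRep_Ω]
    exact vacuum_mem_adjoint_dualPMap (stdTensorModel e.Fock) hb k
  · obtain ⟨x, rfl⟩ := e.surjective_ofLists x
    have h1 : e.gen l (e.incl (e.ofLists x)) = e.fockRep.incl (e.twistData.gen l x) := by
      rw [e.gen_eq hb]; exact A_incl hb l x
    have hm : e.gen l (e.incl (e.ofLists x)) ∈ (e.fockRep.dualPMap hb k).domain := h1 ▸ hdom k _
    have h2 : e.fockRep.dualPMap hb k ⟨e.gen l (e.incl (e.ofLists x)), hm⟩
        = e.fockRep.dualPMap hb k ⟨e.fockRep.incl (e.twistData.gen l x), hdom k _⟩ := by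
      congr 1; exact Subtype.ext h1
    have h3 := dualPMap_apply (R := e.fockRep) hb k x (hdom k _)
    have h4 := h2.trans (dualPMap_apply (R := e.fockRep) hb k _ (hdom k _))
    refine ⟨hm, (congrArg₂ (fun v w => v - e.gen l w) h4 h3).trans ?_⟩
    rw [e.state_gen_mul_gen hb, e.gen_eq hb, A_incl hb, TwistData.dualOp_gen, map_add,
      add_sub_cancel_left, map_smul, mul_smul, ← inner_Ω_incl (R := e.fockRep), ← fockRep_Ω]
    rfl
  · have h := dualPMap_apply (R := e.fockRep) hb k (tens []) (hdom k _)
    rw [TwistData.dualOp_vacuum, map_zero] at h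
    refine Eq.trans ?_ h
    congr 1
    exact Subtype.ext e.fockRep_Ω.symm

end AdaptedBasis

end MixedArakiWoods

open MixedArakiWoods FockRep in
theorem corollary3p7 {H : Type*} [NormedAddCommGroup H] [InnerProductSpace ℝ H]
    [FiniteDimensional ℝ H] {N : Type*} [Finite N] (D : MixedArakiWoods.MixedData H N) {d : ℕ}
    (e : MixedArakiWoods.AdaptedBasis D d) :
    (∃! δ : Fin d → (e.polyAlg →ₗ[ℂ] (e.L2Tensor →L[ℂ] e.L2Tensor)),
      ∀ k, e.IsDiffQuotient k (δ k)) ∧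
    (∃ Δ : Fin d → (e.Fock →ₗ.[ℂ] e.Fock), e.IsDualSystem Δ) ∧
    ∀ (δ : Fin d → (e.polyAlg →ₗ[ℂ] (e.L2Tensor →L[ℂ] e.L2Tensor)))
      (Δ : Fin d → (e.Fock →ₗ.[ℂ] e.Fock)),
      (∀ k, e.IsDiffQuotient k (δ k)) → ∀ hΔ : e.IsDualSystem Δ,
      (∀ k, e.IsConjugateVariable (δ k)
        ((Δ k).adjoint ⟨e.vacuum, hΔ.vacuum_mem_adjoint k⟩)) ∧
      e.IsLipschitz δ fun k => (Δ k).adjoint ⟨e.vacuum, hΔ.vacuum_mem_adjoint k⟩ := by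
  obtain ⟨p, K, hb⟩ := e.exists_bounds
  refine ⟨?_, e.exists_isDualSystem hb, fun δ Δ hδ hΔ => ⟨fun k a => ?_, fun k => ?_⟩⟩
  · choose δ hδ using e.exists_isDiffQuotient hb
    refine ⟨δ, hδ, fun δ' hδ' => funext fun k => LinearMap.ext fun a => ?_⟩
    obtain ⟨x, rfl⟩ := e.exists_poly_eq hb a
    rw [(hδ' k).apply_poly e hb, (hδ k).apply_poly e hb]
  · obtain ⟨x, rfl⟩ := e.exists_poly_eq hb a
    rw [(hδ k).apply_poly e hb, e.oneTensor_eq]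
    refine Eq.trans ?_ (inner_vacuum_dq hb k x).symm
    rw [← hΔ.inner_adjoint e hb k x, ← poly_Ω hb, e.fockRep_Ω]
  · have hcl : (e.unboundedOp (δ k)).IsClosable :=
      isClosable (T := stdTensorModel e.Fock) hb (hΔ.inner_adjoint e hb k)
        fun z hz => (e.mem_graph_unboundedOp hb (hδ k) z).1 hz
    refine ⟨hcl, fun l => ?_⟩
    rw [e.oneTensor_eq]
    exact exists_closure_apply (T := stdTensorModel e.Fock) hb (hΔ.inner_adjoint e hb l) hcl
      (fun x => (e.mem_graph_unboundedOp hb (hδ k) _).2 ⟨x, rfl⟩)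
      (isClosed_vonNeumannGenerated _) (e.dq_mem_tensorAlgebra hb k)

end
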